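/- **Setting.** Let $E=\{-1,0,1\}$, $\beta>0$, and let $\alpha$ be a probability measure on $E$ with $\alpha(1)=\alpha(-1)>0$ and $\alpha(0)>0$ (a symmetric a priori measure). The Curie–Weiss Widom–Rowlinson model is the sequence of probability measures on $E^N$ $$\mu_{N}(\omega)=\frac1{Z_{N}}\exp\Bigl(-\frac{\beta}{2N}\sum_{i,j=1}^N \mathbf 1(\omega_i\omega_j=-1)\Bigr)\prod_{j=1}^N\alpha(\omega_j),$$ and its time evolution is $\mu_{t,N}(\eta)=\sum_{\omega}\mu_{N}(\omega)\prod_{i}p_t(\omega_i,\eta_i)$ with $$p_t(a,b)=\tfrac12(1+e^{-2t})\mathbf 1_{a=b\ne0}+\tfrac12(1-e^{-2t})\mathbf 1_{ab=-1}+\mathbf 1_{a=b=0}.$$ A sequence $(\mu_N)$ of exchangeable probability measures on $E^N$ is *sequentially Gibbs* if for every probability measure $\nu$ on $E$ the limit $\lim_N\mu_N(\,\cdot\mid\omega_{[2,N]})$ of the conditional distributions of the first spin exists, and is the same, for all sequences of conditionings $\omega_{[2,N]}\in E^{N-1}$ whose empirical measures converge to $\nu$. The measure $\nu$ is *bad*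 if two such sequences of conditionings give different limits. Let $B_t$ be the set of bad empirical measures of $(\mu_{t,N})_N$; it is a subset of the simplex of probability measures on $E$. The *axis* is the set of $\nu$ with $\nu(1)=\nu(-1)$, the *bottom edge* is the set of $\nu$ with $\nu(0)=0$, and *mirror image* refers to exchanging $\nu(1)$ and $\nu(-1)$. An *arm* is a simple curve, with its starting point and without its end point, along which $\nu(0)$ strictly increases and which lies in $\{\nu(-1)<\nu(1)\}$ except possibly for its starting point (its end point lies in this set too). **Theorem.** 1. If $\beta\le 2$, then $(\mu_{t,N})_N$ is sequentially Gibbs for all $t\ge0$. 2. If $2<\beta\le3$, then for $t\ge 0$ the sequence $(\mu_{t,N})_N$ is sequentially Gibbs if and only if $t\le t_c:=-\frac14\log(1-\frac2\beta)$. For $t>t_c$ the set $B_t$ is a nondegenerate segment of the axis that starts on the bottom edge (and does not contain its other endpoint), with length strictly increasing in $t$. 3. If $\beta>3$, there are times $0<t_1(\beta)<t_2(\beta)<t_3:=\frac{\log 3}{4}$, depending on $\beta$ only, such that for every symmetric $\alpha$: - for $t\ge0$ the sequence $(\mu_{t,N})_N$ is sequentially Gibbs if and only if $t\le t_1(\beta)$;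 - a pair of bad measures appears at $t_1(\beta)$: as $t\downarrow t_1(\beta)$, $B_t$ converges in Hausdorff distance to a pair of distinct, mutually mirror-image points; - for $t_1(\beta)<t<t_2(\beta)$, $B_t$ consists of two disconnected curves: an arm starting on the bottom edge and its mirror image, with disjoint closures; - at $t=t_2(\beta)$ the two curves touch: $B_t$ is the union of an arm and its mirror image which both start at the midpoint of the bottom edge; - for $t_2(\beta)<t<t_3$, $B_t$ is Y-shaped: it is the union of a nondegenerate segment of the axis starting on the bottom edge and of an arm and its mirror image that both start at the upper end of this segment; - for $t\ge t_3$, $B_t$ is a nondegenerate segment of the axis that starts on the bottom edge (and does not contain its other endpoint), with length strictly increasing in $t$. -/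

import Mathlib

open Set Filter Topology

noncomputable section

namespace WidomRowlinson

/-- Unnormalised weight of `ω` at system size `N`. The single-site space `{-1, 0, 1}` is `SignType`,
and measures on it (or on its powers) are given by their mass functions. -/
def weight (β : ℝ) (α : SignType → ℝ) (N : ℕ) (ω : Fin N → SignType) : ℝ :=
  Real.exp (-(β / (2 * N)) * ∑ i, ∑ j, if ω i * ω j = -1 then 1 else 0) * ∏ j, α (ω j)

/-- The partition function. -/
def partitionFunction (β : ℝ) (α : SignType → ℝ) (N : ℕ) : ℝ :=
  ∑ ω : Fin N → SignType, weight β α N ω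

/-- The finite-volume Gibbs measure of the Curie-Weiss Widom-Rowlinson model. -/
def gibbs (β : ℝ) (α : SignType → ℝ) (N : ℕ) (ω : Fin N → SignType) : ℝ :=
  weight β α N ω / partitionFunction β α N

/-- Single-site transition kernel of the symmetric spin-flip dynamics, holes being fixed. -/
def spinFlip (t : ℝ) (a b : SignType) : ℝ :=
  1 / 2 * (1 + Real.exp (-2 * t)) * (if a = b ∧ b ≠ 0 then 1 else 0)
    + 1 / 2 * (1 - Real.exp (-2 * t)) * (if a * b = -1 then 1 else 0)
    + (if a = b ∧ b = 0 then 1 else 0)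

/-- The time-evolved measure on `N` sites. -/
def evolved (β : ℝ) (α : SignType → ℝ) (t : ℝ) (N : ℕ) (η : Fin N → SignType) : ℝ :=
  ∑ ω : Fin N → SignType, gibbs β α N ω * ∏ i, spinFlip t (ω i) (η i)

/-- Empirical measure of a configuration on `n` sites. -/
def empirical {n : ℕ} (η : Fin n → SignType) (e : SignType) : ℝ :=
  ((Finset.univ.filter fun i => η i = e).card : ℝ) / n

/-- Conditional distribution of the first of `N = n + 1` spins, given the other `n` spins. -/
def condProb (μ : (N : ℕ) → (Fin N → SignType) → ℝ) {n : ℕ} (η : Fin n → SignType)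
    (e : SignType) : ℝ :=
  μ (n + 1) (Fin.cons e η) / ∑ e' : SignType, μ (n + 1) (Fin.cons e' η)

/-- The sequential Gibbs property of a sequence of (exchangeable) measures. The conditioning
`ω n` lives on `n = N - 1` sites. -/
def SeqGibbs (μ : (N : ℕ) → (Fin N → SignType) → ℝ) : Prop :=
  ∀ ν ∈ stdSimplex ℝ SignType, ∃ γ : SignType → ℝ,
    ∀ ω : (n : ℕ) → Fin n → SignType,
      Tendsto (fun n => empirical (ω n)) atTop (𝓝 ν) →
      Tendsto (fun n => condProb μ (ω n)) atTop (𝓝 γ)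

/-- The set of bad empirical measures. -/
def badSet (μ : (N : ℕ) → (Fin N → SignType) → ℝ) : Set (SignType → ℝ) :=
  {ν | ν ∈ stdSimplex ℝ SignType ∧
    ∃ ω ω' : (n : ℕ) → Fin n → SignType, ∃ γ γ' : SignType → ℝ,
      Tendsto (fun n => empirical (ω n)) atTop (𝓝 ν) ∧
      Tendsto (fun n => empirical (ω' n)) atTop (𝓝 ν) ∧
      Tendsto (fun n => condProb μ (ω n)) atTop (𝓝 γ) ∧
      Tendsto (fun n => condProb μ (ω' n)) atTop (𝓝 γ') ∧ γ ≠ γ'}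

/-- Symmetric, nondegenerate a priori measures. -/
def IsSymmetricApriori (α : SignType → ℝ) : Prop :=
  α ∈ stdSimplex ℝ SignType ∧ α 1 = α (-1) ∧ 0 < α 1 ∧ 0 < α 0

/-- Reflection of the simplex at its axis of symmetry: exchange of the two spins. -/
def mirror (ν : SignType → ℝ) : SignType → ℝ := fun e => ν (-e)

/-- The point with hole density `r` on the axis of symmetry of the simplex. -/
def symPoint (r : ℝ) : SignType → ℝ := fun e => if e = 0 then r else (1 - r) / 2

/-- For times `t ∈ I`, the sets `B t` are nondegenerate segments of the axis of symmetry that start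
on the edge without holes (the other endpoint is excluded), and their length increases strictly. -/
def IsGrowingLine (B : ℝ → Set (SignType → ℝ)) (I : Set ℝ) : Prop :=
  ∃ r : ℝ → ℝ, StrictMonoOn r I ∧ ∀ t ∈ I, 0 < r t ∧ B t = symPoint '' Ico 0 (r t)

/-- `c` parametrises, on `[0, 1]`, a simple curve along which the hole density increases strictly,
and which lies, apart possibly from its starting point, strictly on one side of the axis. -/
def IsArm (c : ℝ → SignType → ℝ) : Prop :=
  ContinuousOn c (Icc 0 1) ∧ StrictMonoOn (fun s => c s 0) (Icc 0 1) ∧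
    ∀ s ∈ Ioc (0 : ℝ) 1, c s (-1) < c s 1

/-- The arm without its end point, together with its mirror image. -/
def armPair (c : ℝ → SignType → ℝ) : Set (SignType → ℝ) :=
  c '' Ico 0 1 ∪ mirror '' (c '' Ico 0 1)

/-- Two disconnected curves: they are mirror images of each other, start on the edge without
holes, and even their closures are disjoint. -/
def IsTwoCurves (B : Set (SignType → ℝ)) : Prop :=
  ∃ c : ℝ → SignType → ℝ, IsArm c ∧ c 0 0 = 0 ∧ B = armPair c ∧
    Disjoint (closure (c '' Ico 0 1)) (closure (mirror '' (c '' Ico 0 1)))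

/-- Two mirror-image curves that touch in their common starting point, the midpoint of the edge
without holes, and nowhere else. -/
def IsTouchingCurves (B : Set (SignType → ℝ)) : Prop :=
  ∃ c : ℝ → SignType → ℝ, IsArm c ∧ c 0 = symPoint 0 ∧ B = armPair c

/-- Y-shape: a nondegenerate stem on the axis, starting on the edge without holes, and two
mirror-image arms that branch off from its upper end. -/
def IsYShaped (B : Set (SignType → ℝ)) : Prop :=
  ∃ r : ℝ, 0 < r ∧ ∃ c : ℝ → SignType → ℝ, IsArm c ∧ c 0 = symPoint r ∧
    B = symPoint '' Icc 0 r ∪ armPair c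

end WidomRowlinson

end

/-!
# Gibbs-non Gibbs transitions of the Curie-Weiss Widom-Rowlinson model under spin flips

Holes do not move, so given the evolved configuration the interaction acts on the remaining spins
only, as a mean-field Ising interaction. A Gaussian auxiliary field `y` linearises it
(`evolved_eq`), and given `y` the sites are independent. The conditional distribution of the first
spin, given the others with empirical measure `ν`, is therefore a ratio of Laplace integrals, whose
limit is determined by the global minimisers of a rate function `rate` depending on `ν`. A unique
minimiser gives a limit that does not depend on the conditioning sequence (`tendsto_condProb`). If
there are several, then moving a little mass between the spins `1` and `-1` selects the largest or
the smallest minimiser, and these give different limits (`RateTwo.mem_badSet`). Hence the bad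
measures are those at which the rate function has several minimisers (`badSet_evolved`). At time
zero the rate function is a parabola, and there are none.

For `t > 0` put `K = coth (2 t)`, `S = 1 / sinh (2 t)`, `b = β (ν 1 + ν (-1))` and
`D = S β (ν 1 - ν (-1))`. Up to a constant the rate function is then
`pot K b D y = y ^ 2 / 2 - b log (K + cosh y) - D area K y`, with a derivative of the sign of
`slope K b y - D`, where `slope K b y = y (K + cosh y) - b sinh y` is odd in `y`. On `y > 0` the
slope is convex if `b ≤ 3`; if `b > 3` it is first concave and then convex, with the inflection
point `m` given by `b = inflLevel m = 2 + m coth m`, where its derivative is `K - critK m`. So it is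
monotone, and minimisers are unique, if `b ≤ min 3 (K + 1)` or `critK m ≤ K` (`Monotonic`).

Several minimisers with `D = 0` exist iff `pot K b 0` is somewhere as small as at zero (`AxisBad`).
This is a monotone condition on `b` and `K`: it reads `K + 1 < b` if `K ≤ 2` or `b ≤ 3`, whereas for
`K > 2` it reads `B ≤ b` for some `B < K + 1` (`exists_axisBad_threshold`). Several minimisers with
`D > 0` exist iff `critK m > K`, there is no coexistence at `D = 0`, and `D` is the unique value for
which there is a minimiser on each side of `m` (`Coexist`). Existence of this value follows from
connectedness, uniqueness from the monotonicity of minimisers in `D`, and both together give its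
continuous dependence on `m` (`continuousOn_of_coexist`). So `m` parametrises the arm of the bad
set. The first transition time is given by `K = critK m` with `inflLevel m = β`, the second one by
the largest `K` for which `AxisBad K β` holds, and the third one by `K = 2`.
-/

namespace WidomRowlinson

/-! ### Shape of the slope -/

lemma sinh_lt_mul_cosh {y : ℝ} (hy : 0 < y) : Real.sinh y < y * Real.cosh y := by
  have hm : StrictMonoOn (fun y : ℝ => y * Real.cosh y - Real.sinh y) (Ici 0) := by
    apply strictMonoOn_of_deriv_pos (convex_Ici 0) (by fun_prop)
    intro x hx
    rw [interior_Ici] at hx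
    have h : HasDerivAt (fun y : ℝ => y * Real.cosh y - Real.sinh y)
        (1 * Real.cosh x + x * Real.sinh x - Real.cosh x) x :=
      ((hasDerivAt_id x).mul (Real.hasDerivAt_cosh x)).sub (Real.hasDerivAt_sinh x)
    rw [h.deriv]
    have : 0 < x * Real.sinh x := mul_pos hx (Real.sinh_pos_iff.2 hx)
    linarith
  have := hm (mem_Ici.2 le_rfl) (mem_Ici.2 hy.le) hy
  simp at this
  linarith

lemma lt_sinh_mul_cosh {y : ℝ} (hy : 0 < y) : y < Real.sinh y * Real.cosh y := by
  have h1 := Real.self_lt_sinh_iff.2 hy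
  have h2 := Real.one_le_cosh y
  nlinarith

/-- The unnormalised derivative of the potential: the stationary points of `pot K b D` solve
`slope K b y = D`. -/
noncomputable def slope (K b y : ℝ) : ℝ := y * (K + Real.cosh y) - b * Real.sinh y

/-- The derivative of `slope K b`. -/
noncomputable def slopeDeriv (K b y : ℝ) : ℝ :=
  K + Real.cosh y + y * Real.sinh y - b * Real.cosh y

/-- The value of `b` for which `slope K b` has its positive inflection point at `m`. -/
noncomputable def inflLevel (m : ℝ) : ℝ := 2 + m * Real.cosh m / Real.sinh m

/-- The value of `K` for which the slope at its inflection point `m` is stationary. -/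
noncomputable def critK (m : ℝ) : ℝ := Real.cosh m + m / Real.sinh m

lemma hasDerivAt_slope (K b y : ℝ) : HasDerivAt (slope K b) (slopeDeriv K b y) y := by
  have h : HasDerivAt (slope K b)
      (1 * (K + Real.cosh y) + y * Real.sinh y - b * Real.cosh y) y :=
    ((hasDerivAt_id y).mul ((Real.hasDerivAt_cosh y).const_add K)).sub
      ((Real.hasDerivAt_sinh y).const_mul b)
  convert h using 1
  unfold slopeDeriv; ring

lemma hasDerivAt_slopeDeriv (K b y : ℝ) :
    HasDerivAt (slopeDeriv K b) ((2 - b) * Real.sinh y + y * Real.cosh y) y := by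
  have h : HasDerivAt (slopeDeriv K b)
      (Real.sinh y + (1 * Real.sinh y + y * Real.cosh y) - b * Real.sinh y) y :=
    (((Real.hasDerivAt_cosh y).const_add K).add
      ((hasDerivAt_id y).mul (Real.hasDerivAt_sinh y))).sub ((Real.hasDerivAt_cosh y).const_mul b)
  convert h using 1
  ring

@[fun_prop]
lemma continuous_slope (K b : ℝ) : Continuous (slope K b) := by unfold slope; fun_prop

@[fun_prop]
lemma continuous_slopeDeriv (K b : ℝ) : Continuous (slopeDeriv K b) := by
  unfold slopeDeriv; fun_prop

@[simp] lemma slope_zero (K b : ℝ) : slope K b 0 = 0 := by simp [slope]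

lemma continuousOn_inflLevel : ContinuousOn inflLevel (Ioi 0) := by
  unfold inflLevel
  refine continuousOn_const.add (ContinuousOn.div (by fun_prop) (by fun_prop) ?_)
  intro x hx
  exact (Real.sinh_pos_iff.2 hx).ne'

lemma continuousOn_critK : ContinuousOn critK (Ioi 0) := by
  unfold critK
  refine ContinuousOn.add (by fun_prop) (ContinuousOn.div (by fun_prop) (by fun_prop) ?_)
  intro x hx
  exact (Real.sinh_pos_iff.2 hx).ne'

lemma strictMonoOn_inflLevel : StrictMonoOn inflLevel (Ioi 0) := by
  apply strictMonoOn_of_deriv_pos (convex_Ioi 0) continuousOn_inflLevel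
  intro x hx
  rw [interior_Ioi] at hx
  have hs : 0 < Real.sinh x := Real.sinh_pos_iff.2 hx
  have h : HasDerivAt inflLevel
      (((1 * Real.cosh x + x * Real.sinh x) * Real.sinh x - (x * Real.cosh x) * Real.cosh x)
        / Real.sinh x ^ 2) x :=
    ((((hasDerivAt_id x).mul (Real.hasDerivAt_cosh x)).div (Real.hasDerivAt_sinh x)
      hs.ne').const_add 2)
  rw [h.deriv]
  apply div_pos _ (by positivity)
  have h1 := lt_sinh_mul_cosh hx
  have h2 : (1 * Real.cosh x + x * Real.sinh x) * Real.sinh x - (x * Real.cosh x) * Real.cosh x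
      = Real.sinh x * Real.cosh x - x := by
    linear_combination (-x) * Real.cosh_sq x
  linarith

lemma strictMonoOn_critK : StrictMonoOn critK (Ioi 0) := by
  apply strictMonoOn_of_deriv_pos (convex_Ioi 0) continuousOn_critK
  intro x hx
  rw [interior_Ioi] at hx
  have hs : 0 < Real.sinh x := Real.sinh_pos_iff.2 hx
  have h : HasDerivAt critK
      (Real.sinh x + (1 * Real.sinh x - x * Real.cosh x) / Real.sinh x ^ 2) x :=
    (Real.hasDerivAt_cosh x).add ((hasDerivAt_id x).div (Real.hasDerivAt_sinh x) hs.ne')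
  rw [h.deriv]
  have h1 := lt_sinh_mul_cosh hx
  have h2 := Real.cosh_sq x
  have h3 : Real.sinh x + (1 * Real.sinh x - x * Real.cosh x) / Real.sinh x ^ 2
      = Real.cosh x * (Real.sinh x * Real.cosh x - x) / Real.sinh x ^ 2 := by
    field_simp
    linear_combination (-Real.sinh x) * h2
  rw [h3]
  have := Real.cosh_pos x
  have : 0 < Real.sinh x * Real.cosh x - x := by linarith
  positivity

lemma three_lt_inflLevel {m : ℝ} (hm : 0 < m) : 3 < inflLevel m := by
  have hs : 0 < Real.sinh m := Real.sinh_pos_iff.2 hm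
  have : 1 < m * Real.cosh m / Real.sinh m := by
    rw [one_lt_div hs]; exact sinh_lt_mul_cosh hm
  unfold inflLevel; linarith

lemma cosh_lt_critK {m : ℝ} (hm : 0 < m) : Real.cosh m < critK m := by
  have hs : 0 < Real.sinh m := Real.sinh_pos_iff.2 hm
  have : 0 < m / Real.sinh m := by positivity
  unfold critK; linarith

lemma exists_cosh_eq {x : ℝ} (hx : 1 < x) : ∃ m, 0 < m ∧ Real.cosh m = x := by
  refine ⟨Real.arcosh x, ?_, Real.cosh_arcosh hx.le⟩
  rcases (Real.arcosh_nonneg hx.le).eq_or_lt with h | h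
  · have := Real.cosh_arcosh hx.le
    rw [← h] at this
    simp at this
    linarith
  · exact h

lemma exists_inflLevel_eq {b : ℝ} (hb : 3 < b) : ∃ m, 0 < m ∧ inflLevel m = b := by
  obtain ⟨a, ha, hca⟩ := exists_cosh_eq (x := b - 2) (by linarith)
  have hlow : inflLevel a ≤ b := by
    have hs : 0 < Real.sinh a := Real.sinh_pos_iff.2 ha
    have : a * Real.cosh a / Real.sinh a ≤ Real.cosh a := by
      rw [div_le_iff₀ hs]
      have := Real.self_lt_sinh_iff.2 ha
      have := Real.cosh_pos a
      nlinarith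
    unfold inflLevel; linarith
  have hb0 : 0 < b := by linarith
  have hup : b ≤ inflLevel b := by
    have hs : 0 < Real.sinh b := Real.sinh_pos_iff.2 hb0
    have : b ≤ b * Real.cosh b / Real.sinh b := by
      rw [le_div_iff₀ hs]
      have := Real.sinh_lt_cosh b
      nlinarith
    unfold inflLevel; linarith
  obtain ⟨m, hm, h⟩ := isPreconnected_Ioi.intermediate_value (mem_Ioi.2 ha) (mem_Ioi.2 hb0)
    continuousOn_inflLevel ⟨hlow, hup⟩
  exact ⟨m, hm, h⟩

lemma exists_critK_eq {K : ℝ} (hK : 2 < K) : ∃ m, 0 < m ∧ critK m = K := by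
  obtain ⟨a, ha, hca⟩ := exists_cosh_eq (x := K - 1) (by linarith)
  obtain ⟨c, hc, hcc⟩ := exists_cosh_eq (x := K) (by linarith)
  have hlow : critK a ≤ K := by
    have hs : 0 < Real.sinh a := Real.sinh_pos_iff.2 ha
    have : a / Real.sinh a ≤ 1 := by
      rw [div_le_one hs]
      exact (Real.self_lt_sinh_iff.2 ha).le
    unfold critK; linarith
  have hup : K ≤ critK c := hcc ▸ (cosh_lt_critK hc).le
  obtain ⟨m, hm, h⟩ := isPreconnected_Ioi.intermediate_value (mem_Ioi.2 ha) (mem_Ioi.2 hc)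
    continuousOn_critK ⟨hlow, hup⟩
  exact ⟨m, hm, h⟩

lemma slopeDeriv_inflLevel (K : ℝ) {m : ℝ} (hm : 0 < m) :
    slopeDeriv K (inflLevel m) m = K - critK m := by
  have hs : 0 < Real.sinh m := Real.sinh_pos_iff.2 hm
  unfold slopeDeriv inflLevel critK
  field_simp
  linear_combination (-m) * Real.cosh_sq m

lemma second_slope_eq {m y : ℝ} (hy : 0 < y) :
    (2 - inflLevel m) * Real.sinh y + y * Real.cosh y
      = (inflLevel y - inflLevel m) * Real.sinh y := by
  have hs : 0 < Real.sinh y := Real.sinh_pos_iff.2 hy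
  have : y * Real.cosh y = (inflLevel y - 2) * Real.sinh y := by
    unfold inflLevel; field_simp; ring
  rw [this]; ring

lemma strictAntiOn_slopeDeriv (K : ℝ) {m : ℝ} (hm : 0 < m) :
    StrictAntiOn (slopeDeriv K (inflLevel m)) (Icc 0 m) := by
  apply strictAntiOn_of_deriv_neg (convex_Icc 0 m) (by fun_prop)
  intro x hx
  rw [interior_Icc] at hx
  rw [(hasDerivAt_slopeDeriv _ _ _).deriv, second_slope_eq hx.1]
  have := strictMonoOn_inflLevel (mem_Ioi.2 hx.1) (mem_Ioi.2 hm) hx.2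
  exact mul_neg_of_neg_of_pos (by linarith) (Real.sinh_pos_iff.2 hx.1)

lemma strictMonoOn_slopeDeriv (K : ℝ) {m : ℝ} (hm : 0 < m) :
    StrictMonoOn (slopeDeriv K (inflLevel m)) (Ici m) := by
  apply strictMonoOn_of_deriv_pos (convex_Ici m) (by fun_prop)
  intro x hx
  rw [interior_Ici] at hx
  have hx0 : 0 < x := hm.trans hx
  rw [(hasDerivAt_slopeDeriv _ _ _).deriv, second_slope_eq hx0]
  have := strictMonoOn_inflLevel (mem_Ioi.2 hm) (mem_Ioi.2 hx0) hx
  exact mul_pos (by linarith) (Real.sinh_pos_iff.2 hx0)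

lemma strictMonoOn_slopeDeriv_of_le_three (K : ℝ) {b : ℝ} (hb : b ≤ 3) :
    StrictMonoOn (slopeDeriv K b) (Ici 0) := by
  apply strictMonoOn_of_deriv_pos (convex_Ici 0) (by fun_prop)
  intro x hx
  rw [interior_Ici] at hx
  rw [(hasDerivAt_slopeDeriv _ _ _).deriv]
  have := sinh_lt_mul_cosh hx
  have hs : 0 < Real.sinh x := Real.sinh_pos_iff.2 hx
  nlinarith

lemma slopeDeriv_zero (K b : ℝ) : slopeDeriv K b 0 = K + 1 - b := by
  simp [slopeDeriv]

/-- The parameters for which `slope K b` is strictly increasing, so that no double minimum can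
occur. -/
def Monotonic (K b : ℝ) : Prop :=
  (b ≤ 3 ∧ b ≤ K + 1) ∨ ∃ m, 0 < m ∧ b = inflLevel m ∧ critK m ≤ K

lemma strictMonoOn_slope_of_slopeDeriv_pos {K b : ℝ} {s : Set ℝ} (hs : Convex ℝ s)
    (h : ∀ y ∈ interior s, 0 < slopeDeriv K b y) : StrictMonoOn (slope K b) s := by
  apply strictMonoOn_of_deriv_pos hs (by fun_prop)
  intro x hx
  rw [(hasDerivAt_slope _ _ _).deriv]
  exact h x hx

lemma Monotonic.strictMonoOn {K b : ℝ} (h : Monotonic K b) : StrictMonoOn (slope K b) (Ici 0) := by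
  rcases h with ⟨h3, hK⟩ | ⟨m, hm, rfl, hK⟩
  · apply strictMonoOn_slope_of_slopeDeriv_pos (convex_Ici 0)
    intro y hy
    rw [interior_Ici] at hy
    have := strictMonoOn_slopeDeriv_of_le_three K h3 (mem_Ici.2 le_rfl) (mem_Ici.2 hy.le) hy
    rw [slopeDeriv_zero] at this
    linarith
  · have h0 : 0 ≤ slopeDeriv K (inflLevel m) m := by rw [slopeDeriv_inflLevel K hm]; linarith
    have h1 : StrictMonoOn (slope K (inflLevel m)) (Icc 0 m) := by
      apply strictMonoOn_slope_of_slopeDeriv_pos (convex_Icc 0 m)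
      intro y hy
      rw [interior_Icc] at hy
      have := strictAntiOn_slopeDeriv K hm ⟨hy.1.le, hy.2.le⟩ ⟨hm.le, le_rfl⟩ hy.2
      linarith
    have h2 : StrictMonoOn (slope K (inflLevel m)) (Ici m) := by
      apply strictMonoOn_slope_of_slopeDeriv_pos (convex_Ici m)
      intro y hy
      rw [interior_Ici] at hy
      have := strictMonoOn_slopeDeriv K hm (mem_Ici.2 le_rfl) (mem_Ici.2 hy.le) hy
      linarith
    have := h1.union h2 (isGreatest_Icc hm.le) isLeast_Ici
    rwa [Icc_union_Ici_eq_Ici hm.le] at this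

/-! ### Minimisers of the potential on the half-line -/

/-- The odd primitive of `1 / (K + cosh)`. It is the increasing function of `y` to which the
difference of the two spin densities couples. -/
noncomputable def area (K y : ℝ) : ℝ := ∫ z in (0 : ℝ)..y, (K + Real.cosh z)⁻¹

lemma add_cosh_pos {K : ℝ} (hK : 0 < K) (y : ℝ) : 0 < K + Real.cosh y :=
  add_pos hK (Real.cosh_pos y)

lemma hasDerivAt_area {K : ℝ} (hK : 0 < K) (y : ℝ) :
    HasDerivAt (area K) (K + Real.cosh y)⁻¹ y := by
  have hc : Continuous fun z : ℝ => (K + Real.cosh z)⁻¹ :=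
    Continuous.inv₀ (by fun_prop) fun z => (add_cosh_pos hK z).ne'
  exact (hc.integral_hasStrictDerivAt 0 y).hasDerivAt

@[simp] lemma area_zero (K : ℝ) : area K 0 = 0 := by simp [area]

lemma area_neg (K y : ℝ) : area K (-y) = -area K y := by
  have h := intervalIntegral.integral_comp_neg (a := 0) (b := y)
    (fun z : ℝ => (K + Real.cosh z)⁻¹)
  simp only [Real.cosh_neg, neg_zero] at h
  unfold area
  rw [h, intervalIntegral.integral_symm]

lemma strictMono_area {K : ℝ} (hK : 0 < K) : StrictMono (area K) := by
  apply strictMono_of_deriv_pos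
  intro y
  rw [(hasDerivAt_area hK y).deriv]
  exact inv_pos.2 (add_cosh_pos hK y)

lemma continuous_area {K : ℝ} (hK : 0 < K) : Continuous (area K) :=
  continuous_iff_continuousAt.2 fun y => (hasDerivAt_area hK y).continuousAt

/-- The potential whose global minimisers govern the conditional distributions. The parameter `b`
is `β` times the density of the spins `±1`, and `D` is proportional to the difference of the
densities of the two spins. -/
noncomputable def pot (K b D y : ℝ) : ℝ :=
  y ^ 2 / 2 - b * Real.log (K + Real.cosh y) - D * area K y

lemma hasDerivAt_pot {K : ℝ} (hK : 0 < K) (b D y : ℝ) :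
    HasDerivAt (pot K b D) ((slope K b y - D) / (K + Real.cosh y)) y := by
  have hp := add_cosh_pos hK y
  have h : HasDerivAt (pot K b D)
      ((2 : ℕ) * y ^ (2 - 1) * 1 / 2 - b * (Real.sinh y / (K + Real.cosh y))
        - D * (K + Real.cosh y)⁻¹) y :=
    ((((hasDerivAt_id y).pow 2).div_const 2).sub
      ((((Real.hasDerivAt_cosh y).const_add K).log hp.ne').const_mul b)).sub
      ((hasDerivAt_area hK y).const_mul D)
  convert h using 1
  unfold slope
  field_simp
  norm_num
  ring

lemma continuous_pot {K : ℝ} (hK : 0 < K) :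
    Continuous fun x : ℝ × ℝ × ℝ => pot K x.1 x.2.1 x.2.2 := by
  have h1 : Continuous fun x : ℝ × ℝ × ℝ => Real.log (K + Real.cosh x.2.2) :=
    Continuous.log (by fun_prop) fun x => (add_cosh_pos hK _).ne'
  have h2 : Continuous fun x : ℝ × ℝ × ℝ => area K x.2.2 :=
    (continuous_area hK).comp (by fun_prop)
  unfold pot
  fun_prop

lemma continuous_pot_right {K : ℝ} (hK : 0 < K) (b D : ℝ) : Continuous (pot K b D) :=
  continuous_iff_continuousAt.2 fun y => (hasDerivAt_pot hK b D y).continuousAt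

lemma pot_neg (K b D y : ℝ) : pot K b (-D) (-y) = pot K b D y := by
  simp [pot, area_neg]

lemma pot_sub (K b D D' y : ℝ) : pot K b D' y = pot K b D y - (D' - D) * area K y := by
  unfold pot; ring

lemma pot_lt_of_slope_lt {K b D u v : ℝ} (hK : 0 < K) (huv : u < v)
    (h : ∀ y ∈ Ioo u v, slope K b y < D) : pot K b D v < pot K b D u := by
  refine strictAntiOn_of_deriv_neg (convex_Icc u v) (continuous_pot_right hK b D).continuousOn ?_
    ⟨le_rfl, huv.le⟩ ⟨huv.le, le_rfl⟩ huv
  intro y hy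
  rw [interior_Icc] at hy
  rw [(hasDerivAt_pot hK b D y).deriv]
  exact div_neg_of_neg_of_pos (by linarith [h y hy]) (add_cosh_pos hK y)

lemma pot_lt_of_lt_slope {K b D u v : ℝ} (hK : 0 < K) (huv : u < v)
    (h : ∀ y ∈ Ioo u v, D < slope K b y) : pot K b D u < pot K b D v := by
  refine strictMonoOn_of_deriv_pos (convex_Icc u v) (continuous_pot_right hK b D).continuousOn ?_
    ⟨le_rfl, huv.le⟩ ⟨huv.le, le_rfl⟩ huv
  intro y hy
  rw [interior_Icc] at hy
  rw [(hasDerivAt_pot hK b D y).deriv]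
  exact div_pos (by linarith [h y hy]) (add_cosh_pos hK y)

/-- `y` minimises the potential on the half-line `[0, ∞)`. -/
def HalfMin (K b D y : ℝ) : Prop := 0 ≤ y ∧ ∀ z, 0 ≤ z → pot K b D y ≤ pot K b D z

lemma isClosed_halfMin {K : ℝ} (hK : 0 < K) :
    IsClosed {x : ℝ × ℝ × ℝ | HalfMin K x.1 x.2.1 x.2.2} := by
  have : {x : ℝ × ℝ × ℝ | HalfMin K x.1 x.2.1 x.2.2} = {x | 0 ≤ x.2.2} ∩
      ⋂ z : ℝ, ⋂ _ : 0 ≤ z, {x | pot K x.1 x.2.1 x.2.2 ≤ pot K x.1 x.2.1 z} := by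
    ext x; simp [HalfMin]
  rw [this]
  refine (isClosed_le (by fun_prop) (by fun_prop)).inter (isClosed_iInter fun z =>
    isClosed_iInter fun _ => isClosed_le (continuous_pot hK) ?_)
  exact (continuous_pot hK).comp (g := fun x : ℝ × ℝ × ℝ => pot K x.1 x.2.1 x.2.2)
    (f := fun x : ℝ × ℝ × ℝ => (x.1, x.2.1, z)) (by fun_prop)

lemma HalfMin.le_slope {K b D y : ℝ} (hK : 0 < K) (h : HalfMin K b D y) : D ≤ slope K b y := by
  by_contra! hlt
  have hev : {z | slope K b z < D} ∈ 𝓝 y :=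
    (continuous_slope K b).continuousAt.eventually_lt continuousAt_const hlt
  obtain ⟨v, hv, hsub⟩ := exists_Ico_subset_of_mem_nhds hev ⟨y + 1, by linarith⟩
  have := pot_lt_of_slope_lt hK hv fun z hz => hsub ⟨hz.1.le, hz.2⟩
  exact absurd (h.2 v (h.1.trans hv.le)) (not_le.2 this)

lemma HalfMin.slope_eq {K b D y : ℝ} (hK : 0 < K) (hD : 0 ≤ D) (h : HalfMin K b D y) :
    slope K b y = D := by
  refine le_antisymm ?_ (h.le_slope hK)
  rcases h.1.eq_or_lt with h0 | h0
  · rw [← h0]; simpa using hD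
  by_contra! hlt
  have hev : {z | D < slope K b z} ∈ 𝓝 y :=
    continuousAt_const.eventually_lt (continuous_slope K b).continuousAt hlt
  obtain ⟨l, hl, hsub⟩ := exists_Ioc_subset_of_mem_nhds' hev h0
  have := pot_lt_of_lt_slope hK hl.2 fun z hz => hsub ⟨hz.1, hz.2.le⟩
  exact absurd (h.2 l hl.1) (not_le.2 this)

/-- The second order condition at a minimiser. -/
lemma HalfMin.slopeDeriv_nonneg {K b D y : ℝ} (hK : 0 < K) (hD : 0 ≤ D) (h : HalfMin K b D y) :
    0 ≤ slopeDeriv K b y := by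
  by_contra! hlt
  have hev : {z | slopeDeriv K b z < 0} ∈ 𝓝 y :=
    (continuous_slopeDeriv K b).continuousAt.eventually_lt continuousAt_const hlt
  obtain ⟨v, hv, hsub⟩ := exists_Ico_subset_of_mem_nhds hev ⟨y + 1, by linarith⟩
  have hanti : StrictAntiOn (slope K b) (Icc y v) := by
    apply strictAntiOn_of_deriv_neg (convex_Icc y v) (by fun_prop)
    intro z hz
    rw [interior_Icc] at hz
    rw [(hasDerivAt_slope K b z).deriv]
    exact hsub ⟨hz.1.le, hz.2⟩
  have := pot_lt_of_slope_lt (D := D) (b := b) hK hv fun z hz => by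
    have := hanti ⟨le_rfl, hv.le⟩ ⟨hz.1.le, hz.2.le⟩ hz.1
    rwa [h.slope_eq hK hD] at this
  exact absurd (h.2 v (h.1.trans hv.le)) (not_le.2 this)

lemma HalfMin.mono {K b D D' y y' : ℝ} (hK : 0 < K) (hD : D < D') (h : HalfMin K b D y)
    (h' : HalfMin K b D' y') : y ≤ y' := by
  have h1 := h.2 y' h'.1
  have h2 := h'.2 y h.1
  rw [pot_sub K b D, pot_sub K b D D' y] at h2
  have h3 : 0 ≤ (D' - D) * (area K y' - area K y) := by linarith
  have h4 := nonneg_of_mul_nonneg_right h3 (by linarith)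
  exact (strictMono_area hK).le_iff_le.1 (by linarith)

lemma lt_slope_of_large {K b D y : ℝ} (hb : 0 ≤ b) (hy : b ≤ y) (hD : D < K * y) :
    D < slope K b y := by
  unfold slope
  have h1 := Real.sinh_lt_cosh y
  have h2 := Real.cosh_pos y
  nlinarith

lemma exists_halfMin {K : ℝ} (hK : 0 < K) {b : ℝ} (hb : 0 ≤ b) (D : ℝ) :
    ∃ y, HalfMin K b D y := by
  set R := max b ((|D| + 1) / K) with hR
  have hR0 : 0 ≤ R := hb.trans (le_max_left _ _)
  obtain ⟨y, hy, hmin⟩ := isCompact_Icc.exists_isMinOn (nonempty_Icc.2 hR0)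
    (continuous_pot_right hK b D).continuousOn
  refine ⟨y, hy.1, fun z hz => ?_⟩
  rcases le_or_gt z R with hzR | hzR
  · exact hmin ⟨hz, hzR⟩
  · refine (hmin ⟨hR0, le_rfl⟩).trans (pot_lt_of_lt_slope hK hzR fun w hw => ?_).le
    apply lt_slope_of_large hb ((le_max_left _ _).trans hw.1.le)
    have : (|D| + 1) / K ≤ w := (le_max_right _ _).trans hw.1.le
    rw [div_le_iff₀ hK] at this
    have := le_abs_self D
    linarith

lemma HalfMin.le_of_le {K b D L y : ℝ} (hK : 0 < K) (hb : 0 ≤ b) (hD : 0 ≤ D) (hL : D ≤ L)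
    (h : HalfMin K b D y) : y ≤ max b (L / K) := by
  by_contra! hlt
  have h1 : b ≤ y := (le_max_left _ _).trans hlt.le
  have h2 : L / K < y := (le_max_right _ _).trans_lt hlt
  rw [div_lt_iff₀ hK] at h2
  have := lt_slope_of_large (K := K) (D := D) hb h1 (by linarith)
  rw [h.slope_eq hK hD] at this
  exact lt_irrefl _ this

/-- The symmetric potential is, somewhere away from zero, at most as large as at zero. -/
def AxisBad (K b : ℝ) : Prop := ∃ y, 0 < y ∧ pot K b 0 y ≤ pot K b 0 0

lemma AxisBad.exists_halfMin {K b : ℝ} (hK : 0 < K) (hb : 0 ≤ b) (h : AxisBad K b) :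
    ∃ y, 0 < y ∧ HalfMin K b 0 y := by
  obtain ⟨y, hy⟩ := WidomRowlinson.exists_halfMin hK hb 0
  rcases hy.1.eq_or_lt with rfl | h0
  · obtain ⟨z, hz, hle⟩ := h
    exact ⟨z, hz, hz.le, fun w hw => hle.trans (hy.2 w hw)⟩
  · exact ⟨y, h0, hy⟩

lemma Monotonic.not_axisBad {K b : ℝ} (hK : 0 < K) (h : Monotonic K b) : ¬ AxisBad K b := by
  rintro ⟨y, hy, hle⟩
  refine absurd hle (not_le.2 (pot_lt_of_lt_slope hK hy fun w hw => ?_))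
  have := h.strictMonoOn (mem_Ici.2 le_rfl) (mem_Ici.2 hw.1.le) hw.1
  simpa using this

lemma HalfMin.inflection_le {K m y : ℝ} (hK : 0 < K) (hm : 0 < m) (hy : 0 < y)
    (h : HalfMin K (inflLevel m) 0 y) : m < y := by
  by_contra! hle
  have h1 : StrictMonoOn (slope K (inflLevel m)) (Icc 0 y) := by
    apply strictMonoOn_slope_of_slopeDeriv_pos (convex_Icc 0 y)
    intro z hz
    rw [interior_Icc] at hz
    have := strictAntiOn_slopeDeriv K hm ⟨hz.1.le, hz.2.le.trans hle⟩ ⟨hy.le, hle⟩ hz.2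
    linarith [h.slopeDeriv_nonneg hK le_rfl]
  have := h1 ⟨le_rfl, hy.le⟩ ⟨hy.le, le_rfl⟩ hy
  rw [h.slope_eq hK le_rfl] at this
  simp at this

/-- Coexistence of a minimiser below and of one above the inflection point `m` of the slope. -/
def Coexist (K m D : ℝ) : Prop :=
  ∃ y₁ y₂, y₁ ≤ m ∧ m ≤ y₂ ∧ HalfMin K (inflLevel m) D y₁ ∧ HalfMin K (inflLevel m) D y₂

lemma Coexist.unique {K m D D' : ℝ} (hK : 0 < K) (hD : 0 ≤ D) (hD' : 0 ≤ D')
    (h : Coexist K m D) (h' : Coexist K m D') : D = D' := by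
  wlog hlt : D < D' generalizing D D'
  · rcases lt_trichotomy D D' with h1 | h1 | h1
    · exact absurd h1 hlt
    · exact h1
    · exact (this hD' hD h' h h1).symm
  obtain ⟨-, y₂, -, hy₂, -, h2⟩ := h
  obtain ⟨z₁, -, hz₁, -, h3, -⟩ := h'
  have h4 := h2.mono hK hlt h3
  have h5 : y₂ = m := by linarith
  have h6 : z₁ = m := by linarith
  subst h5
  rw [h6] at h3
  rw [← h2.slope_eq hK hD, ← h3.slope_eq hK hD']

/-- As `D` increases from zero, the minimisers pass from below to above the inflection point; the
connectedness of the range of `D` yields a value where both kinds coexist. -/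
lemma exists_coexist {K m : ℝ} (hK : 0 < K) (hm : 0 < m)
    (h0 : HalfMin K (inflLevel m) 0 0) : ∃ D, 0 ≤ D ∧ Coexist K m D := by
  have hb : 0 ≤ inflLevel m := by linarith [three_lt_inflLevel hm]
  obtain ⟨L, hL⟩ := (isCompact_Icc (a := (0 : ℝ)) (b := m)).bddAbove_image
    (continuous_slope K (inflLevel m)).continuousOn
  have hL0 : 0 ≤ L := by
    have := hL ⟨0, ⟨le_rfl, hm.le⟩, rfl⟩
    simpa using this
  have hclosed : ∀ u v : ℝ,
      IsClosed {D | D ∈ Icc 0 (L + 1) ∧ ∃ y ∈ Icc u v, HalfMin K (inflLevel m) D y} := by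
    intro u v
    have hc : IsCompact ((Icc 0 (L + 1) ×ˢ Icc u v) ∩
        {x : ℝ × ℝ | HalfMin K (inflLevel m) x.1 x.2}) :=
      (isCompact_Icc.prod isCompact_Icc).inter_right
        ((isClosed_halfMin hK).preimage
          (f := fun x : ℝ × ℝ => (inflLevel m, x.1, x.2)) (by fun_prop))
    convert (hc.image continuous_fst).isClosed using 1
    ext D
    constructor
    · rintro ⟨hD, y, hy, h⟩
      exact ⟨(D, y), ⟨⟨hD, hy⟩, h⟩, rfl⟩
    · rintro ⟨⟨D, y⟩, ⟨⟨hD, hy⟩, h⟩, rfl⟩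
      exact ⟨hD, y, hy, h⟩
  set R := max (inflLevel m) ((L + 1) / K)
  have hR : ∀ D ∈ Icc 0 (L + 1), ∀ y, HalfMin K (inflLevel m) D y → y ≤ R := fun D hD y hy =>
    hy.le_of_le hK hb hD.1 hD.2
  obtain ⟨D, hD, ⟨-, y₁, hy₁, h1⟩, -, y₂, hy₂, h2⟩ :=
    isPreconnected_closed_iff.1 (isPreconnected_Icc (a := (0 : ℝ)) (b := L + 1)) _ _
      (hclosed 0 m) (hclosed m R)
      (by
        intro D hD
        obtain ⟨y, hy⟩ := exists_halfMin hK hb D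
        rcases le_total y m with h | h
        · exact Or.inl ⟨hD, y, ⟨hy.1, h⟩, hy⟩
        · exact Or.inr ⟨hD, y, ⟨h, hR D hD y hy⟩, hy⟩)
      ⟨0, ⟨le_rfl, by linarith⟩, ⟨le_rfl, by linarith⟩, 0, ⟨le_rfl, hm.le⟩, h0⟩
      (by
        have hmem : L + 1 ∈ Icc 0 (L + 1) := ⟨by linarith, le_rfl⟩
        obtain ⟨y, hy⟩ := exists_halfMin hK hb (L + 1)
        refine ⟨L + 1, hmem, hmem, y, ⟨?_, hR _ hmem y hy⟩, hy⟩
        by_contra! hlt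
        have := hL ⟨y, ⟨hy.1, hlt.le⟩, rfl⟩
        rw [hy.slope_eq hK (by linarith)] at this
        linarith)
  exact ⟨D, hD.1, y₁, y₂, hy₁.2, hy₂.1, h1, h2⟩

lemma HalfMin.pos {K b D y : ℝ} (hK : 0 < K) (hD : 0 < D) (h : HalfMin K b D y) : 0 < y := by
  rcases h.1.eq_or_lt with h0 | h0
  · have := h.slope_eq hK hD.le
    rw [← h0] at this
    simp at this
    linarith
  · exact h0

/-- Two minimisers on the half-line lie on both sides of the inflection point of the slope. -/
lemma exists_inflection {K b D y₁ y₂ : ℝ} (hK : 0 < K) (hD : 0 ≤ D)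
    (h1 : HalfMin K b D y₁) (h2 : HalfMin K b D y₂) (hlt : y₁ < y₂) :
    ∃ m, 0 < m ∧ b = inflLevel m ∧ K < critK m ∧ y₁ ≤ m ∧ m ≤ y₂ := by
  have hs : slope K b y₁ = slope K b y₂ := by rw [h1.slope_eq hK hD, h2.slope_eq hK hD]
  have hno : ¬ StrictMonoOn (slope K b) (Icc y₁ y₂) := fun h =>
    (h ⟨le_rfl, hlt.le⟩ ⟨hlt.le, le_rfl⟩ hlt).ne hs
  have hd1 := h1.slopeDeriv_nonneg hK hD
  have hd2 := h2.slopeDeriv_nonneg hK hD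
  have h3 : 3 < b := by
    by_contra! hb
    refine hno (strictMonoOn_slope_of_slopeDeriv_pos (convex_Icc _ _) fun y hy => ?_)
    rw [interior_Icc] at hy
    exact hd1.trans_lt (strictMonoOn_slopeDeriv_of_le_three K hb (mem_Ici.2 h1.1)
      (mem_Ici.2 (h1.1.trans hy.1.le)) hy.1)
  obtain ⟨m, hm, rfl⟩ := exists_inflLevel_eq h3
  refine ⟨m, hm, rfl, ?_, ?_, ?_⟩
  · by_contra! hle
    exact hno ((Monotonic.strictMonoOn (Or.inr ⟨m, hm, rfl, hle⟩)).mono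
      fun y hy => h1.1.trans hy.1)
  · by_contra! hlt'
    refine hno (strictMonoOn_slope_of_slopeDeriv_pos (convex_Icc _ _) fun y hy => ?_)
    rw [interior_Icc] at hy
    exact hd1.trans_lt (strictMonoOn_slopeDeriv K hm (mem_Ici.2 hlt'.le)
      (mem_Ici.2 (hlt'.le.trans hy.1.le)) hy.1)
  · by_contra! hlt'
    refine hno (strictMonoOn_slope_of_slopeDeriv_pos (convex_Icc _ _) fun y hy => ?_)
    rw [interior_Icc] at hy
    exact hd2.trans_lt (strictAntiOn_slopeDeriv K hm ⟨h1.1.trans hy.1.le, hy.2.le.trans hlt'.le⟩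
      ⟨h2.1, hlt'.le⟩ hy.2)

/-- If the symmetric potential has a minimiser away from zero, then no asymmetric one has two
minimisers: the minimisers for `D > 0` all lie above that of `D = 0`, hence above the inflection
point. -/
lemma not_axisBad_of_two {K b D y₁ y₂ : ℝ} (hK : 0 < K) (hD : 0 < D)
    (h1 : HalfMin K b D y₁) (h2 : HalfMin K b D y₂) (hlt : y₁ < y₂) : ¬ AxisBad K b := by
  intro hax
  obtain ⟨m, hm, rfl, -, hy₁, -⟩ := exists_inflection hK hD.le h1 h2 hlt
  obtain ⟨y, hy, hmin⟩ := hax.exists_halfMin hK (by linarith [three_lt_inflLevel hm])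
  have := hmin.inflection_le hK hm hy
  have := hmin.mono hK hD h1
  linarith

/-- Between two minimisers there is a stationary point at which the slope does not increase. -/
lemma exists_stationary {K b D y₁ y₂ : ℝ} (hK : 0 < K) (hD : 0 ≤ D)
    (h1 : HalfMin K b D y₁) (h2 : HalfMin K b D y₂) (hlt : y₁ < y₂) :
    ∃ y, 0 < y ∧ slope K b y = D ∧ slopeDeriv K b y ≤ 0 := by
  obtain ⟨m, hm, rfl, -, -, -⟩ := exists_inflection hK hD h1 h2 hlt
  obtain ⟨y, hy, hd⟩ := exists_deriv_eq_zero hlt (continuous_pot_right hK _ D).continuousOn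
    (le_antisymm (h1.2 _ h2.1) (h2.2 _ h1.1))
  have hy0 : 0 < y := h1.1.trans_lt hy.1
  rw [(hasDerivAt_pot hK _ D y).deriv, div_eq_zero_iff] at hd
  have hs : slope K (inflLevel m) y = D := by
    rcases hd with hd | hd
    · linarith
    · exact absurd hd (add_cosh_pos hK y).ne'
  refine ⟨y, hy0, hs, ?_⟩
  by_contra! hpos
  rcases le_total y m with hle | hle
  · have : StrictMonoOn (slope K (inflLevel m)) (Icc y₁ y) := by
      refine strictMonoOn_slope_of_slopeDeriv_pos (convex_Icc _ _) fun z hz => ?_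
      rw [interior_Icc] at hz
      exact hpos.trans (strictAntiOn_slopeDeriv K hm ⟨h1.1.trans hz.1.le, hz.2.le.trans hle⟩
        ⟨hy0.le, hle⟩ hz.2)
    have := this ⟨le_rfl, hy.1.le⟩ ⟨hy.1.le, le_rfl⟩ hy.1
    rw [h1.slope_eq hK hD, hs] at this
    exact lt_irrefl _ this
  · have : StrictMonoOn (slope K (inflLevel m)) (Icc y y₂) := by
      refine strictMonoOn_slope_of_slopeDeriv_pos (convex_Icc _ _) fun z hz => ?_
      rw [interior_Icc] at hz
      exact hpos.trans (strictMonoOn_slopeDeriv K hm (mem_Ici.2 hle)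
        (mem_Ici.2 (hle.trans hz.1.le)) hz.1)
    have := this ⟨le_rfl, hy.2.le⟩ ⟨hy.2.le, le_rfl⟩ hy.2
    rw [h2.slope_eq hK hD, hs] at this
    exact lt_irrefl _ this

/-- Where the slope does not increase it stays below `b S`. This is the statement that the bad
measures found below have positive densities of both spins. -/
lemma slope_lt_of_slopeDeriv_nonpos {K S b y : ℝ} (hK : 0 < K) (hS : 0 < S)
    (hKS : K ^ 2 - S ^ 2 = 1) (hy : 0 < y) (h : slopeDeriv K b y ≤ 0) :
    slope K b y < b * S := by
  by_contra! hle
  obtain ⟨Y, rfl⟩ : ∃ Y, S = Real.sinh Y := ⟨Real.arsinh S, (Real.sinh_arsinh S).symm⟩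
  have hKc : K = Real.cosh Y := by
    have h1 := Real.cosh_sq Y
    have h2 := Real.cosh_pos Y
    nlinarith
  subst hKc
  have hY : 0 < Y := Real.sinh_pos_iff.1 hS
  have hs : 0 < Real.sinh y := Real.sinh_pos_iff.2 hy
  have hC := Real.cosh_pos y
  have hc2 := Real.cosh_sq y
  unfold slope at hle
  unfold slopeDeriv at h
  have h1 : (Real.cosh Y + Real.cosh y + y * Real.sinh y) * (Real.sinh y + Real.sinh Y)
      ≤ b * Real.cosh y * (Real.sinh y + Real.sinh Y) :=
    mul_le_mul_of_nonneg_right (by linarith) (by linarith)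
  have h2 : b * (Real.sinh y + Real.sinh Y) * Real.cosh y
      ≤ y * (Real.cosh Y + Real.cosh y) * Real.cosh y :=
    mul_le_mul_of_nonneg_right (by linarith) hC.le
  have h3 : (Real.cosh Y + Real.cosh y) * (Real.sinh y + Real.sinh Y)
      ≤ y * (1 + Real.cosh (y - Y)) := by
    rw [Real.cosh_sub]
    nlinarith
  have h4 : (Real.cosh Y + Real.cosh y) * (Real.sinh y + Real.sinh Y)
      = Real.sinh (y + Y) * (1 + Real.cosh (y - Y)) := by
    rw [Real.cosh_sub, Real.sinh_add]
    linear_combination (-(Real.sinh y * Real.cosh y)) * hKS -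
      (Real.cosh Y * Real.sinh Y) * hc2
  rw [h4] at h3
  have h5 := Real.cosh_pos (y - Y)
  have h6 := le_of_mul_le_mul_right h3 (by linarith)
  have h7 := Real.self_lt_sinh_iff.2 (add_pos hy hY)
  linarith

/-! ### Global minimisers of the potential -/

/-- The potential has at least two global minimisers. -/
def TwoMin (K b D : ℝ) : Prop :=
  ∃ y₁ y₂, y₁ ≠ y₂ ∧ (∀ z, pot K b D y₁ ≤ pot K b D z) ∧ ∀ z, pot K b D y₂ ≤ pot K b D z

lemma twoMin_neg {K b D : ℝ} : TwoMin K b (-D) ↔ TwoMin K b D := by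
  have key : ∀ D, TwoMin K b D → TwoMin K b (-D) := by
    rintro D ⟨y₁, y₂, hne, h1, h2⟩
    refine ⟨-y₁, -y₂, fun h => hne (neg_injective h), fun z => ?_, fun z => ?_⟩
    · have := pot_neg K b D (-z)
      rw [neg_neg] at this
      rw [pot_neg, this]
      exact h1 _
    · have := pot_neg K b D (-z)
      rw [neg_neg] at this
      rw [pot_neg, this]
      exact h2 _
  exact ⟨fun h => by simpa using key _ h, key D⟩

lemma pot_neg_right (K b D y : ℝ) : pot K b D (-y) = pot K b D y + 2 * D * area K y := by
  simp [pot, area_neg]; ring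

lemma area_pos {K y : ℝ} (hK : 0 < K) (hy : 0 < y) : 0 < area K y := by
  have := strictMono_area hK hy
  simpa using this

lemma area_nonneg {K y : ℝ} (hK : 0 < K) (hy : 0 ≤ y) : 0 ≤ area K y := by
  have := (strictMono_area hK).monotone hy
  simpa using this

lemma HalfMin.global {K b D y : ℝ} (hK : 0 < K) (hD : 0 ≤ D) (h : HalfMin K b D y) (z : ℝ) :
    pot K b D y ≤ pot K b D z := by
  rcases le_total 0 z with hz | hz
  · exact h.2 z hz
  · have h1 := pot_neg_right K b D (-z)
    rw [neg_neg] at h1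
    have h2 := h.2 (-z) (by linarith)
    have h3 := area_nonneg hK (y := -z) (by linarith)
    have : 0 ≤ D * area K (-z) := mul_nonneg hD h3
    linarith

lemma halfMin_of_global {K b D y : ℝ} (hK : 0 < K) (hD : 0 < D)
    (h : ∀ z, pot K b D y ≤ pot K b D z) : HalfMin K b D y := by
  refine ⟨?_, fun z _ => h z⟩
  by_contra! hlt
  have h1 := pot_neg_right K b D (-y)
  rw [neg_neg] at h1
  have h2 := area_pos hK (y := -y) (by linarith)
  have h3 := mul_pos hD h2
  linarith [h (-y)]

/-- On the axis of symmetry, coexistence is decided by comparing with the value at zero. -/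
lemma twoMin_zero_iff {K b : ℝ} (hK : 0 < K) (hb : 0 ≤ b) : TwoMin K b 0 ↔ AxisBad K b := by
  constructor
  · rintro ⟨y₁, y₂, hne, h1, h2⟩
    have key : ∀ y, y ≠ 0 → (∀ z, pot K b 0 y ≤ pot K b 0 z) → AxisBad K b := by
      intro y hy h
      rcases lt_or_gt_of_ne hy with h0 | h0
      · refine ⟨-y, by linarith, ?_⟩
        rw [pot_neg_right]
        simpa using h 0
      · exact ⟨y, h0, h 0⟩
    by_cases h0 : y₁ = 0
    · exact key y₂ (fun h => hne (h0.trans h.symm)) h2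
    · exact key y₁ h0 h1
  · intro h
    obtain ⟨y, hy, hm⟩ := h.exists_halfMin hK hb
    refine ⟨y, -y, by intro h; linarith, hm.global hK le_rfl, fun z => ?_⟩
    rw [pot_neg_right]
    simpa using hm.global hK le_rfl z

/-- Off the axis, coexistence means that there is a minimiser on each side of the inflection
point, where moreover the slope must decrease. -/
lemma twoMin_pos_iff {K b D : ℝ} (hK : 0 < K) (hD : 0 < D) :
    TwoMin K b D ↔ ∃ m, 0 < m ∧ b = inflLevel m ∧ K < critK m ∧ Coexist K m D := by
  constructor
  · rintro ⟨y₁, y₂, hne, h1, h2⟩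
    wlog hlt : y₁ < y₂ generalizing y₁ y₂
    · exact this y₂ y₁ hne.symm h2 h1 (lt_of_le_of_ne (not_lt.1 hlt) hne.symm)
    have h1 := halfMin_of_global hK hD h1
    have h2 := halfMin_of_global hK hD h2
    obtain ⟨m, hm, rfl, hKm, hy₁, hy₂⟩ := exists_inflection hK hD.le h1 h2 hlt
    exact ⟨m, hm, rfl, hKm, y₁, y₂, hy₁, hy₂, h1, h2⟩
  · rintro ⟨m, hm, rfl, hKm, y₁, y₂, hy₁, hy₂, h1, h2⟩
    refine ⟨y₁, y₂, ?_, h1.global hK hD.le, h2.global hK hD.le⟩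
    rintro rfl
    obtain rfl : y₁ = m := le_antisymm hy₁ hy₂
    have := h1.slopeDeriv_nonneg hK hD.le
    rw [slopeDeriv_inflLevel K hm] at this
    linarith

lemma TwoMin.exists_halfMin_lt {K b D : ℝ} (hK : 0 < K) (hD : 0 < D) (h : TwoMin K b D) :
    ∃ y₁ y₂, HalfMin K b D y₁ ∧ HalfMin K b D y₂ ∧ y₁ < y₂ := by
  obtain ⟨y₁, y₂, hne, h1, h2⟩ := h
  rcases lt_or_gt_of_ne hne with hlt | hlt
  · exact ⟨y₁, y₂, halfMin_of_global hK hD h1, halfMin_of_global hK hD h2, hlt⟩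
  · exact ⟨y₂, y₁, halfMin_of_global hK hD h2, halfMin_of_global hK hD h1, hlt⟩

lemma TwoMin.not_axisBad {K b D : ℝ} (hK : 0 < K) (hD : 0 < D) (h : TwoMin K b D) :
    ¬ AxisBad K b := by
  obtain ⟨y₁, y₂, h1, h2, hlt⟩ := h.exists_halfMin_lt hK hD
  exact not_axisBad_of_two hK hD h1 h2 hlt

lemma TwoMin.exists_stationary {K b D : ℝ} (hK : 0 < K) (hD : 0 < D) (h : TwoMin K b D) :
    ∃ y, 0 < y ∧ slope K b y = D ∧ slopeDeriv K b y ≤ 0 := by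
  obtain ⟨y₁, y₂, h1, h2, hlt⟩ := h.exists_halfMin_lt hK hD
  exact WidomRowlinson.exists_stationary hK hD.le h1 h2 hlt

lemma Monotonic.not_twoMin {K b : ℝ} (hK : 0 < K) (hb : 0 ≤ b) (h : Monotonic K b) (D : ℝ) :
    ¬ TwoMin K b D := by
  have key : ∀ D, 0 < D → ¬ TwoMin K b D := by
    intro D hD h2
    obtain ⟨y₁, y₂, h1, h2, hlt⟩ := h2.exists_halfMin_lt hK hD
    have := h.strictMonoOn (mem_Ici.2 h1.1) (mem_Ici.2 h2.1) hlt
    rw [h1.slope_eq hK hD.le, h2.slope_eq hK hD.le] at this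
    exact lt_irrefl _ this
  rcases lt_trichotomy D 0 with hD | rfl | hD
  · rw [← twoMin_neg]; exact key _ (by linarith)
  · rw [twoMin_zero_iff hK hb]; exact h.not_axisBad hK
  · exact key D hD

/-! ### Coexistence on the axis of symmetry -/

/-- The logarithmic growth of `K + cosh` from `0` to `y`. -/
noncomputable def logRatio (K y : ℝ) : ℝ := Real.log (K + Real.cosh y) - Real.log (K + 1)

lemma axisBad_iff {K b : ℝ} : AxisBad K b ↔ ∃ y, 0 < y ∧ y ^ 2 / 2 ≤ b * logRatio K y := by
  refine exists_congr fun y => and_congr_right fun _ => ?_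
  simp only [pot, logRatio, Real.cosh_zero]
  constructor <;> intro h <;> linarith

lemma logRatio_eq {K : ℝ} (hK : 0 < K) (y : ℝ) :
    logRatio K y = Real.log (1 + (Real.cosh y - 1) / (K + 1)) := by
  rw [logRatio, ← Real.log_div (add_cosh_pos hK y).ne' (by linarith)]
  congr 1
  field_simp
  ring

lemma logRatio_pos {K y : ℝ} (hK : 0 < K) (hy : 0 < y) : 0 < logRatio K y := by
  rw [logRatio_eq hK]
  apply Real.log_pos
  have := Real.one_lt_cosh.2 hy.ne'
  have : 0 < (Real.cosh y - 1) / (K + 1) := div_pos (by linarith) (by linarith)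
  linarith

lemma logRatio_le_div {K : ℝ} (hK : 0 < K) (y : ℝ) :
    logRatio K y ≤ (Real.cosh y - 1) / (K + 1) := by
  rw [logRatio_eq hK]
  have := Real.one_le_cosh y
  have h : 0 ≤ (Real.cosh y - 1) / (K + 1) := div_nonneg (by linarith) (by linarith)
  have := Real.log_le_sub_one_of_pos (x := 1 + (Real.cosh y - 1) / (K + 1)) (by linarith)
  linarith

lemma logRatio_le_self {K y : ℝ} (hK : 0 < K) (hy : 0 ≤ y) : logRatio K y ≤ y := by
  have h1 : Real.cosh y ≤ Real.exp y := by
    have := Real.sinh_nonneg_iff.2 hy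
    have := Real.cosh_add_sinh y
    linarith
  have h2 : K ≤ K * Real.exp y := by
    have := Real.one_le_exp hy
    nlinarith
  have h3 : Real.log (K + Real.cosh y) ≤ Real.log ((K + 1) * Real.exp y) :=
    Real.log_le_log (add_cosh_pos hK y) (by linarith)
  rw [Real.log_mul (by linarith) (Real.exp_pos y).ne', Real.log_exp] at h3
  unfold logRatio; linarith

lemma logRatio_lt {K K' y : ℝ} (hK : 0 < K) (h : K < K') (hy : 0 < y) :
    logRatio K' y < logRatio K y := by
  have hc := Real.one_lt_cosh.2 hy.ne'
  rw [logRatio_eq hK, logRatio_eq (hK.trans h)]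
  have h1 : 0 < (Real.cosh y - 1) / (K' + 1) := div_pos (by linarith) (by linarith)
  have h2 : (Real.cosh y - 1) / (K' + 1) < (Real.cosh y - 1) / (K + 1) :=
    div_lt_div_of_pos_left (by linarith) (by linarith) (by linarith)
  exact Real.log_lt_log (by linarith) (by linarith)

lemma continuous_logRatio {K : ℝ} (hK : 0 < K) : Continuous (logRatio K) := by
  unfold logRatio
  exact (Continuous.log (by fun_prop) fun y => (add_cosh_pos hK y).ne').sub continuous_const

lemma AxisBad.mono {K b b' : ℝ} (hK : 0 < K) (h : AxisBad K b) (hb : b ≤ b') : AxisBad K b' := by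
  rw [axisBad_iff] at h ⊢
  obtain ⟨y, hy, hle⟩ := h
  exact ⟨y, hy, hle.trans (mul_le_mul_of_nonneg_right hb (logRatio_pos hK hy).le)⟩

lemma AxisBad.pos {K b : ℝ} (hK : 0 < K) (h : AxisBad K b) : 0 < b := by
  rw [axisBad_iff] at h
  obtain ⟨y, hy, hle⟩ := h
  have : 0 < b * logRatio K y := lt_of_lt_of_le (by positivity) hle
  exact pos_of_mul_pos_left this (logRatio_pos hK hy).le

lemma axisBad_of_lt {K b : ℝ} (hK : 0 < K) (h : K + 1 < b) : AxisBad K b := by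
  have hneg : slopeDeriv K b 0 < 0 := by rw [slopeDeriv_zero]; linarith
  have hev : {z | slopeDeriv K b z < 0} ∈ 𝓝 (0 : ℝ) :=
    (continuous_slopeDeriv K b).continuousAt.eventually_lt continuousAt_const hneg
  obtain ⟨v, hv, hsub⟩ := exists_Ico_subset_of_mem_nhds hev ⟨1, by norm_num⟩
  have hanti : StrictAntiOn (slope K b) (Icc 0 v) := by
    apply strictAntiOn_of_deriv_neg (convex_Icc 0 v) (by fun_prop)
    intro z hz
    rw [interior_Icc] at hz
    rw [(hasDerivAt_slope K b z).deriv]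
    exact hsub ⟨hz.1.le, hz.2⟩
  refine ⟨v, hv, (pot_lt_of_slope_lt hK hv fun z hz => ?_).le⟩
  have := hanti ⟨le_rfl, hv.le⟩ ⟨hz.1.le, hz.2.le⟩ hz.1
  simpa using this

lemma exists_lt_logRatio {K : ℝ} (hK : 2 < K) :
    ∃ y, 0 < y ∧ y ^ 2 / 2 < (K + 1) * logRatio K y := by
  have hK0 : 0 < K := by linarith
  obtain ⟨m, hm, hb⟩ := exists_inflLevel_eq (b := K + 1) (by linarith)
  have hneg : ∀ z ∈ Ioo 0 m, slopeDeriv K (K + 1) z < 0 := by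
    intro z hz
    have := strictAntiOn_slopeDeriv K hm ⟨le_rfl, hm.le⟩ ⟨hz.1.le, hz.2.le⟩ hz.1
    rw [hb, slopeDeriv_zero] at this
    linarith
  have hanti : StrictAntiOn (slope K (K + 1)) (Icc 0 m) := by
    apply strictAntiOn_of_deriv_neg (convex_Icc 0 m) (by fun_prop)
    intro z hz
    rw [interior_Icc] at hz
    rw [(hasDerivAt_slope _ _ z).deriv]
    exact hneg z hz
  have := pot_lt_of_slope_lt (b := K + 1) (D := 0) hK0 hm fun z hz => by
    have := hanti ⟨le_rfl, hm.le⟩ ⟨hz.1.le, hz.2.le⟩ hz.1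
    simpa using this
  refine ⟨m, hm, ?_⟩
  simp only [pot, Real.cosh_zero] at this
  unfold logRatio
  linarith

/-- Near zero `cosh y - 1` is smaller than any `ρ y ^ 2 / 2` with `ρ > 1`. -/
lemma exists_le_of_cosh {ρ : ℝ} (hρ : 1 < ρ) :
    ∃ δ, 0 < δ ∧ ∀ y, 0 < y → ρ * (y ^ 2 / 2) ≤ Real.cosh y - 1 → δ ≤ y := by
  have hpos : 0 < 1 - 1 / ρ := by
    have : 1 / ρ < 1 := by rw [div_lt_one (by linarith)]; exact hρ
    linarith
  refine ⟨Real.sqrt (1 - 1 / ρ), Real.sqrt_pos.2 hpos, fun y hy h => ?_⟩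
  rw [Real.sqrt_le_left hy.le]
  set u := y ^ 2 / 2 with hu
  have hu0 : 0 < u := by positivity
  have hyu : y ^ 2 = 2 * u := by rw [hu]; ring
  rw [hyu]
  rcases le_or_gt 1 u with h1 | h1
  · have : 0 < 1 / ρ := by positivity
    linarith
  have h2 : Real.cosh y ≤ Real.exp u := Real.cosh_le_exp_half_sq y
  have h3 : Real.exp u * (1 - u) ≤ 1 := by
    have h4 := Real.add_one_le_exp (-u)
    have h5 : Real.exp u * Real.exp (-u) = 1 := by rw [← Real.exp_add]; simp
    have := Real.exp_pos u
    nlinarith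
  have h4 : ρ * u * (1 - u) ≤ u := by
    have : ρ * u * (1 - u) ≤ (Real.exp u - 1) * (1 - u) :=
      mul_le_mul_of_nonneg_right (by linarith) (by linarith)
    linarith
  have h5 : ρ * (1 - u) ≤ 1 := by
    have : (ρ * (1 - u)) * u ≤ 1 * u := by linarith
    exact le_of_mul_le_mul_right this hu0
  have h6 : 1 - u ≤ 1 / ρ := by rw [le_div_iff₀ (by linarith)]; linarith
  linarith

/-- For `K > 2` the values of `b` with coexistence on the axis form a closed half-line that starts
strictly below `K + 1`. -/
lemma exists_axisBad_threshold {K : ℝ} (hK : 2 < K) :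
    ∃ B, B < K + 1 ∧ ∀ b, AxisBad K b ↔ B ≤ b := by
  have hK0 : 0 < K := by linarith
  obtain ⟨y₀, hy₀, hlt⟩ := exists_lt_logRatio hK
  have hl₀ := logRatio_pos hK0 hy₀
  set b₀ := y₀ ^ 2 / 2 / logRatio K y₀ with hb₀
  have hb₀pos : 0 < b₀ := by positivity
  have hb₀lt : b₀ < K + 1 := by rw [hb₀, div_lt_iff₀ hl₀]; exact hlt
  obtain ⟨δ, hδ, hδy⟩ := exists_le_of_cosh (ρ := (K + 1) / b₀) (by rwa [one_lt_div hb₀pos])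
  have hrange : ∀ y, 0 < y → y ^ 2 / 2 ≤ b₀ * logRatio K y → y ∈ Icc δ (2 * b₀) := by
    intro y hy h
    constructor
    · apply hδy y hy
      have := mul_le_mul_of_nonneg_left (logRatio_le_div hK0 y) hb₀pos.le
      have h2 := h.trans this
      rw [← mul_div_assoc, le_div_iff₀ (by linarith)] at h2
      rw [div_mul_eq_mul_div, div_le_iff₀ hb₀pos]
      linarith
    · have := mul_le_mul_of_nonneg_left (logRatio_le_self hK0 hy.le) hb₀pos.le
      have h2 : y * y ≤ (2 * b₀) * y := by nlinarith
      exact le_of_mul_le_mul_right h2 hy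
  have hy₀mem : y₀ ∈ Icc δ (2 * b₀) := hrange y₀ hy₀ (by rw [hb₀, div_mul_cancel₀ _ hl₀.ne'])
  obtain ⟨y₁, hy₁, hmin⟩ := isCompact_Icc.exists_isMinOn ⟨y₀, hy₀mem⟩
    (f := fun y => y ^ 2 / 2 / logRatio K y)
    (ContinuousOn.div (by fun_prop) (continuous_logRatio hK0).continuousOn
      fun y hy => (logRatio_pos hK0 (hδ.trans_le hy.1)).ne')
  have hy₁0 : 0 < y₁ := hδ.trans_le hy₁.1
  have hl₁ := logRatio_pos hK0 hy₁0
  refine ⟨y₁ ^ 2 / 2 / logRatio K y₁, (hmin hy₀mem).trans_lt hb₀lt, fun b => ⟨fun h => ?_,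
    fun h => ?_⟩⟩
  · rw [axisBad_iff] at h
    obtain ⟨y, hy, hle⟩ := h
    rcases le_total b b₀ with hb | hb
    · have hmem := hrange y hy
        (hle.trans (mul_le_mul_of_nonneg_right hb (logRatio_pos hK0 hy).le))
      refine (hmin hmem).trans ?_
      rw [div_le_iff₀ (logRatio_pos hK0 hy)]
      exact hle
    · exact (hmin hy₀mem).trans hb
  · rw [axisBad_iff]
    refine ⟨y₁, hy₁0, ?_⟩
    rwa [div_le_iff₀ hl₁] at h

/-- The value of `K + 1` at which the symmetric potential takes the same value at `y` and `0`. -/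
noncomputable def tieLevel (b y : ℝ) : ℝ := (Real.cosh y - 1) / (Real.exp (y ^ 2 / 2 / b) - 1)

lemma exp_sub_one_pos {b y : ℝ} (hb : 0 < b) (hy : 0 < y) :
    0 < Real.exp (y ^ 2 / 2 / b) - 1 := by
  have : 1 < Real.exp (y ^ 2 / 2 / b) := Real.one_lt_exp_iff.2 (by positivity)
  linarith

lemma le_logRatio_iff {K b y : ℝ} (hK : 0 < K) (hb : 0 < b) (hy : 0 < y) :
    y ^ 2 / 2 ≤ b * logRatio K y ↔ K + 1 ≤ tieLevel b y := by
  have h1 := Real.one_lt_cosh.2 hy.ne'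
  have h2 : 0 < 1 + (Real.cosh y - 1) / (K + 1) := by
    have : 0 < (Real.cosh y - 1) / (K + 1) := div_pos (by linarith) (by linarith)
    linarith
  have h3 := exp_sub_one_pos hb hy
  rw [tieLevel, le_div_iff₀ h3, logRatio_eq hK, mul_comm b, ← div_le_iff₀ hb,
    Real.le_log_iff_exp_le h2, ← sub_le_iff_le_add', le_div_iff₀ (by linarith), mul_comm]

lemma tieLevel_lt {b b' y : ℝ} (hb : 0 < b) (h : b < b') (hy : 0 < y) :
    tieLevel b y < tieLevel b' y := by
  have h1 := Real.one_lt_cosh.2 hy.ne'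
  unfold tieLevel
  apply div_lt_div_of_pos_left (by linarith) (exp_sub_one_pos (hb.trans h) hy)
  have : y ^ 2 / 2 / b' < y ^ 2 / 2 / b := div_lt_div_of_pos_left (by positivity) hb h
  have := Real.exp_lt_exp.2 this
  linarith

/-- For `b > 3` the values of `K` with coexistence on the axis form a closed initial segment that
ends strictly above `2`. At its end there is no coexistence for smaller `b`, below its end there
is. -/
lemma exists_axisBad_maxK {b : ℝ} (hb : 3 < b) :
    ∃ K₂, 2 < K₂ ∧ (∀ K, 0 < K → (AxisBad K b ↔ K ≤ K₂)) ∧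
      (∀ b' < b, ¬ AxisBad K₂ b') ∧ ∀ K, 0 < K → K < K₂ → ∃ b' < b, AxisBad K b' := by
  have hb0 : 0 < b := by linarith
  obtain ⟨y₀, hy₀, hlt⟩ := exists_lt_logRatio (K := b - 1) (by linarith)
  rw [sub_add_cancel] at hlt
  have hlt' : b < tieLevel b y₀ := by
    -- The strict inequality at `K = b - 1` survives a small decrease of `b`.
    have hl := logRatio_pos (K := b - 1) (by linarith) hy₀
    have h1 : y₀ ^ 2 / 2 / logRatio (b - 1) y₀ < b := by rwa [div_lt_iff₀ hl]
    have h0 : 0 < y₀ ^ 2 / 2 / logRatio (b - 1) y₀ := by positivity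
    have h2 := (le_logRatio_iff (K := b - 1) (by linarith) h0 hy₀).1
      (by rw [div_mul_cancel₀ _ hl.ne'])
    have := tieLevel_lt h0 h1 hy₀
    linarith
  set L := tieLevel b y₀ with hL
  obtain ⟨δ, hδ, hδy⟩ := exists_le_of_cosh (ρ := L / b) (by rwa [one_lt_div hb0])
  have hrange : ∀ y, 0 < y → L ≤ tieLevel b y → y ∈ Icc δ (2 * b) := by
    intro y hy h
    have hK : 0 < L - 1 := by linarith
    have h' := (le_logRatio_iff (K := L - 1) hK hb0 hy).2 (by linarith)
    constructor
    · apply hδy y hy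
      have := mul_le_mul_of_nonneg_left (logRatio_le_div hK y) hb0.le
      have h2 := h'.trans this
      rw [sub_add_cancel, ← mul_div_assoc, le_div_iff₀ (by linarith)] at h2
      rw [div_mul_eq_mul_div, div_le_iff₀ hb0]
      linarith
    · have := mul_le_mul_of_nonneg_left (logRatio_le_self hK hy.le) hb0.le
      have h2 : y * y ≤ (2 * b) * y := by nlinarith
      exact le_of_mul_le_mul_right h2 hy
  have hy₀mem := hrange y₀ hy₀ le_rfl
  obtain ⟨y₁, hy₁, hmax⟩ := isCompact_Icc.exists_isMaxOn ⟨y₀, hy₀mem⟩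
    (f := tieLevel b)
    (by
      unfold tieLevel
      exact ContinuousOn.div (by fun_prop) (by fun_prop)
        fun y hy => (exp_sub_one_pos hb0 (hδ.trans_le hy.1)).ne')
  have hy₁0 : 0 < y₁ := hδ.trans_le hy₁.1
  have hLle : L ≤ tieLevel b y₁ := hmax hy₀mem
  have hall : ∀ y, 0 < y → tieLevel b y ≤ tieLevel b y₁ := by
    intro y hy
    rcases le_total (tieLevel b y) L with h | h
    · exact h.trans hLle
    · exact hmax (hrange y hy h)
  refine ⟨tieLevel b y₁ - 1, by linarith, fun K hK => ⟨fun h => ?_, fun h => ?_⟩, ?_, ?_⟩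
  · rw [axisBad_iff] at h
    obtain ⟨y, hy, hle⟩ := h
    rw [le_logRatio_iff hK hb0 hy] at hle
    linarith [hall y hy]
  · rw [axisBad_iff]
    refine ⟨y₁, hy₁0, ?_⟩
    rw [le_logRatio_iff hK hb0 hy₁0]
    linarith
  · intro b' hb' h
    have hK : 0 < tieLevel b y₁ - 1 := by linarith
    have hb'0 := h.pos hK
    rw [axisBad_iff] at h
    obtain ⟨y, hy, hle⟩ := h
    rw [le_logRatio_iff hK hb'0 hy] at hle
    linarith [hall y hy, tieLevel_lt hb'0 hb' hy]
  · intro K hK hlt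
    have hK₂ : 0 < tieLevel b y₁ - 1 := by linarith
    have h1 := (le_logRatio_iff hK₂ hb0 hy₁0).2 (by linarith)
    have hl := logRatio_pos hK hy₁0
    have h2 : y₁ ^ 2 / 2 < b * logRatio K y₁ :=
      h1.trans_lt (mul_lt_mul_of_pos_left (logRatio_lt hK hlt hy₁0) hb0)
    exact ⟨y₁ ^ 2 / 2 / logRatio K y₁, (div_lt_iff₀ hl).2 h2,
      axisBad_iff.2 ⟨y₁, hy₁0, by rw [div_mul_cancel₀ _ hl.ne']⟩⟩

lemma halfMin_zero_of_forall_not_axisBad {K b : ℝ} (hK : 0 < K)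
    (h : ∀ b' < b, ¬ AxisBad K b') : HalfMin K b 0 0 := by
  refine ⟨le_rfl, fun z hz => ?_⟩
  by_contra! hlt
  have hz0 : 0 < z := lt_of_le_of_ne hz (by rintro rfl; exact lt_irrefl _ hlt)
  have hl := logRatio_pos hK hz0
  simp only [pot, Real.cosh_zero] at hlt
  have h1 : z ^ 2 / 2 < b * logRatio K z := by unfold logRatio; linarith
  refine h (z ^ 2 / 2 / logRatio K z) ((div_lt_iff₀ hl).2 h1) (axisBad_iff.2 ⟨z, hz0, ?_⟩)
  rw [div_mul_cancel₀ _ hl.ne']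

lemma halfMin_zero_of_not_axisBad {K b : ℝ} (hK : 0 < K) (hb : 0 ≤ b) (h : ¬ AxisBad K b) :
    HalfMin K b 0 0 := by
  obtain ⟨y, hy⟩ := exists_halfMin hK hb 0
  rcases hy.1.eq_or_lt with rfl | h0
  · exact hy
  · exact absurd ⟨y, h0, hy.2 0 le_rfl⟩ h

/-! ### The coexistence curve -/

lemma Coexist.pos {K m D : ℝ} (hm : 0 < m) (hD : 0 ≤ D) (h : Coexist K m D)
    (hax : ¬ AxisBad K (inflLevel m)) : 0 < D := by
  rcases hD.eq_or_lt with rfl | h0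
  · obtain ⟨-, y₂, -, hy₂, -, h2⟩ := h
    exact absurd ⟨y₂, hm.trans_le hy₂, h2.2 0 le_rfl⟩ hax
  · exact h0

lemma Coexist.eq_zero {K m : ℝ} (hK : 0 < K) (hm : 0 < m) {D : ℝ} (hD : 0 ≤ D)
    (h : Coexist K m D) (hax : AxisBad K (inflLevel m)) (h0 : HalfMin K (inflLevel m) 0 0) :
    D = 0 := by
  obtain ⟨y, hy, hmin⟩ := hax.exists_halfMin hK (by linarith [three_lt_inflLevel hm])
  exact h.unique hK hD le_rfl
    ⟨0, y, hm.le, (hmin.inflection_le hK hm hy).le, h0, hmin⟩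

/-- The value of `D` at coexistence depends continuously on the inflection point: the relation
between them is closed and locally bounded, and determines `D`. -/
lemma continuousOn_of_coexist {K u v : ℝ} (hK : 0 < K) (hu : 0 < u) {f : ℝ → ℝ}
    (h0 : ∀ m ∈ Icc u v, 0 ≤ f m) (h : ∀ m ∈ Icc u v, Coexist K m (f m)) :
    ContinuousOn f (Icc u v) := by
  have hb : ∀ m ∈ Icc u v, 0 ≤ inflLevel m := fun m hm => by
    linarith [three_lt_inflLevel (hu.trans_le hm.1)]
  choose! Y₁ Y₂ hY₁ hY₂ hmin₁ hmin₂ using h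
  set L := v * (K + Real.cosh v) with hLdef
  set R := max (inflLevel v) (L / K) with hR
  have hfL : ∀ m ∈ Icc u v, f m ≤ L := by
    intro m hm
    have h1 := hmin₁ m hm
    have hv : Y₁ m ≤ v := (hY₁ m hm).trans hm.2
    rw [← h1.slope_eq hK (h0 m hm), slope, hLdef]
    have h2 : 0 ≤ inflLevel m * Real.sinh (Y₁ m) :=
      mul_nonneg (hb m hm) (Real.sinh_nonneg_iff.2 h1.1)
    have h3 : Real.cosh (Y₁ m) ≤ Real.cosh v := by
      rw [Real.cosh_le_cosh, abs_of_nonneg h1.1, abs_of_nonneg (h1.1.trans hv)]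
      exact hv
    have h4 : Y₁ m * (K + Real.cosh (Y₁ m)) ≤ v * (K + Real.cosh v) :=
      mul_le_mul hv (by linarith) (add_cosh_pos hK _).le (h1.1.trans hv)
    linarith
  have hYR : ∀ m ∈ Icc u v, Y₂ m ≤ R := by
    intro m hm
    refine ((hmin₂ m hm).le_of_le hK (hb m hm) (h0 m hm) (hfL m hm)).trans ?_
    exact max_le_max (strictMonoOn_inflLevel.monotoneOn (mem_Ioi.2 (hu.trans_le hm.1))
      (mem_Ioi.2 (hu.trans_le (hm.1.trans hm.2))) hm.2) le_rfl
  intro m hm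
  have hcont : ContinuousWithinAt inflLevel (Icc u v) m :=
    (continuousOn_inflLevel.mono fun x hx => mem_Ioi.2 (hu.trans_le hx.1)) m hm
  rw [ContinuousWithinAt, tendsto_iff_ultrafilter]
  intro g hg
  have hmem : ∀ᶠ x in (g : Filter ℝ), x ∈ Icc u v := hg self_mem_nhdsWithin
  have hgm : Tendsto id (g : Filter ℝ) (𝓝 m) := hg.trans nhdsWithin_le_nhds
  have hgb : Tendsto inflLevel (g : Filter ℝ) (𝓝 (inflLevel m)) := hcont.mono_left hg
  obtain ⟨⟨D, y₁, y₂⟩, -, hlim⟩ :=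
    ((isCompact_Icc (a := (0 : ℝ)) (b := L)).prod ((isCompact_Icc (a := (0 : ℝ)) (b := v)).prod
      (isCompact_Icc (a := (0 : ℝ)) (b := R)))).ultrafilter_le_nhds
      (g.map fun x => (f x, Y₁ x, Y₂ x)) (by
        rw [le_principal_iff, Ultrafilter.coe_map, mem_map]
        filter_upwards [hmem] with x hx
        exact ⟨⟨h0 x hx, hfL x hx⟩, ⟨(hmin₁ x hx).1, (hY₁ x hx).trans hx.2⟩,
          ⟨(hmin₂ x hx).1, hYR x hx⟩⟩)
  have hlim' : Tendsto (fun x => (f x, Y₁ x, Y₂ x)) (g : Filter ℝ) (𝓝 (D, y₁, y₂)) := hlim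
  have hD : Tendsto f g (𝓝 D) := (continuous_fst.tendsto _).comp hlim'
  have ht₁ : Tendsto Y₁ g (𝓝 y₁) :=
    ((continuous_fst.comp continuous_snd).tendsto _).comp hlim'
  have ht₂ : Tendsto Y₂ g (𝓝 y₂) :=
    ((continuous_snd.comp continuous_snd).tendsto _).comp hlim'
  have hD0 : 0 ≤ D := ge_of_tendsto hD (hmem.mono h0)
  have hco : Coexist K m D := by
    refine ⟨y₁, y₂, le_of_tendsto_of_tendsto ht₁ hgm (hmem.mono hY₁),
      le_of_tendsto_of_tendsto hgm ht₂ (hmem.mono hY₂), ?_, ?_⟩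
    · exact (isClosed_halfMin hK).mem_of_tendsto (hgb.prodMk_nhds (hD.prodMk_nhds ht₁))
        (hmem.mono hmin₁)
    · exact (isClosed_halfMin hK).mem_of_tendsto (hgb.prodMk_nhds (hD.prodMk_nhds ht₂))
        (hmem.mono hmin₂)
  have : D = f m := hco.unique hK hD0 (h0 m hm) ⟨Y₁ m, Y₂ m, hY₁ m hm, hY₂ m hm,
    hmin₁ m hm, hmin₂ m hm⟩
  rw [← this]
  exact hD

/-! ### The rate function and Laplace's method -/

/-- Expected weight of a spin that has evolved to `1`, for an initial spin `±1` with weight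
`exp (± y / 2) / 2`, when the correlation of the initial and final spin is `ε`. -/
noncomputable def tilt (ε y : ℝ) : ℝ := Real.cosh (y / 2) + ε * Real.sinh (y / 2)

lemma exp_le_tilt {ε : ℝ} (h0 : 0 ≤ ε) (h1 : ε ≤ 1) (y : ℝ) : Real.exp (-(|y| / 2)) ≤ tilt ε y := by
  have hs : Real.sinh (|y| / 2) = |Real.sinh (y / 2)| := by
    rw [Real.abs_sinh, abs_div, abs_of_pos (two_pos : (0 : ℝ) < 2)]
  have hc : Real.cosh (|y| / 2) = Real.cosh (y / 2) := by
    rw [← Real.cosh_abs (y / 2), abs_div, abs_of_pos (two_pos : (0 : ℝ) < 2)]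
  rw [← Real.cosh_sub_sinh, hs, hc]
  unfold tilt
  have := neg_abs_le (Real.sinh (y / 2))
  have := abs_nonneg (Real.sinh (y / 2))
  nlinarith

lemma tilt_le_exp {ε : ℝ} (h0 : 0 ≤ ε) (h1 : ε ≤ 1) (y : ℝ) : tilt ε y ≤ Real.exp (|y| / 2) := by
  have hs : Real.sinh (|y| / 2) = |Real.sinh (y / 2)| := by
    rw [Real.abs_sinh, abs_div, abs_of_pos (two_pos : (0 : ℝ) < 2)]
  have hc : Real.cosh (|y| / 2) = Real.cosh (y / 2) := by
    rw [← Real.cosh_abs (y / 2), abs_div, abs_of_pos (two_pos : (0 : ℝ) < 2)]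
  rw [← Real.cosh_add_sinh, hs, hc]
  unfold tilt
  have := le_abs_self (Real.sinh (y / 2))
  have := abs_nonneg (Real.sinh (y / 2))
  nlinarith

lemma tilt_pos {ε : ℝ} (h0 : 0 ≤ ε) (h1 : ε ≤ 1) (y : ℝ) : 0 < tilt ε y :=
  (Real.exp_pos _).trans_le (exp_le_tilt h0 h1 y)

@[fun_prop]
lemma continuous_tilt (ε : ℝ) : Continuous (tilt ε) := by unfold tilt; fun_prop

/-- The logarithm of `tilt`. -/
noncomputable def logTilt (ε y : ℝ) : ℝ := Real.log (tilt ε y)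

lemma abs_logTilt_le {ε : ℝ} (h0 : 0 ≤ ε) (h1 : ε ≤ 1) (y : ℝ) : |logTilt ε y| ≤ |y| / 2 := by
  rw [abs_le, logTilt]
  constructor
  · rw [Real.le_log_iff_exp_le (tilt_pos h0 h1 y)]; exact exp_le_tilt h0 h1 y
  · rw [Real.log_le_iff_le_exp (tilt_pos h0 h1 y)]; exact tilt_le_exp h0 h1 y

lemma continuous_logTilt {ε : ℝ} (h0 : 0 ≤ ε) (h1 : ε ≤ 1) : Continuous (logTilt ε) :=
  (continuous_tilt ε).log fun y => (tilt_pos h0 h1 y).ne'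

@[simp] lemma logTilt_zero (ε : ℝ) : logTilt ε 0 = 0 := by simp [logTilt, tilt]

/-- The rate function of the auxiliary Gaussian field, conditionally on the evolved spins. The
parameters `p` and `q` are `2 β` times the densities of the spins `1` and `-1`. -/
noncomputable def rate (ε p q y : ℝ) : ℝ := y ^ 2 / 2 - p * logTilt ε y - q * logTilt ε (-y)

lemma continuous_rate {ε : ℝ} (h0 : 0 ≤ ε) (h1 : ε ≤ 1) (p q : ℝ) : Continuous (rate ε p q) := by
  have := continuous_logTilt h0 h1
  unfold rate
  fun_prop

lemma rate_zero (ε p q : ℝ) : rate ε p q 0 = 0 := by simp [rate]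

lemma le_rate {ε : ℝ} (h0 : 0 ≤ ε) (h1 : ε ≤ 1) (p q y : ℝ) :
    y ^ 2 / 2 - (|p| + |q|) * (|y| / 2) ≤ rate ε p q y := by
  have h2 := abs_logTilt_le h0 h1 y
  have h3 := abs_logTilt_le h0 h1 (-y)
  rw [abs_neg] at h3
  have h4 : p * logTilt ε y ≤ |p| * (|y| / 2) :=
    (le_abs_self _).trans ((abs_mul _ _).trans_le (mul_le_mul_of_nonneg_left h2 (abs_nonneg p)))
  have h5 : q * logTilt ε (-y) ≤ |q| * (|y| / 2) :=
    (le_abs_self _).trans ((abs_mul _ _).trans_le (mul_le_mul_of_nonneg_left h3 (abs_nonneg q)))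
  unfold rate
  linarith

lemma abs_rate_sub_le {ε : ℝ} (h0 : 0 ≤ ε) (h1 : ε ≤ 1) (p q p' q' y : ℝ) :
    |rate ε p' q' y - rate ε p q y| ≤ (|p' - p| + |q' - q|) * (|y| / 2) := by
  have h2 := abs_logTilt_le h0 h1 y
  have h3 := abs_logTilt_le h0 h1 (-y)
  rw [abs_neg] at h3
  have : rate ε p' q' y - rate ε p q y
      = -((p' - p) * logTilt ε y + (q' - q) * logTilt ε (-y)) := by unfold rate; ring
  rw [this, abs_neg, add_mul]
  refine (abs_add_le _ _).trans (add_le_add ?_ ?_)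
  · rw [abs_mul]; exact mul_le_mul_of_nonneg_left h2 (abs_nonneg _)
  · rw [abs_mul]; exact mul_le_mul_of_nonneg_left h3 (abs_nonneg _)

/-- `y` is a global minimiser of the rate function. -/
def RateMin (ε p q y : ℝ) : Prop := ∀ z, rate ε p q y ≤ rate ε p q z

lemma RateMin.abs_le {ε : ℝ} (h0 : 0 ≤ ε) (h1 : ε ≤ 1) {p q y : ℝ} (h : RateMin ε p q y) :
    |y| ≤ |p| + |q| := by
  have h2 := h 0
  rw [rate_zero] at h2
  have h3 := le_rate h0 h1 p q y
  rcases (abs_nonneg y).eq_or_lt with h4 | h4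
  · rw [← h4]; positivity
  · have h5 : |y| * |y| ≤ (|p| + |q|) * |y| := by rw [abs_mul_abs_self]; nlinarith
    exact le_of_mul_le_mul_right h5 h4

lemma exists_rateMin {ε : ℝ} (h0 : 0 ≤ ε) (h1 : ε ≤ 1) (p q : ℝ) : ∃ y, RateMin ε p q y := by
  set R := |p| + |q| with hR
  have hR0 : 0 ≤ R := by positivity
  obtain ⟨y, -, hmin⟩ := isCompact_Icc.exists_isMinOn (⟨0, by simpa using hR0⟩ : (Icc (-R) R).Nonempty)
    (continuous_rate h0 h1 p q).continuousOn
  refine ⟨y, fun z => ?_⟩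
  by_cases hz : z ∈ Icc (-R) R
  · exact hmin hz
  · rw [mem_Icc, ← abs_le, not_le] at hz
    have h2 : rate ε p q y ≤ rate ε p q 0 := hmin (by simpa using hR0)
    have h3 := le_rate h0 h1 p q z
    rw [rate_zero] at h2
    have h4 : R * |z| ≤ |z| * |z| := mul_le_mul_of_nonneg_right hz.le (abs_nonneg z)
    rw [abs_mul_abs_self] at h4
    nlinarith

lemma isCompact_rateMin {ε : ℝ} (h0 : 0 ≤ ε) (h1 : ε ≤ 1) (p q : ℝ) :
    IsCompact {y | RateMin ε p q y} := by
  refine (isCompact_Icc (a := -(|p| + |q|)) (b := |p| + |q|)).of_isClosed_subset ?_ fun y hy =>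
    abs_le.1 (RateMin.abs_le h0 h1 hy)
  have : {y | RateMin ε p q y} = ⋂ z, {y | rate ε p q y ≤ rate ε p q z} := by
    ext y; simp [RateMin]
  rw [this]
  exact isClosed_iInter fun z => isClosed_le (continuous_rate h0 h1 p q) continuous_const

/-- Away from its minimisers, the rate function stays above its values on some open set by a
positive gap, uniformly under small changes of the parameters. -/
lemma exists_rate_gap {ε : ℝ} (h0 : 0 ≤ ε) (h1 : ε ≤ 1) (p q : ℝ) {U : Set ℝ} (hU : IsOpen U)
    (hmin : ∀ y, RateMin ε p q y → y ∈ U) :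
    ∃ v κ : ℝ, ∃ O : Set ℝ, 0 < κ ∧ IsOpen O ∧ O.Nonempty ∧ ∀ᶠ x : ℝ × ℝ in 𝓝 (p, q),
      (∀ y, y ∉ U → v + κ ≤ rate ε x.1 x.2 y) ∧ ∀ y ∈ O, rate ε x.1 x.2 y ≤ v := by
  have hc := continuous_rate h0 h1 p q
  obtain ⟨y₀, hy₀⟩ := exists_rateMin h0 h1 p q
  set v₀ := rate ε p q y₀ with hv₀
  have hv₀le : v₀ ≤ 0 := (hy₀ 0).trans_eq (rate_zero ε p q)
  set R := |p| + |q| + 1 with hR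
  have hR0 : 0 ≤ R := by positivity
  set M := R + |y₀| + 2 with hM
  have hM2 : 2 ≤ M := by have := abs_nonneg y₀; linarith
  have hMR : R + 1 ≤ M := by have := abs_nonneg y₀; linarith
  obtain ⟨κ, hκ0, hκ1, hκ⟩ : ∃ κ : ℝ, 0 < κ ∧ 3 * κ ≤ 1 ∧
      ∀ y ∈ Icc (-M) M \ U, v₀ + 4 * κ ≤ rate ε p q y := by
    rcases (Icc (-M) M \ U).eq_empty_or_nonempty with he | hne
    · exact ⟨1 / 3, by norm_num, by norm_num, by simp [he]⟩
    · obtain ⟨y₁, hy₁, hmin₁⟩ := (isCompact_Icc.diff hU).exists_isMinOn hne hc.continuousOn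
      have hlt : v₀ < rate ε p q y₁ := by
        by_contra! hle
        exact hy₁.2 (hmin y₁ fun z => hle.trans (hy₀ z))
      refine ⟨min (1 / 3) ((rate ε p q y₁ - v₀) / 4), lt_min (by norm_num) (by linarith), ?_, ?_⟩
      · linarith [min_le_left (1 / 3) ((rate ε p q y₁ - v₀) / 4)]
      · intro y hy
        have : rate ε p q y₁ ≤ rate ε p q y := hmin₁ hy
        linarith [min_le_right (1 / 3) ((rate ε p q y₁ - v₀) / 4)]
  have hclose : ∀ᶠ x : ℝ × ℝ in 𝓝 (p, q), (|x.1 - p| + |x.2 - q|) * (M / 2) < min κ (M / 2) := by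
    have : Tendsto (fun x : ℝ × ℝ => (|x.1 - p| + |x.2 - q|) * (M / 2)) (𝓝 (p, q)) (𝓝 0) := by
      have hc : Continuous fun x : ℝ × ℝ => (|x.1 - p| + |x.2 - q|) * (M / 2) := by fun_prop
      simpa using hc.tendsto (p, q)
    exact this.eventually_lt_const (lt_min hκ0 (by linarith))
  have hnear : ∀ x : ℝ × ℝ, (|x.1 - p| + |x.2 - q|) * (M / 2) < κ → ∀ y, |y| ≤ M →
      |rate ε x.1 x.2 y - rate ε p q y| ≤ κ := by
    intro x hx y hy
    refine (abs_rate_sub_le h0 h1 p q x.1 x.2 y).trans (le_trans ?_ hx.le)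
    exact mul_le_mul_of_nonneg_left (by linarith) (by positivity)
  refine ⟨v₀ + 2 * κ, κ, Ioo (-M) M ∩ {y | rate ε p q y < v₀ + κ}, hκ0,
    isOpen_Ioo.inter (isOpen_lt hc continuous_const), ⟨y₀, ?_, ?_⟩, ?_⟩
  · rw [mem_Ioo, ← abs_lt]; linarith
  · rw [mem_ofPred_eq]; linarith
  filter_upwards [hclose] with x hx
  have hxκ := hx.trans_le (min_le_left _ _)
  have hx1 : |x.1 - p| + |x.2 - q| < 1 := by
    have h := hx.trans_le (min_le_right _ _)
    by_contra! h2
    nlinarith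
  refine ⟨fun y hy => ?_, fun y hy => ?_⟩
  · rcases le_or_gt |y| M with hyM | hyM
    · have h2 := hκ y ⟨abs_le.1 hyM, hy⟩
      have h3 := abs_le.1 (hnear x hxκ y hyM)
      linarith [h3.1]
    · have h2 := le_rate h0 h1 x.1 x.2 y
      have h3 : |x.1| + |x.2| ≤ R := by
        have h4 := abs_sub_abs_le_abs_sub x.1 p
        have h5 := abs_sub_abs_le_abs_sub x.2 q
        linarith
      have h4 : (|x.1| + |x.2|) * |y| ≤ R * |y| := mul_le_mul_of_nonneg_right h3 (abs_nonneg y)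
      have h5 : y ^ 2 = |y| * |y| := by rw [abs_mul_abs_self]; ring
      nlinarith
  · have h2 := hy.2
    rw [mem_ofPred_eq] at h2
    have h3 := abs_le.1 (hnear x hxκ y (abs_lt.2 hy.1).le)
    linarith [h3.2]

/-- Laplace's method with a moving rate function: the average of `h` under the density proportional
to `w * exp (-l n * φ n)` is eventually close to `z` if `h` is close to `z` on the set `U` off
which `φ n` is larger, by a fixed gap, than on some fixed open set. -/
lemma eventually_laplace {w h : ℝ → ℝ} {φ : ℕ → ℝ → ℝ} {l : ℕ → ℝ} {U O : Set ℝ} {v κ z η : ℝ}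
    (hwpos : ∀ y, 0 < w y) (hwi : MeasureTheory.Integrable w)
    (hhi : MeasureTheory.Integrable fun y => w y * h y)
    (hφ : ∀ n, Continuous (φ n)) (hφb : ∀ n, ∃ c, ∀ y, c ≤ φ n y)
    (hl : Tendsto l atTop atTop) (hl0 : ∀ n, 0 ≤ l n) (hO : IsOpen O) (hOne : O.Nonempty)
    (hκ : 0 < κ) (hη : 0 < η) (hhz : ∀ y ∈ U, |h y - z| ≤ η)
    (hgap : ∀ᶠ n in atTop, (∀ y, y ∉ U → v + κ ≤ φ n y) ∧ ∀ y ∈ O, φ n y ≤ v) :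
    ∀ᶠ n in atTop, 0 < (∫ y, w y * Real.exp (-(l n * φ n y))) ∧
      |(∫ y, w y * h y * Real.exp (-(l n * φ n y))) / (∫ y, w y * Real.exp (-(l n * φ n y))) - z|
        ≤ 2 * η := by
  have hint : ∀ n, ∀ f : ℝ → ℝ, MeasureTheory.Integrable f →
      MeasureTheory.Integrable fun y => f y * Real.exp (-(l n * φ n y)) := by
    intro n f hf
    obtain ⟨c, hc⟩ := hφb n
    refine hf.mul_bdd (c := Real.exp (-(l n * c))) ?_ (Eventually.of_forall fun y => ?_)
    · have := hφ n
      exact Continuous.aestronglyMeasurable (by fun_prop)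
    · rw [Real.norm_eq_abs, Real.abs_exp, Real.exp_le_exp]
      have := mul_le_mul_of_nonneg_left (hc y) (hl0 n)
      linarith
  set c₀ := ∫ y in O, w y with hc₀
  have hc₀pos : 0 < c₀ := by
    rw [hc₀, MeasureTheory.setIntegral_pos_iff_support_of_nonneg_ae
      (Eventually.of_forall fun y => (hwpos y).le) hwi.integrableOn]
    have : Function.support w = univ := by
      ext y; simp [(hwpos y).ne']
    rw [this, univ_inter]
    exact hO.measure_pos _ hOne
  have hwz : MeasureTheory.Integrable fun y => w y * |h y - z| := by
    have : (fun y => w y * |h y - z|) = fun y => |w y * h y - w y * z| := by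
      ext y
      rw [← mul_sub, abs_mul, abs_of_pos (hwpos y)]
    rw [this]
    exact (hhi.sub (hwi.mul_const z)).abs
  set C := ∫ y, w y * |h y - z| with hC
  have hsmall : ∀ᶠ n in atTop, C / c₀ * Real.exp (-(l n * κ)) < η := by
    have h1 : Tendsto (fun n => -(l n * κ)) atTop atBot :=
      tendsto_neg_atTop_atBot.comp (hl.atTop_mul_const hκ)
    have h2 := (Real.tendsto_exp_atBot.comp h1).const_mul (C / c₀)
    rw [mul_zero] at h2
    exact h2.eventually_lt_const hη
  filter_upwards [hgap, hsmall] with n hn hsn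
  set I := ∫ y, w y * Real.exp (-(l n * φ n y)) with hI
  have hI0 : Real.exp (-(l n * v)) * c₀ ≤ I := by
    rw [hc₀, ← MeasureTheory.integral_const_mul]
    refine (MeasureTheory.setIntegral_mono_on (hwi.integrableOn.const_mul _)
      (hint n w hwi).integrableOn hO.measurableSet fun y hy => ?_).trans
      (MeasureTheory.setIntegral_le_integral (hint n w hwi) (Eventually.of_forall fun y =>
        mul_nonneg (hwpos y).le (Real.exp_pos _).le))
    rw [mul_comm]
    apply mul_le_mul_of_nonneg_left _ (hwpos y).le
    rw [Real.exp_le_exp]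
    have := mul_le_mul_of_nonneg_left (hn.2 y hy) (hl0 n)
    linarith
  have hIpos : 0 < I := lt_of_lt_of_le (mul_pos (Real.exp_pos _) hc₀pos) hI0
  refine ⟨hIpos, ?_⟩
  have hnum : (∫ y, w y * h y * Real.exp (-(l n * φ n y))) - z * I
      = ∫ y, (w y * h y - z * w y) * Real.exp (-(l n * φ n y)) := by
    rw [hI, ← MeasureTheory.integral_const_mul, ← MeasureTheory.integral_sub (hint n _ hhi)
      ((hint n w hwi).const_mul z)]
    congr 1; ext y; ring
  have hbound : |(∫ y, w y * h y * Real.exp (-(l n * φ n y))) - z * I|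
      ≤ η * I + C * Real.exp (-(l n * (v + κ))) := by
    rw [hnum]
    refine MeasureTheory.abs_integral_le_integral_abs.trans ?_
    rw [hI, hC, ← MeasureTheory.integral_const_mul, ← MeasureTheory.integral_mul_const,
      ← MeasureTheory.integral_add ((hint n w hwi).const_mul η) (hwz.mul_const _)]
    refine MeasureTheory.integral_mono (hint n _ (hhi.sub (hwi.const_mul z))).abs
      (((hint n w hwi).const_mul η).add (hwz.mul_const _)) fun y => ?_
    have he := Real.exp_pos (-(l n * φ n y))
    have he' := Real.exp_pos (-(l n * (v + κ)))
    have hw0 := hwpos y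
    have habs : |(w y * h y - z * w y) * Real.exp (-(l n * φ n y))|
        = w y * |h y - z| * Real.exp (-(l n * φ n y)) := by
      rw [abs_mul, Real.abs_exp, mul_comm z, ← mul_sub, abs_mul, abs_of_pos hw0]
    change |(w y * h y - z * w y) * Real.exp (-(l n * φ n y))| ≤ _
    rw [habs]
    by_cases hy : y ∈ U
    · have h1 : w y * |h y - z| * Real.exp (-(l n * φ n y))
          ≤ w y * η * Real.exp (-(l n * φ n y)) := by
        have := hhz y hy
        gcongr
      have h2 : 0 ≤ w y * |h y - z| * Real.exp (-(l n * (v + κ))) := by positivity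
      linarith
    · have h1 : w y * |h y - z| * Real.exp (-(l n * φ n y))
          ≤ w y * |h y - z| * Real.exp (-(l n * (v + κ))) := by
        apply mul_le_mul_of_nonneg_left _ (by positivity)
        rw [Real.exp_le_exp]
        have := mul_le_mul_of_nonneg_left (hn.1 y hy) (hl0 n)
        linarith
      have h2 : 0 ≤ η * (w y * Real.exp (-(l n * φ n y))) := by positivity
      linarith
  have hdiv : (∫ y, w y * h y * Real.exp (-(l n * φ n y))) / I - z
      = ((∫ y, w y * h y * Real.exp (-(l n * φ n y))) - z * I) / I := by
    field_simp
  rw [hdiv, abs_div, abs_of_pos hIpos, div_le_iff₀ hIpos]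
  refine hbound.trans ?_
  have h3 : C * Real.exp (-(l n * (v + κ))) ≤ η * I := by
    have h4 : C * Real.exp (-(l n * κ)) ≤ η * c₀ := by
      have := hsn.le
      rw [div_mul_eq_mul_div, div_le_iff₀ hc₀pos] at this
      exact this
    have h5 : Real.exp (-(l n * (v + κ))) = Real.exp (-(l n * κ)) * Real.exp (-(l n * v)) := by
      rw [← Real.exp_add]; congr 1; ring
    rw [h5, ← mul_assoc]
    calc C * Real.exp (-(l n * κ)) * Real.exp (-(l n * v))
        ≤ η * c₀ * Real.exp (-(l n * v)) := mul_le_mul_of_nonneg_right h4 (Real.exp_pos _).le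
      _ = η * (Real.exp (-(l n * v)) * c₀) := by ring
      _ ≤ η * I := mul_le_mul_of_nonneg_left hI0 hη.le
  linarith

/-- Shifting weight from the spin `-1` to the spin `1` moves the minimisers upwards. -/
lemma RateMin.le_of_shift {ε : ℝ} (h0 : 0 < ε) (h1 : ε ≤ 1) {p q τ y y' : ℝ} (hτ : 0 < τ)
    (h : RateMin ε p q y) (h' : RateMin ε (p + τ) (q - τ) y') : y ≤ y' := by
  by_contra! hlt
  have h2 := h y'
  have h3 := h' y
  have hs : Real.sinh (y' / 2) < Real.sinh (y / 2) := Real.sinh_strictMono (by linarith)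
  have hmono : logTilt ε y' - logTilt ε (-y') < logTilt ε y - logTilt ε (-y) := by
    unfold logTilt
    rw [← Real.log_div (tilt_pos h0.le h1 _).ne' (tilt_pos h0.le h1 _).ne',
      ← Real.log_div (tilt_pos h0.le h1 _).ne' (tilt_pos h0.le h1 _).ne']
    apply Real.log_lt_log (div_pos (tilt_pos h0.le h1 _) (tilt_pos h0.le h1 _))
    rw [div_lt_div_iff₀ (tilt_pos h0.le h1 _) (tilt_pos h0.le h1 _)]
    have hd : Real.sinh (y' / 2 - y / 2) < 0 := Real.sinh_neg_iff.2 (by linarith)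
    rw [Real.sinh_sub] at hd
    unfold tilt
    rw [neg_div, neg_div, Real.cosh_neg, Real.sinh_neg, Real.cosh_neg, Real.sinh_neg]
    nlinarith
  have e1 : rate ε (p + τ) (q - τ) y
      = rate ε p q y - τ * (logTilt ε y - logTilt ε (-y)) := by unfold rate; ring
  have e2 : rate ε (p + τ) (q - τ) y'
      = rate ε p q y' - τ * (logTilt ε y' - logTilt ε (-y')) := by unfold rate; ring
  rw [e1, e2] at h3
  have := mul_lt_mul_of_pos_left hmono hτ
  linarith

/-! ### Hubbard-Stratonovich representation of the evolved measure -/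

lemma sum_signType (f : SignType → ℝ) : ∑ e, f e = f 0 + f 1 + f (-1) := by
  have : (Finset.univ : Finset SignType) = {0, 1, -1} := by decide
  rw [this, Finset.sum_insert (by decide), Finset.sum_insert (by decide), Finset.sum_singleton]
  ring

lemma signType_cases (e : SignType) : e = 0 ∨ e = 1 ∨ e = -1 := by
  cases e <;> simp

lemma repulsion_eq (a b : SignType) :
    (if a * b = -1 then (1 : ℝ) else 0) = ((a : ℝ) ^ 2 * (b : ℝ) ^ 2 - (a : ℝ) * (b : ℝ)) / 2 := by
  rcases signType_cases a with rfl | rfl | rfl <;> rcases signType_cases b with rfl | rfl | rfl <;>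
    simp

lemma sum_repulsion_eq {N : ℕ} (ω : Fin N → SignType) :
    (∑ i, ∑ j, if ω i * ω j = -1 then (1 : ℝ) else 0)
      = ((∑ i, (ω i : ℝ) ^ 2) ^ 2 - (∑ i, (ω i : ℝ)) ^ 2) / 2 := by
  simp only [repulsion_eq]
  rw [sq (∑ i, (ω i : ℝ) ^ 2), sq (∑ i, (ω i : ℝ)), Finset.sum_mul_sum, Finset.sum_mul_sum,
    ← Finset.sum_sub_distrib, Finset.sum_div]
  refine Finset.sum_congr rfl fun i _ => ?_
  rw [← Finset.sum_sub_distrib, Finset.sum_div]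

lemma integrable_exp_neg_mul_sq_mul_exp {a : ℝ} (ha : 0 < a) (s : ℝ) :
    MeasureTheory.Integrable fun y : ℝ => Real.exp (-a * y ^ 2) * Real.exp (s * y) := by
  have h := ((integrable_exp_neg_mul_sq ha).comp_sub_right (s / (2 * a))).const_mul
    (Real.exp (s ^ 2 / (4 * a)))
  refine h.congr (Eventually.of_forall fun y => ?_)
  change Real.exp (s ^ 2 / (4 * a)) * Real.exp (-a * (y - s / (2 * a)) ^ 2)
    = Real.exp (-a * y ^ 2) * Real.exp (s * y)
  rw [← Real.exp_add, ← Real.exp_add]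
  congr 1
  field_simp
  ring

/-- Completing the square in a Gaussian integral. -/
lemma integral_exp_neg_mul_sq_mul_exp {a : ℝ} (ha : 0 < a) (s : ℝ) :
    ∫ y : ℝ, Real.exp (-a * y ^ 2) * Real.exp (s * y)
      = Real.exp (s ^ 2 / (4 * a)) * ∫ y : ℝ, Real.exp (-a * y ^ 2) := by
  rw [← MeasureTheory.integral_sub_right_eq_self (fun y : ℝ => Real.exp (-a * y ^ 2))
    (s / (2 * a)), ← MeasureTheory.integral_const_mul]
  congr 1
  ext y
  rw [← Real.exp_add, ← Real.exp_add]
  congr 1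
  field_simp
  ring

/-- The single-site weight of the evolved spin `e` in the auxiliary field `y`. -/
noncomputable def siteWeight (α : SignType → ℝ) (t : ℝ) (e : SignType) (y : ℝ) : ℝ :=
  ∑ a : SignType, Real.exp ((a : ℝ) / 2 * y) * α a * spinFlip t a e

lemma spinFlip_eq_zero {t : ℝ} {a e : SignType} (h : (a : ℝ) ^ 2 ≠ (e : ℝ) ^ 2) :
    spinFlip t a e = 0 := by
  rcases signType_cases a with rfl | rfl | rfl <;> rcases signType_cases e with rfl | rfl | rfl <;>
    simp [spinFlip] at h ⊢

/-- The Hubbard-Stratonovich representation of the evolved measure: the quadratic interaction is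
linearised by a Gaussian field `y`, given which the sites are independent. Holes do not move, so
the part of the interaction that depends on the number of holes can be taken out. -/
lemma evolved_eq {β : ℝ} (hβ : 0 < β) (α : SignType → ℝ) (t : ℝ) {N : ℕ} (hN : 0 < N)
    (η : Fin N → SignType) :
    evolved β α t N η = (partitionFunction β α N)⁻¹
        * (∫ y : ℝ, Real.exp (-(N / (4 * β)) * y ^ 2))⁻¹
        * Real.exp (-(β / (4 * N)) * (∑ i, (η i : ℝ) ^ 2) ^ 2)
        * ∫ y : ℝ, Real.exp (-(N / (4 * β)) * y ^ 2) * ∏ i, siteWeight α t (η i) y := by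
  have hN' : (0 : ℝ) < N := by exact_mod_cast hN
  have ha : 0 < (N : ℝ) / (4 * β) := by positivity
  set G := ∫ y : ℝ, Real.exp (-(N / (4 * β)) * y ^ 2) with hG
  have hG0 : G ≠ 0 := by
    rw [hG, integral_gaussian]
    have : 0 < Real.pi / (N / (4 * β)) := by positivity
    exact (Real.sqrt_pos.2 this).ne'
  have hterm : ∀ ω : Fin N → SignType, weight β α N ω * ∏ i, spinFlip t (ω i) (η i)
      = Real.exp (-(β / (4 * N)) * (∑ i, (η i : ℝ) ^ 2) ^ 2) * G⁻¹ *
        ∫ y : ℝ, Real.exp (-(N / (4 * β)) * y ^ 2) *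
          ∏ i, (Real.exp ((ω i : ℝ) / 2 * y) * α (ω i) * spinFlip t (ω i) (η i)) := by
    intro ω
    by_cases hω : ∀ i, (ω i : ℝ) ^ 2 = (η i : ℝ) ^ 2
    · have hprod : ∀ y : ℝ,
          Real.exp (-(N / (4 * β)) * y ^ 2) *
            ∏ i, (Real.exp ((ω i : ℝ) / 2 * y) * α (ω i) * spinFlip t (ω i) (η i))
          = Real.exp (-(N / (4 * β)) * y ^ 2) * Real.exp ((∑ i, (ω i : ℝ)) / 2 * y) *
            ((∏ i, α (ω i)) * ∏ i, spinFlip t (ω i) (η i)) := by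
        intro y
        rw [Finset.prod_mul_distrib, Finset.prod_mul_distrib, ← Real.exp_sum, Finset.sum_div,
          Finset.sum_mul]
        ring
      simp only [hprod]
      rw [MeasureTheory.integral_mul_const, integral_exp_neg_mul_sq_mul_exp ha, ← hG, weight,
        sum_repulsion_eq]
      have hs : ∑ i, (ω i : ℝ) ^ 2 = ∑ i, (η i : ℝ) ^ 2 := Finset.sum_congr rfl fun i _ => hω i
      rw [hs]
      have he : Real.exp (-(β / (2 * N)) * (((∑ i, (η i : ℝ) ^ 2) ^ 2 - (∑ i, (ω i : ℝ)) ^ 2) / 2))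
          = Real.exp (-(β / (4 * N)) * (∑ i, (η i : ℝ) ^ 2) ^ 2)
            * Real.exp (((∑ i, (ω i : ℝ)) / 2) ^ 2 / (4 * (N / (4 * β)))) := by
        rw [← Real.exp_add]
        congr 1
        field_simp
        ring
      rw [he]
      field_simp
    · push Not at hω
      obtain ⟨i, hi⟩ := hω
      have h0 := spinFlip_eq_zero (t := t) hi
      have h1 : ∏ i, spinFlip t (ω i) (η i) = 0 := Finset.prod_eq_zero (Finset.mem_univ i) h0
      have h2 : ∀ y : ℝ,
          ∏ i, (Real.exp ((ω i : ℝ) / 2 * y) * α (ω i) * spinFlip t (ω i) (η i)) = 0 := fun y =>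
        Finset.prod_eq_zero (Finset.mem_univ i) (by rw [h0, mul_zero])
      simp [h1, h2]
  have hint : ∀ ω : Fin N → SignType, MeasureTheory.Integrable fun y : ℝ =>
      Real.exp (-(N / (4 * β)) * y ^ 2) *
        ∏ i, (Real.exp ((ω i : ℝ) / 2 * y) * α (ω i) * spinFlip t (ω i) (η i)) := by
    intro ω
    have := (integrable_exp_neg_mul_sq_mul_exp ha ((∑ i, (ω i : ℝ)) / 2)).mul_const
      ((∏ i, α (ω i)) * ∏ i, spinFlip t (ω i) (η i))
    refine this.congr (Eventually.of_forall fun y => ?_)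
    simp only
    rw [Finset.prod_mul_distrib, Finset.prod_mul_distrib, ← Real.exp_sum, Finset.sum_div,
      Finset.sum_mul]
    ring
  have hev : evolved β α t N η = (partitionFunction β α N)⁻¹ *
      ∑ ω : Fin N → SignType, weight β α N ω * ∏ i, spinFlip t (ω i) (η i) := by
    unfold evolved gibbs
    rw [Finset.mul_sum]
    exact Finset.sum_congr rfl fun ω _ => by ring
  rw [hev, Finset.sum_congr rfl fun ω _ => hterm ω, ← Finset.mul_sum]
  rw [← MeasureTheory.integral_finsetSum _ fun ω _ => hint ω]
  have hexp : ∀ y : ℝ, (∑ ω : Fin N → SignType, Real.exp (-(N / (4 * β)) * y ^ 2) *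
        ∏ i, (Real.exp ((ω i : ℝ) / 2 * y) * α (ω i) * spinFlip t (ω i) (η i)))
      = Real.exp (-(N / (4 * β)) * y ^ 2) * ∏ i, siteWeight α t (η i) y := by
    intro y
    rw [← Finset.mul_sum]
    congr 1
    unfold siteWeight
    rw [Finset.prod_univ_sum, Fintype.piFinset_univ]
  simp only [hexp]
  ring

lemma siteWeight_zero (α : SignType → ℝ) (t y : ℝ) : siteWeight α t 0 y = α 0 := by
  rw [siteWeight, sum_signType]
  simp [spinFlip]

lemma siteWeight_one {α : SignType → ℝ} (hα : α 1 = α (-1)) (t y : ℝ) :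
    siteWeight α t 1 y = α 1 * tilt (Real.exp (-2 * t)) y := by
  rw [siteWeight, sum_signType, ← hα]
  have h : ¬ ((1 : SignType) = -1) := by decide
  simp [spinFlip, tilt, h, Real.cosh_eq, Real.sinh_eq]
  ring_nf

lemma siteWeight_neg_one {α : SignType → ℝ} (hα : α 1 = α (-1)) (t y : ℝ) :
    siteWeight α t (-1) y = α (-1) * tilt (Real.exp (-2 * t)) (-y) := by
  rw [siteWeight, sum_signType, hα]
  have h : ¬ ((1 : SignType) = -1) := by decide
  simp [spinFlip, tilt, h, Real.cosh_eq, Real.sinh_eq]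
  ring_nf

/-- The factor by which the field `y` changes the weight of the evolved spin `e`. -/
noncomputable def siteTilt (ε y : ℝ) (e : SignType) : ℝ :=
  if e = 0 then 1 else if e = 1 then tilt ε y else tilt ε (-y)

lemma siteWeight_eq {α : SignType → ℝ} (hα : α 1 = α (-1)) (t y : ℝ) (e : SignType) :
    siteWeight α t e y = α e * siteTilt (Real.exp (-2 * t)) y e := by
  have h' : ¬ ((-1 : SignType) = 1) := by decide
  rcases signType_cases e with rfl | rfl | rfl
  · simp [siteWeight_zero, siteTilt]
  · simp [siteWeight_one hα, siteTilt]
  · simp [siteWeight_neg_one hα, siteTilt, h']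

/-! ### Limits of the conditional distributions -/

lemma card_eq_mul_empirical {n : ℕ} (η : Fin n → SignType) (e : SignType) :
    ((Finset.univ.filter fun i => η i = e).card : ℝ) = n * empirical η e := by
  rcases Nat.eq_zero_or_pos n with rfl | hn
  · simp
  · have : (n : ℝ) ≠ 0 := by exact_mod_cast hn.ne'
    unfold empirical
    field_simp

lemma sum_sq_eq {n : ℕ} (η : Fin n → SignType) :
    ∑ i, (η i : ℝ) ^ 2 = n * (empirical η 1 + empirical η (-1)) := by
  have h' : ¬ ((-1 : SignType) = 1) := by decide
  have h'' : ¬ ((1 : SignType) = -1) := by decide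
  have h : ∀ e : SignType, (e : ℝ) ^ 2 = (if e = 1 then 1 else 0) + (if e = -1 then 1 else 0) := by
    intro e
    rcases signType_cases e with rfl | rfl | rfl <;> simp [h', h'']
  simp only [h]
  rw [Finset.sum_add_distrib, Finset.sum_boole, Finset.sum_boole, card_eq_mul_empirical,
    card_eq_mul_empirical]
  ring

lemma siteTilt_eq_exp {ε : ℝ} (h0 : 0 ≤ ε) (h1 : ε ≤ 1) (y : ℝ) (e : SignType) :
    siteTilt ε y e = Real.exp ((if e = 1 then 1 else 0) * logTilt ε y
      + (if e = -1 then 1 else 0) * logTilt ε (-y)) := by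
  have h' : ¬ ((-1 : SignType) = 1) := by decide
  have h'' : ¬ ((1 : SignType) = -1) := by decide
  have hp := tilt_pos h0 h1
  rcases signType_cases e with rfl | rfl | rfl <;>
    simp [siteTilt, logTilt, h', h'', Real.exp_log (hp _)]

lemma siteTilt_pos {ε : ℝ} (h0 : 0 ≤ ε) (h1 : ε ≤ 1) (y : ℝ) (e : SignType) :
    0 < siteTilt ε y e := by
  rw [siteTilt_eq_exp h0 h1]; exact Real.exp_pos _

lemma continuous_siteTilt (ε : ℝ) (e : SignType) : Continuous fun y => siteTilt ε y e := by
  unfold siteTilt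
  split_ifs <;> fun_prop

lemma prod_siteTilt {ε : ℝ} (h0 : 0 ≤ ε) (h1 : ε ≤ 1) {n : ℕ} (η : Fin n → SignType) (y : ℝ) :
    ∏ i, siteTilt ε y (η i) = Real.exp (n * empirical η 1 * logTilt ε y
      + n * empirical η (-1) * logTilt ε (-y)) := by
  simp only [siteTilt_eq_exp h0 h1]
  rw [← Real.exp_sum, Finset.sum_add_distrib, ← Finset.sum_mul, ← Finset.sum_mul,
    Finset.sum_boole, Finset.sum_boole, card_eq_mul_empirical, card_eq_mul_empirical]

/-- The Laplace-type integral that governs the probability of the first spin, given the others. -/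
noncomputable def laplaceIntegral (β ε : ℝ) {n : ℕ} (η : Fin n → SignType) (e : SignType) : ℝ :=
  ∫ y : ℝ, Real.exp (-(1 / (4 * β)) * y ^ 2) * siteTilt ε y e *
    Real.exp (-(n / (2 * β) * rate ε (2 * β * empirical η 1) (2 * β * empirical η (-1)) y))

/-- The distribution on `SignType` with weights proportional to `α e * r e`, corrected by the
mean-field repulsion of a density `a` of nonzero spins. -/
noncomputable def kernel (β : ℝ) (α : SignType → ℝ) (a : ℝ) (r : SignType → ℝ) (e : SignType) : ℝ :=
  α e * Real.exp (-(β / 2 * a * (e : ℝ) ^ 2)) * r e /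
    ∑ e', α e' * Real.exp (-(β / 2 * a * (e' : ℝ) ^ 2)) * r e'

lemma IsSymmetricApriori.pos {α : SignType → ℝ} (h : IsSymmetricApriori α) (e : SignType) :
    0 < α e := by
  obtain ⟨-, h1, h2, h3⟩ := h
  rcases signType_cases e with rfl | rfl | rfl
  · exact h3
  · exact h2
  · rw [← h1]; exact h2

lemma partitionFunction_pos {β : ℝ} {α : SignType → ℝ} (h : IsSymmetricApriori α) (N : ℕ) :
    0 < partitionFunction β α N :=
  Finset.sum_pos (fun _ _ => mul_pos (Real.exp_pos _) (Finset.prod_pos fun _ _ => h.pos _))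
    ⟨fun _ => 0, Finset.mem_univ _⟩

lemma condProb_evolved {β : ℝ} (hβ : 0 < β) {α : SignType → ℝ} (hα : IsSymmetricApriori α) {t : ℝ}
    (ht : 0 ≤ t) {n : ℕ} (η : Fin n → SignType) :
    condProb (evolved β α t) η = kernel β α
      ((2 * (n * (empirical η 1 + empirical η (-1))) + 1) / (2 * (n + 1)))
      (laplaceIntegral β (Real.exp (-2 * t)) η) := by
  have h0 : 0 ≤ Real.exp (-2 * t) := (Real.exp_pos _).le
  have h1 : Real.exp (-2 * t) ≤ 1 := Real.exp_le_one_iff.2 (by linarith)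
  set ε := Real.exp (-2 * t) with hε
  set M := (n : ℝ) * (empirical η 1 + empirical η (-1)) with hM
  obtain ⟨A, hA, hev⟩ : ∃ A : ℝ, A ≠ 0 ∧ ∀ e : SignType, evolved β α t (n + 1) (Fin.cons e η)
      = A * (α e * Real.exp (-(β / 2 * ((2 * M + 1) / (2 * (n + 1))) * (e : ℝ) ^ 2)) *
        laplaceIntegral β ε η e) := by
    have hn : (0 : ℝ) < n + 1 := by positivity
    refine ⟨(partitionFunction β α (n + 1))⁻¹ *
      (∫ y : ℝ, Real.exp (-((n + 1 : ℕ) / (4 * β)) * y ^ 2))⁻¹ *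
      Real.exp (-(β / (4 * (n + 1))) * M ^ 2) * ∏ i, α (η i), ?_, fun e => ?_⟩
    · have hG : (∫ y : ℝ, Real.exp (-((n + 1 : ℕ) / (4 * β)) * y ^ 2)) ≠ 0 := by
        rw [integral_gaussian]
        have : 0 < Real.pi / ((n + 1 : ℕ) / (4 * β)) := by push_cast; positivity
        exact (Real.sqrt_pos.2 this).ne'
      refine mul_ne_zero (mul_ne_zero (mul_ne_zero (inv_ne_zero (partitionFunction_pos hα _).ne')
        (inv_ne_zero hG)) (Real.exp_pos _).ne') (Finset.prod_pos fun i _ => hα.pos _).ne'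
    · rw [evolved_eq hβ α t (Nat.succ_pos n)]
      simp only [Fin.sum_univ_succ, Fin.prod_univ_succ, Fin.cons_zero, Fin.cons_succ]
      rw [sum_sq_eq, ← hM]
      have hint : ∀ y : ℝ, Real.exp (-((n + 1 : ℕ) / (4 * β)) * y ^ 2) *
          (siteWeight α t e y * ∏ i, siteWeight α t (η i) y)
          = (∏ i, α (η i)) * α e * (Real.exp (-(1 / (4 * β)) * y ^ 2) * siteTilt ε y e *
            Real.exp (-(n / (2 * β) *
              rate ε (2 * β * empirical η 1) (2 * β * empirical η (-1)) y))) := by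
        intro y
        simp only [siteWeight_eq hα.2.1]
        rw [Finset.prod_mul_distrib, ← hε, prod_siteTilt h0 h1]
        have hexp : Real.exp (-((n + 1 : ℕ) / (4 * β)) * y ^ 2) *
            Real.exp (n * empirical η 1 * logTilt ε y + n * empirical η (-1) * logTilt ε (-y))
            = Real.exp (-(1 / (4 * β)) * y ^ 2) * Real.exp (-(n / (2 * β) *
              rate ε (2 * β * empirical η 1) (2 * β * empirical η (-1)) y)) := by
          rw [← Real.exp_add, ← Real.exp_add]
          congr 1
          unfold rate
          push_cast
          field_simp
          ring
        linear_combination (α e * siteTilt ε y e * ∏ i, α (η i)) * hexp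
      simp only [hint]
      rw [MeasureTheory.integral_const_mul, ← laplaceIntegral]
      have hsq : ((e : ℝ) ^ 2) ^ 2 = (e : ℝ) ^ 2 := by
        rcases signType_cases e with rfl | rfl | rfl <;> simp
      have hexp : Real.exp (-(β / (4 * (n + 1 : ℕ))) * ((e : ℝ) ^ 2 + M) ^ 2)
          = Real.exp (-(β / (4 * (n + 1))) * M ^ 2) *
            Real.exp (-(β / 2 * ((2 * M + 1) / (2 * (n + 1))) * (e : ℝ) ^ 2)) := by
        rw [← Real.exp_add]
        congr 1
        have : ((e : ℝ) ^ 2 + M) ^ 2 = (2 * M + 1) * (e : ℝ) ^ 2 + M ^ 2 := by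
          linear_combination hsq
        rw [this]
        push_cast
        field_simp
        ring
      rw [hexp]
      ring
  ext e
  unfold condProb kernel
  simp only [hev]
  rw [← Finset.mul_sum, mul_div_mul_left _ _ hA]

lemma kernel_smul (β : ℝ) (α : SignType → ℝ) (a : ℝ) (r : SignType → ℝ) {c : ℝ} (hc : c ≠ 0) :
    kernel β α a (fun e => r e / c) = kernel β α a r := by
  ext e
  unfold kernel
  simp only [← mul_div_assoc]
  rw [← Finset.sum_div, div_div_div_cancel_right₀ hc]

lemma kernel_sum_pos {β : ℝ} {α : SignType → ℝ} (hα : IsSymmetricApriori α) (a : ℝ)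
    {r : SignType → ℝ} (hr : ∀ e, 0 < r e) :
    0 < ∑ e', α e' * Real.exp (-(β / 2 * a * (e' : ℝ) ^ 2)) * r e' :=
  Finset.sum_pos (fun e _ => mul_pos (mul_pos (hα.pos e) (Real.exp_pos _)) (hr e))
    ⟨0, Finset.mem_univ _⟩

lemma continuousAt_kernel {β : ℝ} {α : SignType → ℝ} (hα : IsSymmetricApriori α) (a : ℝ)
    {r : SignType → ℝ} (hr : ∀ e, 0 < r e) :
    ContinuousAt (fun x : ℝ × (SignType → ℝ) => kernel β α x.1 x.2) (a, r) := by
  rw [continuousAt_pi]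
  intro e
  unfold kernel
  exact ContinuousAt.div (by fun_prop) (by fun_prop) (kernel_sum_pos hα a hr).ne'

lemma exists_kernel_mem {β : ℝ} {α : SignType → ℝ} (hα : IsSymmetricApriori α) (a : ℝ)
    {r : SignType → ℝ} (hr : ∀ e, 0 < r e) {W : Set (SignType → ℝ)} (hW : W ∈ 𝓝 (kernel β α a r)) :
    ∃ η > 0, ∀ a' r', |a' - a| < η → (∀ e, |r' e - r e| ≤ 2 * η) → kernel β α a' r' ∈ W := by
  obtain ⟨δ, hδ, hsub⟩ := Metric.mem_nhds_iff.1 ((continuousAt_kernel hα a hr) hW)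
  refine ⟨δ / 4, by linarith, fun a' r' ha hr' => ?_⟩
  refine @hsub (a', r') ?_
  rw [Metric.mem_ball, Prod.dist_eq, max_lt_iff]
  refine ⟨?_, ?_⟩
  · rw [Real.dist_eq]; change |a' - a| < δ; linarith
  · rw [dist_pi_lt_iff hδ]
    intro e
    rw [Real.dist_eq]
    change |r' e - r e| < δ
    linarith [hr' e]

lemma integrable_gauss_siteTilt {β : ℝ} (hβ : 0 < β) (ε : ℝ) (e : SignType) :
    MeasureTheory.Integrable fun y : ℝ =>
      Real.exp (-(1 / (4 * β)) * y ^ 2) * siteTilt ε y e := by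
  have ha : 0 < 1 / (4 * β) := by positivity
  have h1 := integrable_exp_neg_mul_sq_mul_exp ha (1 / 2)
  have h2 := integrable_exp_neg_mul_sq_mul_exp ha (-1 / 2)
  have h3 : ∀ c d : ℝ, MeasureTheory.Integrable fun y : ℝ =>
      Real.exp (-(1 / (4 * β)) * y ^ 2) *
        (c * Real.exp (1 / 2 * y) + d * Real.exp (-1 / 2 * y)) := by
    intro c d
    refine ((h1.mul_const c).add (h2.mul_const d)).congr (Eventually.of_forall fun y => ?_)
    simp only [Pi.add_apply]
    ring
  have ht : ∀ y, tilt ε y = (1 + ε) / 2 * Real.exp (1 / 2 * y)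
      + (1 - ε) / 2 * Real.exp (-1 / 2 * y) := by
    intro y
    unfold tilt
    rw [Real.cosh_eq, Real.sinh_eq, show y / 2 = 1 / 2 * y by ring,
      show -(1 / 2 * y) = -1 / 2 * y by ring]
    ring
  have ht' : ∀ y, tilt ε (-y) = (1 - ε) / 2 * Real.exp (1 / 2 * y)
      + (1 + ε) / 2 * Real.exp (-1 / 2 * y) := by
    intro y
    rw [ht, show 1 / 2 * -y = -1 / 2 * y by ring, show -1 / 2 * -y = 1 / 2 * y by ring]
    ring
  unfold siteTilt
  split_ifs
  · simpa using integrable_exp_neg_mul_sq ha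
  · simp only [ht]; exact h3 _ _
  · simp only [ht']; exact h3 _ _

/-- If the empirical measures of the conditionings converge to `ν`, and all minimisers of the rate
function at `ν` lie in a set on which `siteTilt` is close to `z`, then the conditional distributions
end up in a given neighbourhood of `kernel β α (ν 1 + ν (-1)) z`. -/
lemma eventually_condProb_mem {β : ℝ} (hβ : 0 < β) {α : SignType → ℝ} (hα : IsSymmetricApriori α)
    {t : ℝ} (ht : 0 ≤ t) {ν : SignType → ℝ} {ω : (n : ℕ) → Fin n → SignType}
    (hω : Tendsto (fun n => empirical (ω n)) atTop (𝓝 ν)) {U : Set ℝ} (hU : IsOpen U)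
    (hmin : ∀ y, RateMin (Real.exp (-2 * t)) (2 * β * ν 1) (2 * β * ν (-1)) y → y ∈ U)
    {z : SignType → ℝ} {η : ℝ} (hη : 0 < η)
    (hz : ∀ y ∈ U, ∀ e, |siteTilt (Real.exp (-2 * t)) y e - z e| ≤ η) {W : Set (SignType → ℝ)}
    (hW : ∀ a' r', |a' - (ν 1 + ν (-1))| < η → (∀ e, |r' e - z e| ≤ 2 * η) →
      kernel β α a' r' ∈ W) :
    ∀ᶠ n in atTop, condProb (evolved β α t) (ω n) ∈ W := by
  have h0 : 0 ≤ Real.exp (-2 * t) := (Real.exp_pos _).le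
  have h1 : Real.exp (-2 * t) ≤ 1 := Real.exp_le_one_iff.2 (by linarith)
  set ε := Real.exp (-2 * t) with hε
  have hω' : ∀ e, Tendsto (fun n => empirical (ω n) e) atTop (𝓝 (ν e)) :=
    fun e => (tendsto_pi_nhds.1 hω) e
  obtain ⟨v, κ, O, hκ, hO, hOne, hgap⟩ := exists_rate_gap h0 h1 (2 * β * ν 1) (2 * β * ν (-1)) hU hmin
  have hgap' := (((hω' 1).const_mul (2 * β)).prodMk_nhds ((hω' (-1)).const_mul (2 * β))).eventually
    hgap
  have hl : Tendsto (fun n : ℕ => (n : ℝ) / (2 * β)) atTop atTop :=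
    tendsto_natCast_atTop_atTop.atTop_div_const (by positivity)
  have ha : 0 < 1 / (4 * β) := by positivity
  have hlap : ∀ e, ∀ᶠ n in atTop, 0 < laplaceIntegral β ε (ω n) 0 ∧
      |laplaceIntegral β ε (ω n) e / laplaceIntegral β ε (ω n) 0 - z e| ≤ 2 * η := by
    intro e
    have := eventually_laplace (w := fun y => Real.exp (-(1 / (4 * β)) * y ^ 2))
      (h := fun y => siteTilt ε y e) (z := z e) (U := U)
      (φ := fun n => rate ε (2 * β * empirical (ω n) 1) (2 * β * empirical (ω n) (-1)))
      (l := fun n => (n : ℝ) / (2 * β)) (fun y => Real.exp_pos _) (integrable_exp_neg_mul_sq ha)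
      (integrable_gauss_siteTilt hβ ε e) (fun n => continuous_rate h0 h1 _ _)
      (fun n => ⟨_, (exists_rateMin h0 h1 (2 * β * empirical (ω n) 1)
        (2 * β * empirical (ω n) (-1))).choose_spec⟩) hl (fun n => by positivity) hO hOne hκ hη
      (fun y hy => hz y hy e) hgap'
    simpa [laplaceIntegral, siteTilt] using this
  have hdens : ∀ᶠ n : ℕ in atTop, |(2 * (n * (empirical (ω n) 1 + empirical (ω n) (-1))) + 1) /
      (2 * ((n : ℝ) + 1)) - (ν 1 + ν (-1))| < η := by
    have h2 : Tendsto (fun n : ℕ => 1 / ((n : ℝ) + 1)) atTop (𝓝 0) :=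
      tendsto_one_div_add_atTop_nhds_zero_nat
    have h3 := (hω' 1).add (hω' (-1))
    have h4 := h3.add (h2.mul ((h3.neg).add_const (1 / 2)))
    rw [zero_mul, add_zero] at h4
    have h5 : Tendsto (fun n : ℕ => (2 * (n * (empirical (ω n) 1 + empirical (ω n) (-1))) + 1) /
        (2 * ((n : ℝ) + 1))) atTop (𝓝 (ν 1 + ν (-1))) := by
      refine h4.congr fun n => ?_
      have : (n : ℝ) + 1 ≠ 0 := by positivity
      field_simp
      ring
    have := Metric.tendsto_nhds.1 h5 η hη
    simpa only [Real.dist_eq] using this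
  filter_upwards [hlap 0, hlap 1, hlap (-1), hdens] with n hn0 hn1 hn2 hnd
  rw [condProb_evolved hβ hα ht, ← hε, ← kernel_smul _ _ _ _ hn0.1.ne']
  refine hW _ _ hnd fun e => ?_
  rcases signType_cases e with rfl | rfl | rfl
  · exact hn0.2
  · exact hn1.2
  · exact hn2.2

/-- If every neighbourhood of `(ν, γ)` eventually contains the pair of empirical measure and
conditional distribution of some sequence of conditionings, then one sequence converges: choose, at
each size, a conditioning that is nearest. -/
lemma exists_tendsto_of_forall_nhds (μ : (N : ℕ) → (Fin N → SignType) → ℝ) {ν γ : SignType → ℝ}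
    (h : ∀ W ∈ 𝓝 (ν, γ), ∃ ω : (n : ℕ) → Fin n → SignType,
      ∀ᶠ n in atTop, (empirical (ω n), condProb μ (ω n)) ∈ W) :
    ∃ ω : (n : ℕ) → Fin n → SignType, Tendsto (fun n => empirical (ω n)) atTop (𝓝 ν) ∧
      Tendsto (fun n => condProb μ (ω n)) atTop (𝓝 γ) := by
  have hmin : ∀ n : ℕ, ∃ η : Fin n → SignType, ∀ η' : Fin n → SignType,
      dist (empirical η, condProb μ η) (ν, γ) ≤ dist (empirical η', condProb μ η') (ν, γ) :=
    fun n => Finite.exists_min _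
  choose ω hω using hmin
  have ht : Tendsto (fun n => (empirical (ω n), condProb μ (ω n))) atTop (𝓝 (ν, γ)) := by
    rw [Metric.tendsto_nhds]
    intro δ hδ
    obtain ⟨ω', hω'⟩ := h _ (Metric.ball_mem_nhds (ν, γ) hδ)
    filter_upwards [hω'] with n hn
    exact (hω n (ω' n)).trans_lt hn
  exact ⟨ω, (continuous_fst.tendsto _).comp ht, (continuous_snd.tendsto _).comp ht⟩

lemma sum_empirical {n : ℕ} (hn : 0 < n) (η : Fin n → SignType) :
    empirical η 0 = 1 - empirical η 1 - empirical η (-1) := by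
  have h : ∑ e : SignType, (Finset.univ.filter fun i => η i = e).card = n := by
    rw [← Finset.card_eq_sum_card_fiberwise (f := η) (s := Finset.univ) (t := Finset.univ)
      (fun i _ => Finset.mem_coe.2 (Finset.mem_univ _))]
    simp
  have h2 : ∑ e : SignType, ((Finset.univ.filter fun i => η i = e).card : ℝ) = n := by
    exact_mod_cast h
  have hn' : (n : ℝ) ≠ 0 := by exact_mod_cast hn.ne'
  rw [sum_signType] at h2
  unfold empirical
  field_simp
  linarith

lemma exists_tendsto_empirical {ν : SignType → ℝ} (hν : ν ∈ stdSimplex ℝ SignType) :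
    ∃ ω : (n : ℕ) → Fin n → SignType, Tendsto (fun n => empirical (ω n)) atTop (𝓝 ν) := by
  have hsum := hν.2
  rw [sum_signType] at hsum
  have h' : ¬ ((-1 : SignType) = 1) := by decide
  have h'' : ¬ ((0 : SignType) = 1) := by decide
  have h3 : ¬ ((0 : SignType) = -1) := by decide
  set k : ℕ → ℕ := fun n => ⌊ν 1 * n⌋₊
  set l : ℕ → ℕ := fun n => ⌊ν (-1) * n⌋₊
  have hkl : ∀ n, k n + l n ≤ n := by
    intro n
    have h1 : (k n : ℝ) ≤ ν 1 * n := Nat.floor_le (mul_nonneg (hν.1 1) (Nat.cast_nonneg n))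
    have h2 : (l n : ℝ) ≤ ν (-1) * n := Nat.floor_le (mul_nonneg (hν.1 (-1)) (Nat.cast_nonneg n))
    have h3 : (ν 1 + ν (-1)) * n ≤ 1 * n :=
      mul_le_mul_of_nonneg_right (by linarith [hν.1 0]) (Nat.cast_nonneg n)
    have : ((k n + l n : ℕ) : ℝ) ≤ n := by push_cast; linarith
    exact_mod_cast this
  set ω : (n : ℕ) → Fin n → SignType := fun n i =>
    if (i : ℕ) < k n then 1 else if (i : ℕ) < k n + l n then -1 else 0 with hω
  have hcard : ∀ n m : ℕ, m ≤ n → (Finset.univ.filter fun i : Fin n => (i : ℕ) < m).card = m := by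
    intro n m hm
    rw [Fin.card_filter_val_lt, min_eq_right hm]
  have hone : ∀ n, empirical (ω n) 1 = (k n : ℝ) / n := by
    intro n
    unfold empirical
    congr 2
    rw [← hcard n (k n) (by have := hkl n; omega)]
    congr 1
    ext i
    simp only [Finset.mem_filter, hω]
    split_ifs <;> simp_all
  have hneg : ∀ n, empirical (ω n) (-1) = (l n : ℝ) / n := by
    intro n
    unfold empirical
    congr 2
    have h1 := hcard n (k n + l n) (hkl n)
    have h2 := hcard n (k n) (by have := hkl n; omega)
    have h3 : (Finset.univ.filter fun i : Fin n => ω n i = -1)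
        = (Finset.univ.filter fun i : Fin n => (i : ℕ) < k n + l n) \
          (Finset.univ.filter fun i : Fin n => (i : ℕ) < k n) := by
      ext i
      simp only [Finset.mem_filter, Finset.mem_sdiff, hω]
      split_ifs <;> simp_all
    rw [h3, Finset.card_sdiff_of_subset, h1, h2]
    · omega
    · intro i
      simp only [Finset.mem_filter]
      exact fun h => ⟨h.1, by omega⟩
  have ht1 : Tendsto (fun n => empirical (ω n) 1) atTop (𝓝 (ν 1)) := by
    simp only [hone]
    exact (tendsto_nat_floor_mul_div_atTop (hν.1 1)).comp tendsto_natCast_atTop_atTop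
  have ht2 : Tendsto (fun n => empirical (ω n) (-1)) atTop (𝓝 (ν (-1))) := by
    simp only [hneg]
    exact (tendsto_nat_floor_mul_div_atTop (hν.1 (-1))).comp tendsto_natCast_atTop_atTop
  refine ⟨ω, tendsto_pi_nhds.2 fun e => ?_⟩
  rcases signType_cases e with rfl | rfl | rfl
  · have h5 : ν 0 = 1 - ν 1 - ν (-1) := by linarith
    rw [h5]
    refine ((ht1.const_sub 1).sub ht2).congr' ?_
    filter_upwards [eventually_gt_atTop 0] with n hn
    rw [sum_empirical hn]
  · exact ht1
  · exact ht2

/-- The rate function at the empirical measure `ν` has at least two global minimisers. -/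
def RateTwo (β ε : ℝ) (ν : SignType → ℝ) : Prop :=
  ∃ y₁ y₂, y₁ ≠ y₂ ∧ RateMin ε (2 * β * ν 1) (2 * β * ν (-1)) y₁ ∧
    RateMin ε (2 * β * ν 1) (2 * β * ν (-1)) y₂

lemma siteTilt_injective {ε y y' : ℝ} (hε : 0 < ε) (h : siteTilt ε y = siteTilt ε y') : y = y' := by
  have h1 := congrFun h 1
  have h2 := congrFun h (-1)
  have h' : ¬ ((-1 : SignType) = 1) := by decide
  simp [siteTilt, h', tilt, neg_div] at h1 h2
  have : ε * Real.sinh (y / 2) = ε * Real.sinh (y' / 2) := by linarith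
  have := Real.sinh_injective (mul_left_cancel₀ hε.ne' this)
  linarith

lemma kernel_siteTilt_injective {β : ℝ} {α : SignType → ℝ} (hα : IsSymmetricApriori α) {ε a y y' : ℝ}
    (hε : 0 < ε) (h1 : ε ≤ 1)
    (h : kernel β α a (siteTilt ε y) = kernel β α a (siteTilt ε y')) : y = y' := by
  have hS := kernel_sum_pos (β := β) hα a (r := siteTilt ε y) fun e => siteTilt_pos hε.le h1 y e
  have hS' := kernel_sum_pos (β := β) hα a (r := siteTilt ε y') fun e => siteTilt_pos hε.le h1 y' e
  have hα0 := hα.pos 0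
  have hsum : (∑ e', α e' * Real.exp (-(β / 2 * a * (e' : ℝ) ^ 2)) * siteTilt ε y e')
      = ∑ e', α e' * Real.exp (-(β / 2 * a * (e' : ℝ) ^ 2)) * siteTilt ε y' e' := by
    have h0 := congrFun h 0
    unfold kernel at h0
    rw [div_eq_div_iff hS.ne' hS'.ne'] at h0
    simp only [siteTilt, if_true] at h0 ⊢
    have hne : α 0 * Real.exp (-(β / 2 * a * ((0 : SignType) : ℝ) ^ 2)) * 1 ≠ 0 := by
      have := Real.exp_pos (-(β / 2 * a * ((0 : SignType) : ℝ) ^ 2))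
      positivity
    exact (mul_left_cancel₀ hne h0).symm
  refine siteTilt_injective hε (funext fun e => ?_)
  have he := congrFun h e
  unfold kernel at he
  rw [hsum, div_left_inj' hS'.ne'] at he
  exact mul_left_cancel₀ (mul_pos (hα.pos e) (Real.exp_pos _)).ne' he

lemma exists_nhds_siteTilt (ε y₀ : ℝ) {η : ℝ} (hη : 0 < η) :
    ∃ U : Set ℝ, IsOpen U ∧ y₀ ∈ U ∧ ∀ y ∈ U, ∀ e, |siteTilt ε y e - siteTilt ε y₀ e| ≤ η := by
  refine ⟨⋂ e, {y | |siteTilt ε y e - siteTilt ε y₀ e| < η},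
    isOpen_iInter_of_finite fun e => isOpen_lt
      (((continuous_siteTilt ε e).sub continuous_const).abs) continuous_const, ?_, ?_⟩
  · simpa using hη
  · intro y hy e
    exact (mem_iInter.1 hy e).le

/-- A unique minimiser determines the limiting conditional distribution. -/
lemma tendsto_condProb {β : ℝ} (hβ : 0 < β) {α : SignType → ℝ} (hα : IsSymmetricApriori α)
    {t : ℝ} (ht : 0 ≤ t) {ν : SignType → ℝ} {ω : (n : ℕ) → Fin n → SignType}
    (hω : Tendsto (fun n => empirical (ω n)) atTop (𝓝 ν)) {y₀ : ℝ}
    (hmin : ∀ y, RateMin (Real.exp (-2 * t)) (2 * β * ν 1) (2 * β * ν (-1)) y → y = y₀) :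
    Tendsto (fun n => condProb (evolved β α t) (ω n)) atTop
      (𝓝 (kernel β α (ν 1 + ν (-1)) (siteTilt (Real.exp (-2 * t)) y₀))) := by
  have h0 : 0 ≤ Real.exp (-2 * t) := (Real.exp_pos _).le
  have h1 : Real.exp (-2 * t) ≤ 1 := Real.exp_le_one_iff.2 (by linarith)
  intro W hW
  obtain ⟨η, hη, hWη⟩ := exists_kernel_mem hα _ (fun e => siteTilt_pos h0 h1 y₀ e) hW
  obtain ⟨U, hU, hy₀, hUη⟩ := exists_nhds_siteTilt (Real.exp (-2 * t)) y₀ hη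
  exact eventually_condProb_mem hβ hα ht hω hU (fun y hy => (hmin y hy).symm ▸ hy₀) hη hUη hWη

/-- The measure `ν` with mass `s` moved from the spin `-1` to the spin `1`. -/
def shift (ν : SignType → ℝ) (s : ℝ) (e : SignType) : ℝ := ν e + s * (e : ℝ)

lemma shift_mem {ν : SignType → ℝ} (hν : ν ∈ stdSimplex ℝ SignType) {s : ℝ}
    (h1 : -ν 1 ≤ s) (h2 : s ≤ ν (-1)) : shift ν s ∈ stdSimplex ℝ SignType := by
  have hs := hν.2
  refine ⟨fun e => ?_, ?_⟩
  · rcases signType_cases e with rfl | rfl | rfl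
    · simpa [shift] using hν.1 0
    · simp [shift]; linarith
    · simp [shift]; linarith
  · rw [sum_signType] at hs ⊢
    simp [shift]
    linarith

/-- The conditional distribution belonging to `y₀` is a limit of conditional distributions along
`ν` as soon as the minimisers at small shifts of `ν` accumulate at `y₀` only. -/
lemma exists_tendsto_of_shift {β : ℝ} (hβ : 0 < β) {α : SignType → ℝ} (hα : IsSymmetricApriori α)
    {t : ℝ} (ht : 0 ≤ t) {ν : SignType → ℝ} {y₀ : ℝ}
    {f : Filter ℝ} [f.NeBot] (hf : f ≤ 𝓝 0) (hfs : ∀ᶠ s in f, shift ν s ∈ stdSimplex ℝ SignType)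
    (hmin : ∀ U, IsOpen U → y₀ ∈ U → ∀ᶠ s in f, ∀ y, RateMin (Real.exp (-2 * t))
      (2 * β * shift ν s 1) (2 * β * shift ν s (-1)) y → y ∈ U) :
    ∃ ω : (n : ℕ) → Fin n → SignType, Tendsto (fun n => empirical (ω n)) atTop (𝓝 ν) ∧
      Tendsto (fun n => condProb (evolved β α t) (ω n)) atTop
        (𝓝 (kernel β α (ν 1 + ν (-1)) (siteTilt (Real.exp (-2 * t)) y₀))) := by
  have h0 : 0 ≤ Real.exp (-2 * t) := (Real.exp_pos _).le
  have h1 : Real.exp (-2 * t) ≤ 1 := Real.exp_le_one_iff.2 (by linarith)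
  apply exists_tendsto_of_forall_nhds
  intro W hW
  rw [nhds_prod_eq, mem_prod_iff] at hW
  obtain ⟨W₁, hW₁, W₂, hW₂, hsub⟩ := hW
  obtain ⟨η, hη, hWη⟩ := exists_kernel_mem hα _ (fun e => siteTilt_pos h0 h1 y₀ e) hW₂
  obtain ⟨U, hU, hy₀, hUη⟩ := exists_nhds_siteTilt (Real.exp (-2 * t)) y₀ hη
  have hcont : Tendsto (shift ν) f (𝓝 ν) := by
    have h2 : Continuous (shift ν) := by unfold shift; fun_prop
    have h3 : shift ν 0 = ν := by ext e; simp [shift]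
    have h4 := h2.tendsto 0
    rw [h3] at h4
    exact h4.mono_left hf
  obtain ⟨s, ⟨hs1, hs2⟩, hs3⟩ := ((hfs.and (hmin U hU hy₀)).and
    (hcont (interior_mem_nhds.2 hW₁))).exists
  obtain ⟨ω, hω⟩ := exists_tendsto_empirical hs1
  refine ⟨ω, ?_⟩
  have ha : shift ν s 1 + shift ν s (-1) = ν 1 + ν (-1) := by
    simp [shift]; ring
  have hev1 := hω.eventually (isOpen_interior.mem_nhds hs3)
  have hev2 := eventually_condProb_mem hβ hα ht hω hU hs2 hη hUη (W := W₂) (by rwa [ha])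
  filter_upwards [hev1, hev2] with n hn1 hn2
  exact hsub ⟨interior_subset hn1, hn2⟩

lemma eventually_rateMin_mem {ε : ℝ} (h0 : 0 ≤ ε) (h1 : ε ≤ 1) (p q : ℝ) {U : Set ℝ}
    (hU : IsOpen U) (hmin : ∀ y, RateMin ε p q y → y ∈ U) :
    ∀ᶠ x : ℝ × ℝ in 𝓝 (p, q), ∀ y, RateMin ε x.1 x.2 y → y ∈ U := by
  obtain ⟨v, κ, O, hκ, -, ⟨z, hz⟩, hgap⟩ := exists_rate_gap h0 h1 p q hU hmin
  filter_upwards [hgap] with x hx y hy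
  by_contra hyU
  linarith [hx.1 y hyU, hx.2 z hz, hy z]

/-- Two minimisers at `ν` give two limits of conditional distributions: shifting a little mass from
`-1` to `1` selects the largest minimiser, shifting it back selects the smallest one. -/
lemma RateTwo.mem_badSet {β : ℝ} (hβ : 0 < β) {α : SignType → ℝ} (hα : IsSymmetricApriori α)
    {t : ℝ} (ht : 0 ≤ t) {ν : SignType → ℝ} (hν : ν ∈ stdSimplex ℝ SignType)
    (hpos : 0 < ν 1) (hneg : 0 < ν (-1)) (h : RateTwo β (Real.exp (-2 * t)) ν) :
    ν ∈ badSet (evolved β α t) := by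
  have h0 : 0 < Real.exp (-2 * t) := Real.exp_pos _
  have h1 : Real.exp (-2 * t) ≤ 1 := Real.exp_le_one_iff.2 (by linarith)
  set ε := Real.exp (-2 * t) with hε
  obtain ⟨y₁, y₂, hne, hy₁, hy₂⟩ := h
  set S := {y | RateMin ε (2 * β * ν 1) (2 * β * ν (-1)) y} with hS
  have hScomp : IsCompact S := isCompact_rateMin h0.le h1 _ _
  obtain ⟨a, ha, haS⟩ := hScomp.exists_isLeast ⟨y₁, hy₁⟩
  obtain ⟨b, hb, hbS⟩ := hScomp.exists_isGreatest ⟨y₁, hy₁⟩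
  have hab : a ≠ b := by
    intro hab
    have e1 : y₁ = a := le_antisymm (hab ▸ hbS hy₁) (haS hy₁)
    have e2 : y₂ = a := le_antisymm (hab ▸ hbS hy₂) (haS hy₂)
    exact hne (e1.trans e2.symm)
  have hcont : Tendsto (fun s => (2 * β * shift ν s 1, 2 * β * shift ν s (-1))) (𝓝 0)
      (𝓝 (2 * β * ν 1, 2 * β * ν (-1))) := by
    have h2 : Continuous fun s => (2 * β * shift ν s 1, 2 * β * shift ν s (-1)) := by
      unfold shift; fun_prop
    have h3 := h2.tendsto 0
    simpa [shift] using h3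
  have hsimp : ∀ᶠ s in 𝓝 (0 : ℝ), shift ν s ∈ stdSimplex ℝ SignType := by
    have h2 : Ioo (-ν 1) (ν (-1)) ∈ 𝓝 (0 : ℝ) := Ioo_mem_nhds (by linarith) hneg
    filter_upwards [h2] with s hs
    exact shift_mem hν hs.1.le hs.2.le
  have hsh1 : ∀ s, 2 * β * shift ν s 1 = 2 * β * ν 1 + 2 * β * s := by
    intro s; simp [shift]; ring
  have hsh2 : ∀ s, 2 * β * shift ν s (-1) = 2 * β * ν (-1) - 2 * β * s := by
    intro s; simp [shift]; ring
  obtain ⟨ω, hω, hγ⟩ := exists_tendsto_of_shift hβ hα ht (ν := ν) (y₀ := b) (f := 𝓝[>] 0)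
    nhdsWithin_le_nhds (hsimp.filter_mono nhdsWithin_le_nhds) (by
      intro U hU hbU
      have hev := hcont.eventually (eventually_rateMin_mem h0.le h1 _ _ (hU.union isOpen_Iio)
        (U := U ∪ Iio b) fun y hy => by
          rcases (hbS hy).eq_or_lt with h | h
          · exact Or.inl (h ▸ hbU)
          · exact Or.inr h)
      filter_upwards [hev.filter_mono nhdsWithin_le_nhds, self_mem_nhdsWithin] with s hs hs0 y hy
      refine (hs y hy).resolve_right fun hlt => absurd (mem_Iio.1 hlt) (not_lt.2 ?_)
      rw [hsh1, hsh2] at hy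
      exact RateMin.le_of_shift h0 h1 (mul_pos (by linarith) hs0) hb hy)
  obtain ⟨ω', hω', hγ'⟩ := exists_tendsto_of_shift hβ hα ht (ν := ν) (y₀ := a) (f := 𝓝[<] 0)
    nhdsWithin_le_nhds (hsimp.filter_mono nhdsWithin_le_nhds) (by
      intro U hU haU
      have hev := hcont.eventually (eventually_rateMin_mem h0.le h1 _ _ (hU.union isOpen_Ioi)
        (U := U ∪ Ioi a) fun y hy => by
          rcases (haS hy).eq_or_lt with h | h
          · exact Or.inl (h ▸ haU)
          · exact Or.inr h)
      filter_upwards [hev.filter_mono nhdsWithin_le_nhds, self_mem_nhdsWithin] with s hs hs0 y hy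
      refine (hs y hy).resolve_right fun hlt => absurd (mem_Ioi.1 hlt) (not_lt.2 ?_)
      rw [hsh1, hsh2] at hy
      refine RateMin.le_of_shift h0 h1 (τ := 2 * β * (-s))
        (mul_pos (by linarith) (neg_pos.2 hs0)) hy ?_
      have e1 : 2 * β * ν 1 + 2 * β * s + 2 * β * -s = 2 * β * ν 1 := by ring
      have e2 : 2 * β * ν (-1) - 2 * β * s - 2 * β * -s = 2 * β * ν (-1) := by ring
      rw [e1, e2]
      exact ha)
  exact ⟨hν, ω, ω', _, _, hω, hω', hγ, hγ', fun he =>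
    hab (kernel_siteTilt_injective hα h0 h1 he).symm⟩

lemma exists_unique_rateMin {β ε : ℝ} (h0 : 0 ≤ ε) (h1 : ε ≤ 1) {ν : SignType → ℝ}
    (h : ¬ RateTwo β ε ν) :
    ∃ y₀, ∀ y, RateMin ε (2 * β * ν 1) (2 * β * ν (-1)) y → y = y₀ := by
  obtain ⟨y₀, hy₀⟩ := exists_rateMin h0 h1 (2 * β * ν 1) (2 * β * ν (-1))
  refine ⟨y₀, fun y hy => ?_⟩
  by_contra hne
  exact h ⟨y, y₀, hne, hy, hy₀⟩

/-- The bad empirical measures are those at which the rate function has several minimisers. -/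
theorem badSet_evolved {β : ℝ} (hβ : 0 < β) {α : SignType → ℝ} (hα : IsSymmetricApriori α)
    {t : ℝ} (ht : 0 ≤ t) (hpos : ∀ ν ∈ stdSimplex ℝ SignType, RateTwo β (Real.exp (-2 * t)) ν →
      0 < ν 1 ∧ 0 < ν (-1)) :
    badSet (evolved β α t) = {ν | ν ∈ stdSimplex ℝ SignType ∧ RateTwo β (Real.exp (-2 * t)) ν} := by
  ext ν
  constructor
  · rintro ⟨hν, ω, ω', γ, γ', hω, hω', hγ, hγ', hne⟩
    refine ⟨hν, ?_⟩
    by_contra htwo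
    obtain ⟨y₀, hy₀⟩ := exists_unique_rateMin (Real.exp_pos _).le
      (Real.exp_le_one_iff.2 (by linarith)) htwo
    exact hne ((tendsto_nhds_unique hγ (tendsto_condProb hβ hα ht hω hy₀)).trans
      (tendsto_nhds_unique hγ' (tendsto_condProb hβ hα ht hω' hy₀)).symm)
  · rintro ⟨hν, htwo⟩
    exact htwo.mem_badSet hβ hα ht hν (hpos ν hν htwo).1 (hpos ν hν htwo).2

theorem seqGibbs_evolved_iff {β : ℝ} (hβ : 0 < β) {α : SignType → ℝ} (hα : IsSymmetricApriori α)
    {t : ℝ} (ht : 0 ≤ t) (hpos : ∀ ν ∈ stdSimplex ℝ SignType, RateTwo β (Real.exp (-2 * t)) ν →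
      0 < ν 1 ∧ 0 < ν (-1)) :
    SeqGibbs (evolved β α t) ↔
      ∀ ν ∈ stdSimplex ℝ SignType, ¬ RateTwo β (Real.exp (-2 * t)) ν := by
  constructor
  · intro h ν hν htwo
    obtain ⟨γ₀, hγ₀⟩ := h ν hν
    obtain ⟨-, ω, ω', γ, γ', hω, hω', hγ, hγ', hne⟩ :=
      htwo.mem_badSet hβ hα ht hν (hpos ν hν htwo).1 (hpos ν hν htwo).2
    exact hne ((tendsto_nhds_unique hγ (hγ₀ ω hω)).trans
      (tendsto_nhds_unique hγ' (hγ₀ ω' hω')).symm)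
  · intro h ν hν
    obtain ⟨y₀, hy₀⟩ := exists_unique_rateMin (Real.exp_pos _).le
      (Real.exp_le_one_iff.2 (by linarith)) (h ν hν)
    exact ⟨_, fun ω hω => tendsto_condProb hβ hα ht hω hy₀⟩

/-! ### From the rate function to the potential -/

/-- The hyperbolic cotangent of `2 t`. -/
noncomputable def timeK (t : ℝ) : ℝ := (1 + Real.exp (-2 * t) ^ 2) / (1 - Real.exp (-2 * t) ^ 2)

/-- The hyperbolic cosecant of `2 t`. -/
noncomputable def timeS (t : ℝ) : ℝ := 2 * Real.exp (-2 * t) / (1 - Real.exp (-2 * t) ^ 2)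

lemma one_sub_exp_sq_pos {t : ℝ} (ht : 0 < t) : 0 < 1 - Real.exp (-2 * t) ^ 2 := by
  have h1 : Real.exp (-2 * t) < 1 := Real.exp_lt_one_iff.2 (by linarith)
  have h0 := Real.exp_pos (-2 * t)
  nlinarith

lemma timeK_pos {t : ℝ} (ht : 0 < t) : 0 < timeK t := by
  have := one_sub_exp_sq_pos ht
  unfold timeK; positivity

lemma timeS_pos {t : ℝ} (ht : 0 < t) : 0 < timeS t := by
  have := one_sub_exp_sq_pos ht
  unfold timeS; positivity

lemma timeK_sq_sub {t : ℝ} (ht : 0 < t) : timeK t ^ 2 - timeS t ^ 2 = 1 := by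
  have := one_sub_exp_sq_pos ht
  unfold timeK timeS
  generalize Real.exp (-2 * t) = ε at *
  field_simp
  ring

lemma timeK_add_one {t : ℝ} (ht : 0 < t) : timeK t + 1 = 2 / (1 - Real.exp (-4 * t)) := by
  have h := one_sub_exp_sq_pos ht
  have h2 : Real.exp (-4 * t) = Real.exp (-2 * t) ^ 2 := by
    rw [← Real.exp_nat_mul]; congr 1; push_cast; ring
  rw [h2]
  unfold timeK
  generalize Real.exp (-2 * t) = ε at *
  field_simp
  ring

lemma one_sub_exp_pos {t : ℝ} (ht : 0 < t) : 0 < 1 - Real.exp (-4 * t) := by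
  have h1 : Real.exp (-4 * t) < 1 := Real.exp_lt_one_iff.2 (by linarith)
  linarith

lemma timeK_lt_iff {t t' : ℝ} (ht : 0 < t) (ht' : 0 < t') : timeK t < timeK t' ↔ t' < t := by
  rw [← add_lt_add_iff_right (1 : ℝ), timeK_add_one ht, timeK_add_one ht',
    div_lt_div_iff_of_pos_left two_pos (one_sub_exp_pos ht) (one_sub_exp_pos ht'),
    sub_lt_sub_iff_left, Real.exp_lt_exp]
  constructor <;> intro h <;> linarith

lemma timeK_le_iff {t t' : ℝ} (ht : 0 < t) (ht' : 0 < t') : timeK t ≤ timeK t' ↔ t' ≤ t := by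
  rw [← not_lt, timeK_lt_iff ht' ht, not_lt]

lemma timeK_add_one_lt_iff {t β : ℝ} (ht : 0 < t) (hβ : 2 < β) :
    timeK t + 1 < β ↔ -(1 / 4) * Real.log (1 - 2 / β) < t := by
  have h1 : 0 < 1 - 2 / β := by
    have : 2 / β < 1 := by rw [div_lt_one (by linarith)]; exact hβ
    linarith
  have h2 := one_sub_exp_pos ht
  have h3 : timeK t + 1 < β ↔ Real.exp (-4 * t) < 1 - 2 / β := by
    rw [timeK_add_one ht, div_lt_comm₀ h2 (by linarith)]
    constructor <;> intro h <;> linarith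
  rw [h3, ← Real.lt_log_iff_exp_lt h1]
  constructor <;> intro h <;> linarith

lemma one_lt_timeK {t : ℝ} (ht : 0 < t) : 1 < timeK t := by
  have h := one_sub_exp_sq_pos ht
  unfold timeK
  rw [one_lt_div h]
  have := Real.exp_pos (-2 * t)
  nlinarith

lemma exists_timeK_eq {K : ℝ} (hK : 1 < K) : ∃ t, 0 < t ∧ timeK t = K := by
  have h1 : 1 < (K + 1) / (K - 1) := by rw [one_lt_div (by linarith)]; linarith
  have ht : 0 < 1 / 4 * Real.log ((K + 1) / (K - 1)) := by
    have := Real.log_pos h1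
    positivity
  refine ⟨_, ht, ?_⟩
  have h2 := timeK_add_one ht
  have h3 : Real.exp (-4 * (1 / 4 * Real.log ((K + 1) / (K - 1)))) = (K - 1) / (K + 1) := by
    rw [show -4 * (1 / 4 * Real.log ((K + 1) / (K - 1))) = -Real.log ((K + 1) / (K - 1)) by ring,
      Real.exp_neg, Real.exp_log (by linarith), inv_div]
  rw [h3] at h2
  have h4 : 2 / (1 - (K - 1) / (K + 1)) = K + 1 := by
    have : K + 1 ≠ 0 := by linarith
    rw [one_sub_div this, show K + 1 - (K - 1) = 2 by ring, div_div_eq_mul_div]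
    ring
  linarith

lemma log_three_pos : 0 < Real.log 3 / 4 := by
  have := Real.log_pos (by norm_num : (1 : ℝ) < 3)
  positivity

lemma timeK_log_three : timeK (Real.log 3 / 4) = 2 := by
  have h2 := timeK_add_one log_three_pos
  have h3 : Real.exp (-4 * (Real.log 3 / 4)) = 1 / 3 := by
    rw [show -4 * (Real.log 3 / 4) = -Real.log 3 by ring, Real.exp_neg, Real.exp_log (by norm_num)]
    norm_num
  rw [h3] at h2
  norm_num at h2
  linarith

lemma continuousAt_timeK {t : ℝ} (ht : 0 < t) : ContinuousAt timeK t := by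
  unfold timeK
  exact ContinuousAt.div (by fun_prop) (by fun_prop) (one_sub_exp_sq_pos ht).ne'

lemma continuousAt_timeS {t : ℝ} (ht : 0 < t) : ContinuousAt timeS t := by
  unfold timeS
  exact ContinuousAt.div (by fun_prop) (by fun_prop) (one_sub_exp_sq_pos ht).ne'

lemma hasDerivAt_tilt (ε y : ℝ) :
    HasDerivAt (tilt ε) (Real.sinh (y / 2) / 2 + ε * (Real.cosh (y / 2) / 2)) y := by
  have h : HasDerivAt (fun y : ℝ => y / 2) (1 / 2) y := (hasDerivAt_id y).div_const 2
  have h2 : HasDerivAt (tilt ε)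
      (Real.sinh (y / 2) * (1 / 2) + ε * (Real.cosh (y / 2) * (1 / 2))) y :=
    h.cosh.add (h.sinh.const_mul ε)
  convert h2 using 1
  ring

lemma tilt_mul_tilt_neg (ε y : ℝ) :
    2 * (tilt ε y * tilt ε (-y)) = (1 + ε ^ 2) + (1 - ε ^ 2) * Real.cosh y := by
  have h1 : Real.cosh y = Real.cosh (y / 2) ^ 2 + Real.sinh (y / 2) ^ 2 := by
    rw [← Real.cosh_two_mul]; congr 1; ring
  have h2 := Real.cosh_sq (y / 2)
  unfold tilt
  rw [neg_div, Real.cosh_neg, Real.sinh_neg, h1]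
  linear_combination (1 + ε ^ 2) * h2

lemma logTilt_sub {t : ℝ} (ht : 0 < t) (y : ℝ) :
    logTilt (Real.exp (-2 * t)) y - logTilt (Real.exp (-2 * t)) (-y)
      = timeS t * area (timeK t) y := by
  have h0 : 0 ≤ Real.exp (-2 * t) := (Real.exp_pos _).le
  have h1 : Real.exp (-2 * t) ≤ 1 := Real.exp_le_one_iff.2 (by linarith)
  have hs := one_sub_exp_sq_pos ht
  have hK := timeK_pos ht
  have hKdef : timeK t * (1 - Real.exp (-2 * t) ^ 2) = 1 + Real.exp (-2 * t) ^ 2 := by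
    unfold timeK; exact div_mul_cancel₀ _ hs.ne'
  have hSdef : timeS t * (1 - Real.exp (-2 * t) ^ 2) = 2 * Real.exp (-2 * t) := by
    unfold timeS; exact div_mul_cancel₀ _ hs.ne'
  set ε := Real.exp (-2 * t) with hε
  set f : ℝ → ℝ := fun y => logTilt ε y - logTilt ε (-y) - timeS t * area (timeK t) y with hf
  have hder : ∀ y, HasDerivAt f 0 y := by
    intro y
    have hp := tilt_pos h0 h1 y
    have hn := tilt_pos h0 h1 (-y)
    have d1 : HasDerivAt (logTilt ε) _ y := (hasDerivAt_tilt ε y).log hp.ne'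
    have d2 : HasDerivAt (fun y => logTilt ε (-y)) _ y :=
      ((((hasDerivAt_tilt ε (-y)).comp y (hasDerivAt_neg y))).log hn.ne')
    have d3 := (hasDerivAt_area hK y).const_mul (timeS t)
    have d : HasDerivAt f _ y := (d1.sub d2).sub d3
    convert d using 1
    have hc := add_cosh_pos hK y
    have hprod := tilt_mul_tilt_neg ε y
    have hprod' : 2 * (tilt ε y * tilt ε (-y))
        = (1 - ε ^ 2) * (timeK t + Real.cosh y) := by rw [hprod]; linear_combination -hKdef
    have hnum : (Real.sinh (y / 2) / 2 + ε * (Real.cosh (y / 2) / 2)) * tilt ε (-y) -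
        (Real.sinh (-y / 2) / 2 + ε * (Real.cosh (-y / 2) / 2)) * -1 * tilt ε y = ε := by
      have h2 := Real.cosh_sq (y / 2)
      unfold tilt
      rw [neg_div, Real.cosh_neg, Real.sinh_neg]
      linear_combination ε * h2
    have e1 : (Real.sinh (y / 2) / 2 + ε * (Real.cosh (y / 2) / 2)) / tilt ε y -
        (Real.sinh (-y / 2) / 2 + ε * (Real.cosh (-y / 2) / 2)) * -1 / tilt ε (-y)
        = ε / (tilt ε y * tilt ε (-y)) := by
      rw [div_sub_div _ _ hp.ne' hn.ne']
      congr 1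
      linear_combination hnum
    have e2 : ε / (tilt ε y * tilt ε (-y)) = timeS t * (timeK t + Real.cosh y)⁻¹ := by
      rw [← div_eq_mul_inv, div_eq_div_iff (mul_pos hp hn).ne' hc.ne']
      have : 2 * (ε * (timeK t + Real.cosh y)) * (1 - ε ^ 2)
          = 2 * (timeS t * (tilt ε y * tilt ε (-y))) * (1 - ε ^ 2) := by
        linear_combination (-(timeS t) * (1 - ε ^ 2)) * hprod' -
          ((1 - ε ^ 2) * (timeK t + Real.cosh y)) * hSdef
      have := mul_right_cancel₀ hs.ne' this
      linarith
    change (0 : ℝ) = (Real.sinh (y / 2) / 2 + ε * (Real.cosh (y / 2) / 2)) / tilt ε y -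
        (Real.sinh (-y / 2) / 2 + ε * (Real.cosh (-y / 2) / 2)) * -1 / tilt ε (-y) -
        timeS t * (timeK t + Real.cosh y)⁻¹
    rw [e1, e2, sub_self]
  have hconst := is_const_of_deriv_eq_zero (fun y => (hder y).differentiableAt)
    (fun y => (hder y).deriv) y 0
  simp only [hf, neg_zero, sub_self, area_zero, mul_zero] at hconst
  linarith

lemma logTilt_add {t : ℝ} (ht : 0 < t) (y : ℝ) :
    logTilt (Real.exp (-2 * t)) y + logTilt (Real.exp (-2 * t)) (-y)
      = Real.log (timeK t + Real.cosh y) + Real.log ((1 - Real.exp (-2 * t) ^ 2) / 2) := by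
  have h0 : 0 ≤ Real.exp (-2 * t) := (Real.exp_pos _).le
  have h1 : Real.exp (-2 * t) ≤ 1 := Real.exp_le_one_iff.2 (by linarith)
  have hs := one_sub_exp_sq_pos ht
  unfold logTilt
  rw [← Real.log_mul (tilt_pos h0 h1 y).ne' (tilt_pos h0 h1 (-y)).ne',
    ← Real.log_mul (add_cosh_pos (timeK_pos ht) y).ne' (by positivity)]
  congr 1
  have := tilt_mul_tilt_neg (Real.exp (-2 * t)) y
  unfold timeK
  generalize Real.exp (-2 * t) = ε at *
  field_simp
  linarith

lemma rate_eq {t : ℝ} (ht : 0 < t) (p q y : ℝ) :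
    rate (Real.exp (-2 * t)) p q y = pot (timeK t) ((p + q) / 2) (timeS t * ((p - q) / 2)) y
      - (p + q) / 2 * Real.log ((1 - Real.exp (-2 * t) ^ 2) / 2) := by
  unfold rate pot
  linear_combination (-(p + q) / 2) * logTilt_add ht y - (p - q) / 2 * logTilt_sub ht y

/-- For positive times, several minimisers of the rate function are the same as several minimisers
of the potential. -/
lemma rateTwo_iff {t : ℝ} (ht : 0 < t) (β : ℝ) (ν : SignType → ℝ) :
    RateTwo β (Real.exp (-2 * t)) ν ↔
      TwoMin (timeK t) (β * (ν 1 + ν (-1))) (timeS t * (β * (ν 1 - ν (-1)))) := by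
  unfold RateTwo TwoMin RateMin
  simp only [rate_eq ht, sub_le_sub_iff_right]
  rw [show (2 * β * ν 1 + 2 * β * ν (-1)) / 2 = β * (ν 1 + ν (-1)) by ring,
    show (2 * β * ν 1 - 2 * β * ν (-1)) / 2 = β * (ν 1 - ν (-1)) by ring]

/-- At time zero the rate function is a parabola. -/
lemma not_rateTwo_zero (β : ℝ) (ν : SignType → ℝ) : ¬ RateTwo β (Real.exp (-2 * 0)) ν := by
  rintro ⟨y₁, y₂, hne, h1, h2⟩
  have hlog : ∀ y, logTilt (Real.exp (-2 * 0)) y = y / 2 := by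
    intro y
    unfold logTilt tilt
    rw [mul_zero, Real.exp_zero, one_mul, Real.cosh_add_sinh, Real.log_exp]
  have h3 := h1 ((y₁ + y₂) / 2)
  have h4 := h2 ((y₁ + y₂) / 2)
  unfold rate at h3 h4
  simp only [hlog] at h3 h4
  have h5 : 0 < (y₁ - y₂) ^ 2 := by
    have := sub_ne_zero.2 hne
    positivity
  nlinarith

lemma TwoMin.lt_mul {K S b D : ℝ} (hK : 0 < K) (hS : 0 < S) (hKS : K ^ 2 - S ^ 2 = 1) (hD : 0 < D)
    (h : TwoMin K b D) : D < b * S := by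
  obtain ⟨y, hy, rfl, hd⟩ := h.exists_stationary hK hD
  exact slope_lt_of_slopeDeriv_nonpos hK hS hKS hy hd

lemma pos_of_rateTwo {β : ℝ} (hβ : 0 < β) {t : ℝ} (ht : 0 ≤ t) :
    ∀ ν ∈ stdSimplex ℝ SignType, RateTwo β (Real.exp (-2 * t)) ν → 0 < ν 1 ∧ 0 < ν (-1) := by
  intro ν hν h
  rcases ht.eq_or_lt with rfl | ht
  · exact absurd h (not_rateTwo_zero β ν)
  rw [rateTwo_iff ht] at h
  have hK := timeK_pos ht
  have hS := timeS_pos ht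
  have hν1 := hν.1 1
  have hν2 := hν.1 (-1)
  have hb : 0 ≤ β * (ν 1 + ν (-1)) := by positivity
  have key : ∀ u v : ℝ, u < v → TwoMin (timeK t) (β * (v + u)) (timeS t * (β * (v - u))) →
      0 < u := by
    intro u v huv h
    have hpos : 0 < timeS t * (β * (v - u)) := mul_pos hS (mul_pos hβ (by linarith))
    have h1 := h.lt_mul hK hS (timeK_sq_sub ht) hpos
    have h2 : (β * (v - u)) * timeS t < (β * (v + u)) * timeS t := by linarith
    have h3 := lt_of_mul_lt_mul_right h2 hS.le
    have h4 := lt_of_mul_lt_mul_left h3 hβ.le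
    linarith
  rcases lt_trichotomy (ν 1) (ν (-1)) with hlt | heq | hlt
  · have h2 : timeS t * (β * (ν 1 - ν (-1))) = -(timeS t * (β * (ν (-1) - ν 1))) := by ring
    rw [h2, twoMin_neg, add_comm (ν 1)] at h
    have := key _ _ hlt h
    exact ⟨this, this.trans hlt⟩
  · rw [heq, sub_self, mul_zero, mul_zero, ← heq] at h
    rw [← heq] at hb
    rw [twoMin_zero_iff hK hb] at h
    have := pos_of_mul_pos_right (h.pos hK) hβ.le
    rw [← heq]
    constructor <;> linarith
  · have := key _ _ hlt h
    exact ⟨this.trans hlt, this⟩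

/-- The measures at which the potential belonging to time `t` has several minimisers. -/
def badAt (β t : ℝ) : Set (SignType → ℝ) :=
  {ν | ν ∈ stdSimplex ℝ SignType ∧
    TwoMin (timeK t) (β * (ν 1 + ν (-1))) (timeS t * (β * (ν 1 - ν (-1))))}

lemma badSet_eq_badAt {β : ℝ} (hβ : 0 < β) {α : SignType → ℝ} (hα : IsSymmetricApriori α) {t : ℝ}
    (ht : 0 < t) : badSet (evolved β α t) = badAt β t := by
  rw [badSet_evolved hβ hα ht.le (pos_of_rateTwo hβ ht.le)]
  simp only [rateTwo_iff ht]
  rfl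

lemma seqGibbs_iff_badAt {β : ℝ} (hβ : 0 < β) {α : SignType → ℝ} (hα : IsSymmetricApriori α)
    {t : ℝ} (ht : 0 < t) : SeqGibbs (evolved β α t) ↔ badAt β t = ∅ := by
  rw [seqGibbs_evolved_iff hβ hα ht.le (pos_of_rateTwo hβ ht.le), eq_empty_iff_forall_notMem]
  simp only [rateTwo_iff ht]
  exact ⟨fun h ν hν => h ν hν.1 hν.2, fun h ν hν h2 => h ν ⟨hν, h2⟩⟩

lemma seqGibbs_zero {β : ℝ} (hβ : 0 < β) {α : SignType → ℝ} (hα : IsSymmetricApriori α) :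
    SeqGibbs (evolved β α 0) := by
  rw [seqGibbs_evolved_iff hβ hα le_rfl (pos_of_rateTwo hβ le_rfl)]
  exact fun ν _ => not_rateTwo_zero β ν

/-- The measure with the parameters `b` and `D` of the potential. -/
noncomputable def point (β S b D : ℝ) (e : SignType) : ℝ :=
  if e = 0 then 1 - b / β else (b + D / S * (e : ℝ)) / (2 * β)

lemma point_zero (β S b D : ℝ) : point β S b D 0 = 1 - b / β := by simp [point]

lemma point_one (β S b D : ℝ) : point β S b D 1 = (b + D / S) / (2 * β) := by simp [point]

lemma point_neg_one (β S b D : ℝ) : point β S b D (-1) = (b - D / S) / (2 * β) := by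
  simp [point]; ring

lemma mirror_point (β S b D : ℝ) : mirror (point β S b D) = point β S b (-D) := by
  ext e
  rcases signType_cases e with rfl | rfl | rfl
  · simp [mirror, point]
  · simp [mirror, point]; ring
  · simp [mirror, point]; ring

lemma mirror_mirror (ν : SignType → ℝ) : mirror (mirror ν) = ν := by
  ext e; simp [mirror]

lemma point_mem {β S b D : ℝ} (hβ : 0 < β) (hS : 0 < S) (hb : b ≤ β) (h1 : D ≤ b * S)
    (h2 : -D ≤ b * S) : point β S b D ∈ stdSimplex ℝ SignType := by
  have e1 : D / S ≤ b := by rwa [div_le_iff₀ hS]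
  have e2 : -b ≤ D / S := by rw [le_div_iff₀ hS]; linarith
  have e3 : b / β ≤ 1 := by rwa [div_le_one hβ]
  refine ⟨fun e => ?_, ?_⟩
  · rcases signType_cases e with rfl | rfl | rfl
    · rw [point_zero]; linarith
    · rw [point_one]; exact div_nonneg (by linarith) (by linarith)
    · rw [point_neg_one]; exact div_nonneg (by linarith) (by linarith)
  · rw [sum_signType, point_zero, point_one, point_neg_one]
    field_simp
    ring

lemma eq_point {β S : ℝ} (hβ : 0 < β) (hS : 0 < S) {ν : SignType → ℝ}
    (hν : ν ∈ stdSimplex ℝ SignType) :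
    ν = point β S (β * (ν 1 + ν (-1))) (S * (β * (ν 1 - ν (-1)))) := by
  have hs := hν.2
  rw [sum_signType] at hs
  ext e
  rcases signType_cases e with rfl | rfl | rfl
  · rw [point_zero]; field_simp; linarith
  · rw [point_one]; field_simp; ring
  · rw [point_neg_one]; field_simp; ring

lemma point_sum {β : ℝ} (hβ : 0 < β) (S b D : ℝ) :
    β * (point β S b D 1 + point β S b D (-1)) = b := by
  rw [point_one, point_neg_one]; field_simp; ring

lemma point_sub {β S : ℝ} (hβ : 0 < β) (hS : 0 < S) (b D : ℝ) :
    S * (β * (point β S b D 1 - point β S b D (-1))) = D := by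
  rw [point_one, point_neg_one]; field_simp; ring

lemma point_mem_badAt {β t : ℝ} (hβ : 0 < β) (ht : 0 < t) {b D : ℝ} (hb : b ≤ β) (hD : 0 ≤ D)
    (h : TwoMin (timeK t) b D) (hle : D ≤ b * timeS t) :
    point β (timeS t) b D ∈ badAt β t := by
  refine ⟨point_mem hβ (timeS_pos ht) hb hle (by linarith), ?_⟩
  rwa [point_sum hβ, point_sub hβ (timeS_pos ht)]

lemma mirror_mem_badAt {β t : ℝ} {ν : SignType → ℝ} (h : ν ∈ badAt β t) :
    mirror ν ∈ badAt β t := by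
  obtain ⟨hν, h2⟩ := h
  have hs := hν.2
  refine ⟨⟨fun e => hν.1 _, ?_⟩, ?_⟩
  · rw [sum_signType] at hs ⊢
    simp [mirror]
    linarith
  · have e1 : mirror ν 1 + mirror ν (-1) = ν 1 + ν (-1) := by simp [mirror]; ring
    have e2 : timeS t * (β * (mirror ν 1 - mirror ν (-1)))
        = -(timeS t * (β * (ν 1 - ν (-1)))) := by simp [mirror]; ring
    rw [e1, e2, twoMin_neg]
    exact h2

/-- Every bad measure lies on the axis, or it or its mirror image has more spins `1`. -/
lemma badAt_cases {β t : ℝ} (hβ : 0 < β) (ht : 0 < t) {ν : SignType → ℝ} (h : ν ∈ badAt β t) :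
    (∃ b, 0 ≤ b ∧ b ≤ β ∧ AxisBad (timeK t) b ∧ ν = point β (timeS t) b 0) ∨
    (∃ b D, b ≤ β ∧ 0 < D ∧ TwoMin (timeK t) b D ∧ ν = point β (timeS t) b D) ∨
    ∃ b D, b ≤ β ∧ 0 < D ∧ TwoMin (timeK t) b D ∧ ν = mirror (point β (timeS t) b D) := by
  obtain ⟨hν, h2⟩ := h
  have hS := timeS_pos ht
  have hK := timeK_pos ht
  have hs := hν.2
  rw [sum_signType] at hs
  have hν0 := hν.1 0
  have hν1 := hν.1 1
  have hν2 := hν.1 (-1)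
  have hb : β * (ν 1 + ν (-1)) ≤ β := by nlinarith
  have hb0 : 0 ≤ β * (ν 1 + ν (-1)) := by positivity
  have hpt := eq_point hβ hS hν
  generalize β * (ν 1 + ν (-1)) = b at *
  generalize timeS t * (β * (ν 1 - ν (-1))) = D at *
  rcases lt_trichotomy D 0 with hD | rfl | hD
  · refine Or.inr (Or.inr ⟨b, -D, hb, by linarith, twoMin_neg.2 h2, ?_⟩)
    rw [mirror_point, neg_neg]
    exact hpt
  · exact Or.inl ⟨b, hb0, hb, (twoMin_zero_iff hK hb0).1 h2, hpt⟩
  · exact Or.inr (Or.inl ⟨b, D, hb, hD, h2, hpt⟩)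

lemma axis_mem_badAt {β t : ℝ} (hβ : 0 < β) (ht : 0 < t) {b : ℝ} (hb : b ≤ β)
    (h : AxisBad (timeK t) b) : point β (timeS t) b 0 ∈ badAt β t := by
  have hb0 := h.pos (timeK_pos ht)
  have := timeS_pos ht
  exact point_mem_badAt hβ ht hb le_rfl ((twoMin_zero_iff (timeK_pos ht) hb0.le).2 h)
    (by positivity)

lemma off_axis_mem_badAt {β t : ℝ} (hβ : 0 < β) (ht : 0 < t) {b D : ℝ} (hb : b ≤ β) (hD : 0 < D)
    (h : TwoMin (timeK t) b D) : point β (timeS t) b D ∈ badAt β t :=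
  point_mem_badAt hβ ht hb hD.le h
    (h.lt_mul (timeK_pos ht) (timeS_pos ht) (timeK_sq_sub ht) hD).le

lemma symPoint_eq {β : ℝ} (hβ : 0 < β) (S r : ℝ) : symPoint r = point β S (β * (1 - r)) 0 := by
  ext e
  rcases signType_cases e with rfl | rfl | rfl
  · rw [point_zero]; simp [symPoint]; field_simp; ring
  · rw [point_one]; simp [symPoint]; field_simp
  · rw [point_neg_one]; simp [symPoint]; field_simp

lemma badAt_eq_empty {β t : ℝ} (hβ : 0 < β) (ht : 0 < t)
    (h : ∀ b ≤ β, Monotonic (timeK t) b) : badAt β t = ∅ := by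
  have hK := timeK_pos ht
  rw [eq_empty_iff_forall_notMem]
  intro ν hν
  have hs := hν.1.2
  rw [sum_signType] at hs
  have hν0 := hν.1.1 0
  have hν1 := hν.1.1 1
  have hν2 := hν.1.1 (-1)
  exact (h _ (by nlinarith)).not_twoMin hK (by positivity) _ hν.2

/-- If `K ≤ 2` or `β ≤ 3`, coexistence occurs on the axis only. -/
lemma badAt_eq_line {β t : ℝ} (hβ : 0 < β) (ht : 0 < t) (h : timeK t ≤ 2 ∨ β ≤ 3) :
    badAt β t = symPoint '' Ico 0 (1 - (timeK t + 1) / β) := by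
  have hK := timeK_pos ht
  have hax : ∀ b ≤ β, AxisBad (timeK t) b ↔ timeK t + 1 < b := by
    intro b hb
    refine ⟨fun hax => ?_, axisBad_of_lt hK⟩
    by_contra! hle
    have h3 : b ≤ 3 := by rcases h with h | h <;> linarith
    exact Monotonic.not_axisBad hK (Or.inl ⟨h3, hle⟩) hax
  have hoff : ∀ b ≤ β, ∀ D, 0 < D → ¬ TwoMin (timeK t) b D := by
    intro b hb D hD h2
    have hnot := h2.not_axisBad hK hD
    obtain ⟨m, hm, rfl, -⟩ := (twoMin_pos_iff hK hD).1 h2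
    have := three_lt_inflLevel hm
    rcases h with h | h
    · exact hnot (axisBad_of_lt hK (by linarith))
    · linarith
  ext ν
  constructor
  · intro hν
    rcases badAt_cases hβ ht hν with ⟨b, -, hb, hab, rfl⟩ | ⟨b, D, hb, hD, h2, -⟩ |
      ⟨b, D, hb, hD, h2, -⟩
    · rw [hax b hb] at hab
      refine ⟨1 - b / β, ⟨?_, ?_⟩, ?_⟩
      · have : b / β ≤ 1 := by rwa [div_le_one hβ]
        linarith
      · have := div_lt_div_of_pos_right hab hβ
        linarith
      · rw [symPoint_eq hβ (timeS t)]
        congr 1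
        field_simp
        ring
    · exact absurd h2 (hoff b hb D hD)
    · exact absurd h2 (hoff b hb D hD)
  · rintro ⟨r, ⟨hr0, hr1⟩, rfl⟩
    rw [symPoint_eq hβ (timeS t)]
    have hb : β * (1 - r) ≤ β := by nlinarith
    refine axis_mem_badAt hβ ht hb ((hax _ hb).2 ?_)
    have h1 : (timeK t + 1) / β < 1 - r := by linarith
    rw [div_lt_iff₀ hβ] at h1
    linarith

/-- The bad measures off the axis form an arm and its mirror image. The arm is parametrised by the
inflection point `m`, which runs from `v` down to the point `u` where the two minimisers merge. -/
lemma exists_arm {β t : ℝ} (hβ : 0 < β) (ht : 0 < t) {u v : ℝ} (hu : 0 < u) (huv : u < v)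
    (hcrit : critK u = timeK t) (hv : inflLevel v ≤ β)
    (hax : ∀ m, u ≤ m → m < v → ¬ AxisBad (timeK t) (inflLevel m))
    (hv0 : HalfMin (timeK t) (inflLevel v) 0 0)
    (hmax : ∀ m, 0 < m → inflLevel m ≤ β → ¬ AxisBad (timeK t) (inflLevel m) → m ≤ v) :
    ∃ c D₀, IsArm c ∧ 0 ≤ D₀ ∧ Coexist (timeK t) v D₀ ∧
      c 0 = point β (timeS t) (inflLevel v) D₀ ∧
      badAt β t = {ν | ∃ b ≤ β, AxisBad (timeK t) b ∧ ν = point β (timeS t) b 0} ∪ armPair c := by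
  have hK := timeK_pos ht
  have hS := timeS_pos ht
  have hex : ∀ m ∈ Icc u v, ∃ D, 0 ≤ D ∧ Coexist (timeK t) m D := by
    intro m hm
    have hm0 : 0 < m := hu.trans_le hm.1
    refine exists_coexist hK hm0 ?_
    rcases hm.2.eq_or_lt with rfl | hlt
    · exact hv0
    · exact halfMin_zero_of_not_axisBad hK (by linarith [three_lt_inflLevel hm0])
        (hax m hm.1 hlt)
  choose! f hf0 hf using hex
  have hfc := continuousOn_of_coexist hK hu hf0 hf
  set p : ℝ → ℝ := fun s => v + s * (u - v) with hp
  have hpmem : ∀ s ∈ Icc (0 : ℝ) 1, p s ∈ Icc u v := by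
    intro s hs
    simp only [hp]
    constructor <;> nlinarith [hs.1, hs.2]
  have hpc : Continuous p := by fun_prop
  set c : ℝ → SignType → ℝ := fun s => point β (timeS t) (inflLevel (p s)) (f (p s)) with hc
  have hbc : ContinuousOn (fun s => inflLevel (p s)) (Icc 0 1) :=
    continuousOn_inflLevel.comp hpc.continuousOn fun s hs => hu.trans_le (hpmem s hs).1
  have hDc : ContinuousOn (fun s => f (p s)) (Icc 0 1) := hfc.comp hpc.continuousOn hpmem
  have harm : IsArm c := by
    refine ⟨?_, ?_, ?_⟩
    · rw [continuousOn_pi]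
      intro e
      simp only [hc, point]
      split_ifs
      · exact continuousOn_const.sub (hbc.div_const _)
      · exact (hbc.add ((hDc.div_const _).mul_const _)).div_const _
    · intro s hs s' hs' hlt
      simp only [hc, point_zero]
      have h1 : inflLevel (p s') < inflLevel (p s) :=
        strictMonoOn_inflLevel (hu.trans_le (hpmem s' hs').1) (hu.trans_le (hpmem s hs).1)
          (by simp only [hp]; nlinarith)
      have := div_lt_div_of_pos_right h1 hβ
      linarith
    · intro s hs
      have hmem := hpmem s ⟨hs.1.le, hs.2⟩
      have hpos : 0 < f (p s) := (hf _ hmem).pos (hu.trans_le hmem.1) (hf0 _ hmem)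
        (hax _ hmem.1 (by simp only [hp]; nlinarith [hs.1]))
      simp only [hc, point_one, point_neg_one]
      have : 0 < f (p s) / timeS t := div_pos hpos hS
      apply div_lt_div_of_pos_right _ (by linarith)
      linarith
  -- A coexistence point above `u` lies on the arm.
  have hon : ∀ b D, b ≤ β → 0 < D → TwoMin (timeK t) b D →
      point β (timeS t) b D ∈ c '' Ico 0 1 := by
    intro b D hb hD h2
    have hnot := h2.not_axisBad hK hD
    obtain ⟨m, hm, rfl, hKm, hco⟩ := (twoMin_pos_iff hK hD).1 h2
    have hmv := hmax m hm hb hnot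
    have hum : u < m := by
      rw [← hcrit] at hKm
      exact (strictMonoOn_critK.lt_iff_lt (mem_Ioi.2 hu) (mem_Ioi.2 hm)).1 hKm
    have hvu : 0 < v - u := by linarith
    have hps : p ((v - m) / (v - u)) = m := by
      simp only [hp]; field_simp; ring
    refine ⟨(v - m) / (v - u), ⟨div_nonneg (by linarith) hvu.le, ?_⟩, ?_⟩
    · rw [div_lt_one hvu]; linarith
    · simp only [hc, hps]
      rw [(hf m ⟨hum.le, hmv⟩).unique hK (hf0 m ⟨hum.le, hmv⟩) hD.le hco]
  -- Conversely the arm consists of coexistence points; only its start can be on the axis.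
  have hbad : ∀ x ∈ c '' Ico 0 1, x ∈ badAt β t := by
    rintro x ⟨s, hs, rfl⟩
    have hmem := hpmem s ⟨hs.1, hs.2.le⟩
    have hm0 : 0 < p s := hu.trans_le hmem.1
    have hum : u < p s := by simp only [hp]; nlinarith [hs.2]
    have hb : inflLevel (p s) ≤ β :=
      (strictMonoOn_inflLevel.monotoneOn hm0 (hu.trans huv) hmem.2).trans hv
    simp only [hc]
    rcases (hf0 _ hmem).eq_or_lt with h0 | h0
    · rw [← h0]
      refine axis_mem_badAt hβ ht hb ?_
      by_contra hnot
      have := (hf _ hmem).pos hm0 (hf0 _ hmem) hnot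
      linarith
    · refine off_axis_mem_badAt hβ ht hb h0 ((twoMin_pos_iff hK h0).2
        ⟨p s, hm0, rfl, ?_, hf _ hmem⟩)
      rw [← hcrit]
      exact strictMonoOn_critK hu hm0 hum
  have hvmem : v ∈ Icc u v := ⟨huv.le, le_rfl⟩
  refine ⟨c, f v, harm, hf0 v hvmem, hf v hvmem, by simp [hc, hp], ?_⟩
  ext ν
  constructor
  · intro hν
    rcases badAt_cases hβ ht hν with ⟨b, -, hb, hab, rfl⟩ | ⟨b, D, hb, hD, h2, rfl⟩ |
      ⟨b, D, hb, hD, h2, rfl⟩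
    · exact Or.inl ⟨b, hb, hab, rfl⟩
    · exact Or.inr (Or.inl (hon b D hb hD h2))
    · exact Or.inr (Or.inr ⟨_, hon b D hb hD h2, rfl⟩)
  · rintro (⟨b, hb, hab, rfl⟩ | h | ⟨x, hx, rfl⟩)
    · exact axis_mem_badAt hβ ht hb hab
    · exact hbad _ h
    · exact mirror_mem_badAt (hbad _ hx)

/-! ### Shape of the bad set -/

lemma isGrowingLine_of_eq {β : ℝ} (hβ : 0 < β) {B : ℝ → Set (SignType → ℝ)} {I : Set ℝ}
    (hI : ∀ t ∈ I, 0 < t) (hlt : ∀ t ∈ I, timeK t + 1 < β)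
    (hB : ∀ t ∈ I, B t = symPoint '' Ico 0 (1 - (timeK t + 1) / β)) : IsGrowingLine B I := by
  refine ⟨fun t => 1 - (timeK t + 1) / β, fun s hs t ht hst => ?_, fun t ht => ⟨?_, hB t ht⟩⟩
  · have h1 := (timeK_lt_iff (hI t ht) (hI s hs)).2 hst
    have h2 : (timeK t + 1) / β < (timeK s + 1) / β := div_lt_div_of_pos_right (by linarith) hβ
    change 1 - (timeK s + 1) / β < 1 - (timeK t + 1) / β
    linarith
  · have : (timeK t + 1) / β < 1 := by rw [div_lt_one hβ]; exact hlt t ht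
    linarith

/-- Below the critical value of `K` there is a bad measure on the edge without holes. -/
lemma badAt_nonempty {β t m : ℝ} (hβ : 0 < β) (ht : 0 < t) (hm : 0 < m) (hmβ : inflLevel m = β)
    (hK : timeK t < critK m) : (badAt β t).Nonempty := by
  have hK0 := timeK_pos ht
  by_cases hax : AxisBad (timeK t) β
  · exact ⟨_, axis_mem_badAt hβ ht le_rfl hax⟩
  · subst hmβ
    obtain ⟨D, hD, hco⟩ := exists_coexist hK0 hm (halfMin_zero_of_not_axisBad hK0 hβ.le hax)
    have hD' := hco.pos hm hD hax
    exact ⟨_, off_axis_mem_badAt hβ ht le_rfl hD' ((twoMin_pos_iff hK0 hD').2 ⟨m, hm, rfl, hK, hco⟩)⟩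

lemma continuous_mirror : Continuous mirror := by unfold mirror; fun_prop

/-- Before coexistence reaches the axis, the bad set consists of two disjoint curves. -/
lemma isTwoCurves_badAt {β t m : ℝ} (hβ : 0 < β) (ht : 0 < t) (hm : 0 < m) (hmβ : inflLevel m = β)
    (hK : timeK t < critK m) (hK2 : 2 < timeK t) (hax : ¬ AxisBad (timeK t) β) :
    IsTwoCurves (badAt β t) := by
  have hK0 := timeK_pos ht
  obtain ⟨u, hu, hcrit⟩ := exists_critK_eq hK2
  have hum : u < m := by
    rw [← hcrit] at hK
    exact (strictMonoOn_critK.lt_iff_lt (mem_Ioi.2 hu) (mem_Ioi.2 hm)).1 hK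
  have hax' : ∀ b ≤ β, ¬ AxisBad (timeK t) b := fun b hb h => hax (h.mono hK0 hb)
  obtain ⟨c, D₀, harm, hD₀, hco, hc0, hbad⟩ := exists_arm hβ ht hu hum hcrit hmβ.le
    (fun k hk hkm => hax' _ (hmβ ▸ (strictMonoOn_inflLevel (hu.trans_le hk) hm hkm).le))
    (halfMin_zero_of_not_axisBad hK0 (hmβ ▸ hβ.le) (hmβ ▸ hax))
    (fun k hk hkβ _ => (strictMonoOn_inflLevel.le_iff_le hk hm).1 (hmβ ▸ hkβ))
  have hD₀' : 0 < D₀ := hco.pos hm hD₀ (hmβ ▸ hax)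
  refine ⟨c, harm, ?_, ?_, ?_⟩
  · rw [hc0, point_zero, hmβ, div_self hβ.ne', sub_self]
  · rw [hbad, union_eq_right]
    rintro ν ⟨b, hb, h, -⟩
    exact absurd h (hax' b hb)
  · have hside : ∀ x ∈ c '' Icc 0 1, x (-1) < x 1 := by
      rintro x ⟨s, hs, rfl⟩
      rcases hs.1.eq_or_lt with rfl | h0
      · rw [hc0, point_one, point_neg_one]
        have : 0 < D₀ / timeS t := div_pos hD₀' (timeS_pos ht)
        apply div_lt_div_of_pos_right _ (by linarith)
        linarith
      · exact harm.2.2 s ⟨h0, hs.2⟩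
    have hcomp : IsCompact (c '' Icc 0 1) := isCompact_Icc.image_of_continuousOn harm.1
    have hsub : c '' Ico 0 1 ⊆ c '' Icc 0 1 := image_mono Ico_subset_Icc_self
    have h1 : closure (c '' Ico 0 1) ⊆ c '' Icc 0 1 := closure_minimal hsub hcomp.isClosed
    have h2 : closure (mirror '' (c '' Ico 0 1)) ⊆ mirror '' (c '' Icc 0 1) :=
      closure_minimal (image_mono hsub) (hcomp.image continuous_mirror).isClosed
    refine Disjoint.mono h1 h2 (disjoint_left.2 ?_)
    rintro x hx ⟨z, hz, rfl⟩
    have e1 := hside _ hx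
    have e2 := hside _ hz
    simp [mirror] at e1
    linarith

/-- Coexistence reaches the axis first on the edge without holes. -/
lemma isTouchingCurves_badAt {β t m : ℝ} (hβ : 0 < β) (ht : 0 < t) (hm : 0 < m)
    (hmβ : inflLevel m = β) (hK : timeK t < critK m) (hK2 : 2 < timeK t)
    (hax : AxisBad (timeK t) β) (hnot : ∀ b < β, ¬ AxisBad (timeK t) b) :
    IsTouchingCurves (badAt β t) := by
  have hK0 := timeK_pos ht
  obtain ⟨u, hu, hcrit⟩ := exists_critK_eq hK2
  have hum : u < m := by
    rw [← hcrit] at hK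
    exact (strictMonoOn_critK.lt_iff_lt (mem_Ioi.2 hu) (mem_Ioi.2 hm)).1 hK
  have h0 : HalfMin (timeK t) (inflLevel m) 0 0 :=
    halfMin_zero_of_forall_not_axisBad hK0 (by rwa [hmβ])
  obtain ⟨c, D₀, harm, hD₀, hco, hc0, hbad⟩ := exists_arm hβ ht hu hum hcrit hmβ.le
    (fun k hk hkm => hnot _ (hmβ ▸ strictMonoOn_inflLevel (hu.trans_le hk) hm hkm)) h0
    (fun k hk hkβ _ => (strictMonoOn_inflLevel.le_iff_le hk hm).1 (hmβ ▸ hkβ))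
  obtain rfl : D₀ = 0 := hco.eq_zero hK0 hm hD₀ (hmβ ▸ hax) h0
  refine ⟨c, harm, ?_, ?_⟩
  · rw [hc0, symPoint_eq hβ (timeS t), hmβ, sub_zero, mul_one]
  · rw [hbad, union_eq_right]
    rintro ν ⟨b, hb, h, rfl⟩
    obtain rfl : b = β := le_antisymm hb (not_lt.1 fun hlt => hnot b hlt h)
    exact Or.inl ⟨0, ⟨le_rfl, one_pos⟩, by rw [hc0, hmβ]⟩

/-- Once coexistence occurs on the axis also with few holes, the bad set is Y-shaped. -/
lemma isYShaped_badAt {β t : ℝ} (hβ : 0 < β) (ht : 0 < t) (hK2 : 2 < timeK t) {b₀ : ℝ}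
    (hb₀ : b₀ < β) (hax : AxisBad (timeK t) b₀) : IsYShaped (badAt β t) := by
  have hK0 := timeK_pos ht
  obtain ⟨B, hBK, hB⟩ := exists_axisBad_threshold hK2
  have hBβ : B < β := ((hB b₀).1 hax).trans_lt hb₀
  have hBax : AxisBad (timeK t) B := (hB B).2 le_rfl
  have hB3 : 3 < B := by
    by_contra! h3
    exact Monotonic.not_axisBad hK0 (Or.inl ⟨h3, by linarith⟩) hBax
  obtain ⟨v, hv, hvB⟩ := exists_inflLevel_eq hB3
  obtain ⟨u, hu, hcrit⟩ := exists_critK_eq hK2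
  have huv : u < v := by
    by_contra! hvu
    exact Monotonic.not_axisBad hK0 (Or.inr ⟨v, hv, hvB.symm,
      hcrit ▸ strictMonoOn_critK.monotoneOn hv hu hvu⟩) hBax
  have hnot : ∀ b < B, ¬ AxisBad (timeK t) b := fun b hb h => absurd ((hB b).1 h) (not_le.2 hb)
  have h0 : HalfMin (timeK t) (inflLevel v) 0 0 :=
    halfMin_zero_of_forall_not_axisBad hK0 (by rwa [hvB])
  obtain ⟨c, D₀, harm, hD₀, hco, hc0, hbad⟩ := exists_arm hβ ht hu huv hcrit (hvB ▸ hBβ.le)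
    (fun k hk hkm => hnot _ (hvB ▸ strictMonoOn_inflLevel (hu.trans_le hk) hv hkm)) h0
    (fun k hk _ hkax => by
      by_contra! hlt
      exact hkax ((hB _).2 (hvB ▸ (strictMonoOn_inflLevel hv hk hlt).le)))
  obtain rfl : D₀ = 0 := hco.eq_zero hK0 hv hD₀ (hvB ▸ hBax) h0
  have hBβ' : B / β < 1 := by rwa [div_lt_one hβ]
  refine ⟨1 - B / β, by linarith, c, harm, ?_, ?_⟩
  · rw [hc0, symPoint_eq hβ (timeS t), hvB]
    congr 1
    field_simp
    ring
  · rw [hbad]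
    congr 1
    ext ν
    constructor
    · rintro ⟨b, hb, h, rfl⟩
      have h1 : b / β ≤ 1 := by rwa [div_le_one hβ]
      have h2 : B / β ≤ b / β := div_le_div_of_nonneg_right ((hB b).1 h) hβ.le
      refine ⟨1 - b / β, ⟨by linarith, by linarith⟩, ?_⟩
      rw [symPoint_eq hβ (timeS t)]
      congr 1
      field_simp
      ring
    · rintro ⟨r, hr, rfl⟩
      refine ⟨β * (1 - r), by nlinarith [hr.1], (hB _).2 ?_, symPoint_eq hβ _ r⟩
      have : B / β ≤ 1 - r := by linarith [hr.2]
      rw [div_le_iff₀ hβ] at this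
      linarith

/-- As the critical time is approached from above, the bad measures on one side of the axis
accumulate at a single point: at a stationary point where the slope does not increase, the
parameters are squeezed to the critical ones. -/
lemma eventually_point_mem {β t₁ m : ℝ} (ht₁ : 0 < t₁) (hm : 0 < m)
    (hmβ : inflLevel m = β) (hK : timeK t₁ = critK m) {W : Set (SignType → ℝ)}
    (hW : W ∈ 𝓝 (point β (timeS t₁) β (slope (timeK t₁) β m))) :
    ∀ᶠ t in 𝓝[>] t₁, ∀ b ≤ β, ∀ D, 0 < D → TwoMin (timeK t) b D →
      point β (timeS t) b D ∈ W := by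
  have hd0 : slopeDeriv (timeK t₁) β m = 0 := by
    rw [← hmβ, slopeDeriv_inflLevel _ hm, hK, sub_self]
  have hcK := continuousAt_timeK ht₁
  have hcS := continuousAt_timeS ht₁
  have hF : ContinuousAt (fun x : ℝ × ℝ × ℝ =>
      point β (timeS x.1) x.2.1 (slope (timeK x.1) x.2.1 x.2.2)) (t₁, β, m) := by
    have h1 : ContinuousAt (fun x : ℝ × ℝ × ℝ => timeK x.1) (t₁, β, m) :=
      ContinuousAt.comp (g := timeK) hcK continuousAt_fst
    have h2 : ContinuousAt (fun x : ℝ × ℝ × ℝ => timeS x.1) (t₁, β, m) :=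
      ContinuousAt.comp (g := timeS) hcS continuousAt_fst
    have h3 : ContinuousAt (fun x : ℝ × ℝ × ℝ => slope (timeK x.1) x.2.1 x.2.2) (t₁, β, m) := by
      unfold slope
      fun_prop
    rw [continuousAt_pi]
    intro e
    unfold point
    split_ifs
    · fun_prop
    · exact ((continuousAt_fst.comp continuousAt_snd).add
        ((h3.div h2 (timeS_pos ht₁).ne').mul continuousAt_const)).div_const _
  have hFW := hF.eventually (eventually_mem_set.2 hW)
  rw [nhds_prod_eq, nhds_prod_eq, eventually_prod_iff] at hFW
  obtain ⟨T, hT, V, hV, hTV⟩ := hFW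
  obtain ⟨B, hB, Y, hY, hBY⟩ := eventually_prod_iff.1 hV
  obtain ⟨δ, hδ, hBδ⟩ := Metric.eventually_nhds_iff.1 hB
  have hG : ContinuousAt (fun x : ℝ × ℝ =>
      (timeK x.1 + Real.cosh x.2 + x.2 * Real.sinh x.2) / Real.cosh x.2) (t₁, m) := by
    have h1 : ContinuousAt (fun x : ℝ × ℝ => timeK x.1) (t₁, m) :=
      ContinuousAt.comp (g := timeK) hcK continuousAt_fst
    exact ContinuousAt.div (by fun_prop) (by fun_prop) (Real.cosh_pos m).ne'
  have hGβ : β - δ < (timeK t₁ + Real.cosh m + m * Real.sinh m) / Real.cosh m := by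
    unfold slopeDeriv at hd0
    rw [lt_div_iff₀ (Real.cosh_pos m)]
    have := mul_pos hδ (Real.cosh_pos m)
    linarith
  have hGev := hG.eventually (lt_mem_nhds hGβ)
  rw [nhds_prod_eq] at hGev
  obtain ⟨T', hT', Y', hY', hTY'⟩ := eventually_prod_iff.1 hGev
  obtain ⟨η, hη, hηY⟩ := Metric.eventually_nhds_iff.1 (hY.and hY')
  set ρ := min (η / 2) (m / 2) with hρ
  have hρ0 : 0 < ρ := lt_min (by linarith) (by linarith)
  have hρη : ρ < η := (min_le_left _ _).trans_lt (by linarith)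
  have hρm : ρ < m := (min_le_right _ _).trans_lt (by linarith)
  have hleft : 0 < slopeDeriv (timeK t₁) β (m - ρ) := by
    rw [← hd0, ← hmβ]
    exact strictAntiOn_slopeDeriv _ hm ⟨by linarith, by linarith⟩ ⟨hm.le, le_rfl⟩ (by linarith)
  have hright : 0 < slopeDeriv (timeK t₁) β (m + ρ) := by
    rw [← hd0, ← hmβ]
    exact strictMonoOn_slopeDeriv _ hm (mem_Ici.2 le_rfl) (mem_Ici.2 (by linarith)) (by linarith)
  have hcd : ∀ y, ContinuousAt (fun t => slopeDeriv (timeK t) β y) t₁ := by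
    intro y
    unfold slopeDeriv
    fun_prop
  have hev1 := (hcd (m - ρ)).eventually (lt_mem_nhds hleft)
  have hev2 := (hcd (m + ρ)).eventually (lt_mem_nhds hright)
  have hev : ∀ᶠ t in 𝓝 t₁, (T t ∧ T' t) ∧ 0 < slopeDeriv (timeK t) β (m - ρ) ∧
      0 < slopeDeriv (timeK t) β (m + ρ) := (hT.and hT').and (hev1.and hev2)
  filter_upwards [hev.filter_mono nhdsWithin_le_nhds, self_mem_nhdsWithin]
    with t ⟨⟨htT, htT'⟩, hl, hr⟩ htt b hb D hD h2
  have ht : 0 < t := ht₁.trans htt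
  obtain ⟨y, hy, rfl, hd⟩ := h2.exists_stationary (timeK_pos ht) hD
  have hcy := Real.cosh_pos y
  have hdβ : slopeDeriv (timeK t) β y ≤ 0 := by
    unfold slopeDeriv at hd ⊢
    have := mul_le_mul_of_nonneg_right hb hcy.le
    linarith
  have hy1 : m - ρ < y := by
    by_contra! hle
    have := (strictAntiOn_slopeDeriv (timeK t) hm).antitoneOn (a := y) (b := m - ρ)
      ⟨hy.le, by linarith⟩ ⟨by linarith, by linarith⟩ hle
    rw [hmβ] at this
    linarith
  have hy2 : y < m + ρ := by
    by_contra! hle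
    have := (strictMonoOn_slopeDeriv (timeK t) hm).monotoneOn (a := m + ρ) (b := y)
      (mem_Ici.2 (by linarith)) (mem_Ici.2 (by linarith)) hle
    rw [hmβ] at this
    linarith
  have hyY : Y y ∧ Y' y := hηY (by
    rw [Real.dist_eq, abs_lt]
    constructor <;> linarith)
  have hbB : B b := by
    apply hBδ
    rw [Real.dist_eq, abs_lt]
    have h3 : β - δ < (timeK t + Real.cosh y + y * Real.sinh y) / Real.cosh y :=
      hTY' htT' hyY.2
    rw [lt_div_iff₀ hcy] at h3
    unfold slopeDeriv at hd
    have h4 : (β - δ) * Real.cosh y < b * Real.cosh y := by linarith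
    have h5 := lt_of_mul_lt_mul_right h4 hcy.le
    constructor <;> linarith
  exact hTV htT (hBY hbB hyY.1)

lemma edist_mirror (x y : SignType → ℝ) : edist (mirror x) (mirror y) = edist x y := by
  have key : ∀ x y : SignType → ℝ, edist (mirror x) (mirror y) ≤ edist x y := fun x y =>
    edist_pi_le_iff.2 fun e => edist_le_pi_edist x y (-e)
  refine le_antisymm (key x y) ?_
  have := key (mirror x) (mirror y)
  rwa [mirror_mirror, mirror_mirror] at this

/-- At the critical time the bad set is born as a pair of mirror-image points. -/
lemma tendsto_hausdorffEDist_badAt {β t₁ t₂ m : ℝ} (hβ : 0 < β) (ht₁ : 0 < t₁) (ht₂ : t₁ < t₂)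
    (hm : 0 < m) (hmβ : inflLevel m = β) (hK : timeK t₁ = critK m)
    (hax : ∀ t ∈ Ioo t₁ t₂, ¬ AxisBad (timeK t) β) :
    Tendsto (fun t => Metric.hausdorffEDist (badAt β t)
      {point β (timeS t₁) β (slope (timeK t₁) β m),
        mirror (point β (timeS t₁) β (slope (timeK t₁) β m))}) (𝓝[>] t₁) (𝓝 0) := by
  set p := point β (timeS t₁) β (slope (timeK t₁) β m) with hp
  rw [ENNReal.tendsto_nhds_zero]
  intro r hr
  have hev := eventually_point_mem ht₁ hm hmβ hK (Metric.eball_mem_nhds p hr)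
  filter_upwards [hev, Ioo_mem_nhdsGT ht₂] with t hball ht
  have ht0 : 0 < t := ht₁.trans ht.1
  have hK0 := timeK_pos ht0
  obtain ⟨D, hD, h2⟩ : ∃ D, 0 < D ∧ TwoMin (timeK t) β D := by
    have hnot := hax t ht
    obtain ⟨D, hD, hco⟩ := exists_coexist hK0 hm
      (halfMin_zero_of_not_axisBad hK0 (hmβ ▸ hβ.le) (hmβ ▸ hnot))
    have hD' := hco.pos hm hD (hmβ ▸ hnot)
    refine ⟨D, hD', (twoMin_pos_iff hK0 hD').2 ⟨m, hm, hmβ.symm, ?_, hco⟩⟩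
    rw [← hK]
    exact (timeK_lt_iff ht0 ht₁).2 ht.1
  have hq := hball β le_rfl D hD h2
  have hqbad := off_axis_mem_badAt hβ ht0 le_rfl hD h2
  apply Metric.hausdorffEDist_le_of_mem_edist
  · intro ν hν
    rcases badAt_cases hβ ht0 hν with ⟨b, -, hb, hab, -⟩ | ⟨b, D', hb, hD', h2', rfl⟩ |
      ⟨b, D', hb, hD', h2', rfl⟩
    · exact absurd (hab.mono hK0 hb) (hax t ht)
    · exact ⟨p, Or.inl rfl, (hball b hb D' hD' h2').le⟩
    · exact ⟨mirror p, Or.inr rfl, (edist_mirror _ _).trans_le (hball b hb D' hD' h2').le⟩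
  · rintro x (rfl | rfl)
    · exact ⟨_, hqbad, by rw [edist_comm]; exact hq.le⟩
    · exact ⟨_, mirror_mem_badAt hqbad, by rw [edist_mirror, edist_comm]; exact hq.le⟩

end WidomRowlinson

open WidomRowlinson in
theorem theorem2 (β : ℝ) (hβ : 0 < β) :
    (β ≤ 2 → ∀ α : SignType → ℝ, IsSymmetricApriori α →
      ∀ t : ℝ, 0 ≤ t → SeqGibbs (evolved β α t)) ∧
    (2 < β → β ≤ 3 → ∀ α : SignType → ℝ, IsSymmetricApriori α →
      (∀ t : ℝ, 0 ≤ t →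
        (SeqGibbs (evolved β α t) ↔ t ≤ -(1 / 4) * Real.log (1 - 2 / β))) ∧
      IsGrowingLine (fun t => badSet (evolved β α t))
        (Ioi (-(1 / 4) * Real.log (1 - 2 / β)))) ∧
    (3 < β → ∃ t₁ t₂ : ℝ, 0 < t₁ ∧ t₁ < t₂ ∧ t₂ < Real.log 3 / 4 ∧
      ∀ α : SignType → ℝ, IsSymmetricApriori α →
        (∀ t : ℝ, 0 ≤ t → (SeqGibbs (evolved β α t) ↔ t ≤ t₁)) ∧
        (∃ p ∈ stdSimplex ℝ SignType, p (-1) < p 1 ∧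
          Tendsto (fun t => Metric.hausdorffEDist (badSet (evolved β α t)) {p, mirror p})
            (𝓝[>] t₁) (𝓝 0)) ∧
        (∀ t ∈ Ioo t₁ t₂, IsTwoCurves (badSet (evolved β α t))) ∧
        IsTouchingCurves (badSet (evolved β α t₂)) ∧
        (∀ t ∈ Ioo t₂ (Real.log 3 / 4), IsYShaped (badSet (evolved β α t))) ∧
        IsGrowingLine (fun t => badSet (evolved β α t)) (Ici (Real.log 3 / 4))) := by
  refine ⟨fun h2 α hα t ht => ?_, fun h2 h3 α hα => ?_, fun h3 => ?_⟩
  · rcases ht.eq_or_lt with rfl | ht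
    · exact seqGibbs_zero hβ hα
    · have := one_lt_timeK ht
      exact (seqGibbs_iff_badAt hβ hα ht).2 (badAt_eq_empty hβ ht fun b hb =>
        Or.inl ⟨by linarith, by linarith⟩)
  · have htc : 0 < -(1 / 4) * Real.log (1 - 2 / β) := by
      have h4 : 2 / β < 1 := by rwa [div_lt_one hβ]
      have h5 : 0 < 2 / β := by positivity
      have := Real.log_neg (x := 1 - 2 / β) (by linarith) (by linarith)
      linarith
    refine ⟨fun t ht => ?_, ?_⟩
    · rcases ht.eq_or_lt with rfl | ht
      · exact iff_of_true (seqGibbs_zero hβ hα) htc.le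
      · rw [seqGibbs_iff_badAt hβ hα ht, ← not_lt, ← timeK_add_one_lt_iff ht h2]
        constructor
        · intro hempty hlt
          have := axis_mem_badAt hβ ht le_rfl (axisBad_of_lt (timeK_pos ht) hlt)
          rw [hempty] at this
          exact this
        · intro hle
          exact badAt_eq_empty hβ ht fun b hb => Or.inl ⟨hb.trans h3, hb.trans (not_lt.1 hle)⟩
    · have hpos : ∀ t ∈ Ioi (-(1 / 4) * Real.log (1 - 2 / β)), 0 < t := fun t ht => htc.trans ht
      refine isGrowingLine_of_eq hβ hpos
        (fun t ht => (timeK_add_one_lt_iff (hpos t ht) h2).2 ht) fun t ht => ?_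
      rw [badSet_eq_badAt hβ hα (hpos t ht)]
      exact badAt_eq_line hβ (hpos t ht) (Or.inr h3)
  · obtain ⟨m, hm, hmβ⟩ := exists_inflLevel_eq h3
    obtain ⟨K₂, hK₂, hK₂ax, hK₂not, hK₂lt⟩ := exists_axisBad_maxK h3
    have hcrit0 : 0 < critK m := (Real.cosh_pos m).trans (cosh_lt_critK hm)
    -- At the critical value of `K` the slope is monotone, so that `K₂` lies strictly below it.
    have hK₂₁ : K₂ < critK m := by
      by_contra! hle
      exact Monotonic.not_axisBad hcrit0 (Or.inr ⟨m, hm, hmβ.symm, le_rfl⟩)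
        ((hK₂ax _ hcrit0).2 hle)
    obtain ⟨t₁, ht₁, hKt₁⟩ := exists_timeK_eq (K := critK m) (by linarith)
    obtain ⟨t₂, ht₂, hKt₂⟩ := exists_timeK_eq (K := K₂) (by linarith)
    have ht₁₂ : t₁ < t₂ := (timeK_lt_iff ht₂ ht₁).1 (by rwa [hKt₁, hKt₂])
    have ht₂₃ : t₂ < Real.log 3 / 4 := (timeK_lt_iff log_three_pos ht₂).1
      (by rwa [timeK_log_three, hKt₂])
    refine ⟨t₁, t₂, ht₁, ht₁₂, ht₂₃, fun α hα => ⟨fun t ht => ?_, ?_, fun t ht => ?_, ?_,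
      fun t ht => ?_, ?_⟩⟩
    · rcases ht.eq_or_lt with rfl | ht
      · exact iff_of_true (seqGibbs_zero hβ hα) ht₁.le
      · rw [seqGibbs_iff_badAt hβ hα ht, ← timeK_le_iff ht₁ ht, hKt₁]
        constructor
        · intro hempty
          by_contra! hlt
          obtain ⟨ν, hν⟩ := badAt_nonempty hβ ht hm hmβ hlt
          rw [hempty] at hν
          exact hν
        · refine fun hle => badAt_eq_empty hβ ht fun b hb => ?_
          rcases le_or_gt b 3 with hb3 | hb3
          · exact Or.inl ⟨hb3, by linarith⟩
          · obtain ⟨k, hk, rfl⟩ := exists_inflLevel_eq hb3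
            have hkm : k ≤ m := (strictMonoOn_inflLevel.le_iff_le hk hm).1 (hmβ ▸ hb)
            exact Or.inr ⟨k, hk, rfl, (strictMonoOn_critK.monotoneOn hk hm hkm).trans hle⟩
    · have hmono : Monotonic (timeK t₁) β := Or.inr ⟨m, hm, hmβ.symm, hKt₁.ge⟩
      have hD : 0 < slope (timeK t₁) β m := by
        have := hmono.strictMonoOn (mem_Ici.2 le_rfl) (mem_Ici.2 hm.le) hm
        simpa using this
      have hS := timeS_pos ht₁
      have hDS : slope (timeK t₁) β m < β * timeS t₁ :=
        slope_lt_of_slopeDeriv_nonpos (timeK_pos ht₁) hS (timeK_sq_sub ht₁) hm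
          (by rw [← hmβ, slopeDeriv_inflLevel _ hm, hKt₁, sub_self])
      refine ⟨point β (timeS t₁) β (slope (timeK t₁) β m),
        point_mem hβ hS le_rfl hDS.le (by nlinarith), ?_, ?_⟩
      · rw [point_one, point_neg_one]
        have : 0 < slope (timeK t₁) β m / timeS t₁ := div_pos hD hS
        apply div_lt_div_of_pos_right _ (by linarith)
        linarith
      · refine (tendsto_hausdorffEDist_badAt hβ ht₁ ht₁₂ hm hmβ hKt₁ fun t ht => ?_).congr' ?_
        · rw [hK₂ax _ (timeK_pos (ht₁.trans ht.1)), not_le, ← hKt₂]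
          exact (timeK_lt_iff ht₂ (ht₁.trans ht.1)).2 ht.2
        · filter_upwards [self_mem_nhdsWithin] with t ht
          rw [badSet_eq_badAt hβ hα (ht₁.trans ht)]
    · have ht0 := ht₁.trans ht.1
      rw [badSet_eq_badAt hβ hα ht0]
      have hlt : K₂ < timeK t := hKt₂ ▸ (timeK_lt_iff ht₂ ht0).2 ht.2
      refine isTwoCurves_badAt hβ ht0 hm hmβ (hKt₁ ▸ (timeK_lt_iff ht0 ht₁).2 ht.1)
        (hK₂.trans hlt) ?_
      rw [hK₂ax _ (timeK_pos ht0), not_le]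
      exact hlt
    · rw [badSet_eq_badAt hβ hα ht₂]
      exact isTouchingCurves_badAt hβ ht₂ hm hmβ (hKt₂ ▸ hK₂₁) (hKt₂ ▸ hK₂)
        ((hK₂ax _ (timeK_pos ht₂)).2 hKt₂.le) (hKt₂ ▸ hK₂not)
    · have ht0 := ht₂.trans ht.1
      rw [badSet_eq_badAt hβ hα ht0]
      obtain ⟨b, hb, hax⟩ := hK₂lt (timeK t) (timeK_pos ht0)
        (hKt₂ ▸ (timeK_lt_iff ht0 ht₂).2 ht.1)
      exact isYShaped_badAt hβ ht0
        (timeK_log_three ▸ (timeK_lt_iff log_three_pos ht0).2 ht.2) hb hax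
    · have hpos : ∀ t ∈ Ici (Real.log 3 / 4), 0 < t := fun t ht => log_three_pos.trans_le ht
      have hle : ∀ t ∈ Ici (Real.log 3 / 4), timeK t ≤ 2 := fun t ht =>
        timeK_log_three ▸ (timeK_le_iff (hpos t ht) log_three_pos).2 ht
      refine isGrowingLine_of_eq hβ hpos (fun t ht => by linarith [hle t ht]) fun t ht => ?_
      rw [badSet_eq_badAt hβ hα (hpos t ht)]
      exact badAt_eq_line hβ (hpos t ht) (Or.inl (hle t ht))
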